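/- Throughout, cube complexes are considered with the combinatorial (edge-path) metric on their vertices. Let $X$ be a CAT(0) cube complex, i.e. a simply connected cube complex all of whose vertex links are flag complexes (of arbitrary, possibly infinite, dimension), and let $G$ be a group acting on $X$ by automorphisms without inversion: no $h\in G$ and half-space $H$ satisfy $hH=\overline H$, where $\overline H$ is the half-space opposite to $H$. Two half-spaces $H,K$ are *transverse* if $H\cap K$, $H\cap\overline K$, $\overline H\cap K$, $\overline H\cap\overline K$ are all non-empty; they are *tightly nested* if one is properly contained in the other and no third half-space lies properly between them. Let $g\in G$ be *hyperbolic*: $\ell_g=\min_x d(x,gx)>0$, where $x$ ranges over the vertices of $X$. A *combinatorial axis* of $g$ is a bi-infinite combinatorial geodesic on which $g$ acts as translation by $\ell_g$, oriented in the direction of translation. Let $\mathbb A_g^+$ be the set of half-spaces of $X$ dual to a positively oriented edge of some combinatorial axis of $g$ (the half-space dual to an oriented edge $(x,y)$ is the one that contains $y$ but not $x$), let $\mathbb A_g^-=\{\overline H: H\in\mathbb A_g^+\}$ and $\mathbb A_g=\mathbb A_g^+\cup\mathbb A_g^-$. The *essential characteristic set* of $g$ is the cube complex $E_g=X(\mathbb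 A_g)$ given by the Sageev construction applied to $\mathbb A_g$ (ordered by inclusion, with involution $H\mapsto\overline H$): its vertices are the principal ultrafilters on $\mathbb A_g$, two vertices are adjacent if they differ on exactly one hyperplane, and all cubes whose $1$-skeleta are present are filled in. Its half-spaces are identified with the elements of $\mathbb A_g$, and $\langle g\rangle$ acts on it through its action on $\mathbb A_g$. For vertices $x,y$ of $E_g$, $[x,y]$ is the set of half-spaces in $\mathbb A_g$ that contain $y$ but not $x$. Suppose that $\langle g\rangle$ acts *non-transversely* on $E_g$: for every $H\in\mathbb A_g$, $H$ and $gH$ are not transverse in $E_g$. Then $E_g$ has finite dimension $d$. Let $C$ be any cube of $E_g$ of dimension $d$, and let $A\subseteq\mathbb A_g^+$ be the set of elements of $\mathbb A_g^+$ dual to the edges of $C$. There is a vertex $o$ of $C$ such that $A=[o,y]$ for some vertex $y$ of $C$; let $o$ be any such vertex (the *minimal vertex* of $C$). Put $$[A,gA]=\{K\in\mathbb A_g^+ : H\supseteq K\supseteq H'\text{ for some }H,H'\in A\cup gA\},\qquad [A,gA)=[A,gA]\setminus gA .$$ Give $\mathbb R^d$ its standard integer cubing (with vertex set $\mathbb Z^d$).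 For $1\le i\le d$ let $\mathcal H^i=\{\{x\in\mathbb R^d: x_i\ge n+\tfrac12\}: n\in\mathbb Z\}$, and let $\mathcal H^+(\mathbb R^d)=\mathcal H^1\cup\dots\cup\mathcal H^d$. Then there exist an action of $\langle g\rangle$ on $\mathbb R^d$ by automorphisms of the standard cubing and a $\langle g\rangle$-equivariant cubical embedding $\phi\colon E_g\hookrightarrow\mathbb R^d$, isometric for the combinatorial metrics, such that: 1. $\phi(C)=[0,1]^d$. 2. $\phi$ induces a bijection $\phi_*$ from $\mathbb A_g$ onto the set of half-spaces of $\mathbb R^d$ (where $\phi^{-1}(\phi_*(H))=H$), and $\phi_*(\mathbb A_g^+)=\mathcal H^+(\mathbb R^d)$. 3. The set $[A,gA]\cap\phi_*^{-1}(\mathcal H^1)$ is tightly nested in $E_g$: it is a finite chain $H_1\supset H_2\supset\dots\supset H_n$ whose consecutive members are tightly nested in $E_g$. 4. $[A,gA)=[o,go]$. -/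

import Mathlib

open scoped Pointwise

/-- The `1`-skeleton of the cube `[0,1]^n`: two vertices are adjacent when they differ in exactly
one coordinate. -/
def hypercube (n : ℕ) : SimpleGraph (Fin n → Bool) where
  Adj x y := ∃! i, x i ≠ y i
  symm := ⟨fun x y h => by simpa only [ne_comm] using h⟩
  loopless := ⟨fun x h => by obtain ⟨i, hi, -⟩ := h; exact hi rfl⟩

/-- A cube complex with vertex set `V`, presented by its `1`-skeleton and by the vertex sets of its
cubes. Each cube spans a copy of the `1`-skeleton of some `[0,1]^n`; all vertices and edges are
cubes; and faces of cubes are cubes. (The faces of a cube `C` are exactly the subsets of `C` that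
again span the `1`-skeleton of a cube.) Only complexes whose cubes are embedded and determined by
their vertex sets are presented in this way; this includes all CAT(0) cube complexes. -/
structure CubeComplex (V : Type*) where
  graph : SimpleGraph V
  cubes : Set (Set V)
  isCube : ∀ C ∈ cubes, ∃ n, Nonempty (hypercube n ≃g graph.induce C)
  vertex_mem : ∀ v, {v} ∈ cubes
  edge_mem : ∀ u v, graph.Adj u v → {u, v} ∈ cubes
  face_mem : ∀ C ∈ cubes, ∀ F ⊆ C,
    (∃ m, Nonempty (hypercube m ≃g graph.induce F)) → F ∈ cubes

theorem hypercube_iso_singleton {V : Type*} (G : SimpleGraph V) (v : V) :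
    Nonempty (hypercube 0 ≃g G.induce {v}) := by
  refine ⟨⟨⟨fun _ => ⟨v, rfl⟩, fun _ => Fin.elim0, fun x => Subsingleton.elim _ _,
    fun x => Subsingleton.elim _ _⟩, ?_⟩⟩
  intro x y
  constructor
  · intro h
    exact absurd h (G.induce {v}).irrefl
  · rintro ⟨i, -⟩
    exact i.elim0

theorem hypercube_iso_pair {V : Type*} (G : SimpleGraph V) (u v : V) (h : G.Adj u v) :
    Nonempty (hypercube 1 ≃g G.induce {u, v}) := by
  classical
  have hne := h.ne
  refine ⟨⟨⟨fun x => if x 0 then ⟨v, by simp⟩ else ⟨u, by simp⟩,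
    fun w _ => decide (w.1 = v), ?_, ?_⟩, ?_⟩⟩
  · intro x
    funext i
    have hi : i = 0 := Subsingleton.elim _ _
    subst hi
    by_cases hx : x 0 = true <;> simp [hx, hne]
  · rintro ⟨w, hw⟩
    rcases hw with rfl | hw
    · simp [hne]
    · obtain rfl : w = v := hw
      simp
  · intro x y
    have key : (hypercube 1).Adj x y ↔ x 0 ≠ y 0 := by
      constructor
      · rintro ⟨i, hi, -⟩
        have h0 : i = 0 := Subsingleton.elim _ _
        subst h0
        exact hi
      · intro h0
        exact ⟨0, h0, fun j _ => Subsingleton.elim _ _⟩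
    rw [key]
    cases hx : x 0 <;> cases hy : y 0 <;> simp [hx, hy, h, h.symm]

/-- The cube complex obtained from a graph by adding every cube whose `1`-skeleton is present. -/
def SimpleGraph.cubeCompletion {V : Type*} (G : SimpleGraph V) : CubeComplex V where
  graph := G
  cubes := {C | ∃ n, Nonempty (hypercube n ≃g G.induce C)}
  isCube _ h := h
  vertex_mem v := ⟨0, hypercube_iso_singleton G v⟩
  edge_mem u v h := ⟨1, hypercube_iso_pair G u v h⟩
  face_mem _ _ _ _ h := h

namespace CubeComplex

variable {V : Type*} (X : CubeComplex V)

/-- `C` is a cube of `X` of dimension `n`. -/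
def IsCubeOfDim (n : ℕ) (C : Set V) : Prop :=
  C ∈ X.cubes ∧ Nonempty (hypercube n ≃g X.graph.induce C)

/-- The dimension of a cube complex, `⊤` when the dimensions of its cubes are unbounded. -/
noncomputable def dim : ℕ∞ :=
  sSup {m : ℕ∞ | ∃ (n : ℕ) (C : Set V), X.IsCubeOfDim n C ∧ m = n}

/-! ### CAT(0) cube complexes -/

/-- Homotopy of edge paths relative to their endpoints: the equivalence relation generated by
inserting or deleting a backtrack and by pushing an edge path across a square. -/
inductive Homotopic : ∀ {u v : V}, X.graph.Walk u v → X.graph.Walk u v → Prop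
  | refl {u v : V} (p : X.graph.Walk u v) : Homotopic p p
  | symm {u v : V} {p q : X.graph.Walk u v} : Homotopic p q → Homotopic q p
  | trans {u v : V} {p q r : X.graph.Walk u v} : Homotopic p q → Homotopic q r → Homotopic p r
  | backtrack {u v w x : V} (p : X.graph.Walk u v) (h : X.graph.Adj v w)
      (q : X.graph.Walk v x) :
      Homotopic (p.append (.cons h (.cons h.symm q))) (p.append q)
  | square {u a b c d v : V} (p : X.graph.Walk u a) (hab : X.graph.Adj a b)
      (hbc : X.graph.Adj b c) (had : X.graph.Adj a d) (hdc : X.graph.Adj d c)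
      (q : X.graph.Walk c v) (hsq : {a, b, c, d} ∈ X.cubes) :
      Homotopic (p.append (.cons hab (.cons hbc q))) (p.append (.cons had (.cons hdc q)))

/-- Connected, with every closed edge path null-homotopic (trivial edge-path group). -/
def IsSimplyConnected : Prop :=
  X.graph.Connected ∧ ∀ (v : V) (p : X.graph.Walk v v), X.Homotopic p .nil

/-- The vertices of `link v` are the neighbours of `v`; a cube `C` at `v` contributes the simplex
whose vertices are the neighbours of `v` in `C`. -/
def linkSimplex (v : V) (C : Set V) : Set V := {w ∈ C | X.graph.Adj v w}

/-- The link of `v` is a flag complex: it is a simplicial complex (different cubes at `v` give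
different simplices), and finitely many vertices of the link, pairwise joined by edges of the link,
span a simplex of the link. -/
def IsFlagLink (v : V) : Prop :=
  (∀ C ∈ X.cubes, ∀ C' ∈ X.cubes, v ∈ C → v ∈ C' →
    X.linkSimplex v C = X.linkSimplex v C' → C = C') ∧
  ∀ S : Finset V, (∀ a ∈ S, X.graph.Adj v a) →
    (∀ a ∈ S, ∀ b ∈ S, a ≠ b → ∃ Q ∈ X.cubes, v ∈ Q ∧ X.linkSimplex v Q = {a, b}) →
    ∃ C ∈ X.cubes, v ∈ C ∧ X.linkSimplex v C = S

/-- A cube complex is CAT(0) when it is simply connected and nonpositively curved, that is, all its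
vertex links are flag complexes. -/
structure IsCAT0 : Prop where
  simplyConnected : X.IsSimplyConnected
  flagLink : ∀ v, X.IsFlagLink v

/-! ### Hyperplanes and half-spaces -/

/-- `e` and `f` are opposite edges of a square, i.e. they meet a common midcube of it. -/
def OppositeEdges (e f : Sym2 V) : Prop :=
  ∃ a b c d : V, X.graph.Adj a b ∧ X.graph.Adj b c ∧ X.graph.Adj c d ∧ X.graph.Adj d a ∧
    {a, b, c, d} ∈ X.cubes ∧ e = s(a, b) ∧ f = s(d, c)

/-- The hyperplane dual to the edge `e`, given as the set of all edges that it crosses. -/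
def hyperplane (e : Sym2 V) : Set (Sym2 V) := {f | Relation.EqvGen X.OppositeEdges e f}

/-- The half-spaces of `X`, given by their vertex sets: the components of the complement of a
hyperplane. The opposite half-space `H̄` of `H` is the complement `Hᶜ`. -/
def halfspaces : Set (Set V) :=
  {H | ∃ e ∈ X.graph.edgeSet, ∃ v : V,
    H = {w | (X.graph.deleteEdges (X.hyperplane e)).Reachable v w}}

end CubeComplex

/-- Two half-spaces are transverse when all four intersections are non-empty. -/
def Transverse {W : Type*} (H K : Set W) : Prop :=
  (H ∩ K).Nonempty ∧ (H ∩ Kᶜ).Nonempty ∧ (Hᶜ ∩ K).Nonempty ∧ (Hᶜ ∩ Kᶜ).Nonempty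

/-- With respect to a collection `𝓗` of half-spaces, `H` and `K` are tightly nested when they are
nested and no third element of `𝓗` lies properly between them. -/
def TightlyNested {V : Type*} (𝓗 : Set (Set V)) (H K : Set V) : Prop :=
  (H ⊂ K ∨ K ⊂ H) ∧ ¬ ∃ L ∈ 𝓗, (H ⊂ L ∧ L ⊂ K) ∨ (K ⊂ L ∧ L ⊂ H)

/-- A segment `H₁ ⊃ H₂ ⊃ ⋯ ⊃ Hₙ` in `𝓗`: consecutive elements are tightly nested. -/
def IsSegment {V : Type*} (𝓗 : Set (Set V)) (l : List (Set V)) : Prop :=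
  (∀ H ∈ l, H ∈ 𝓗) ∧ l.IsChain (fun H K => K ⊂ H ∧ TightlyNested 𝓗 H K)

/-! ### The Sageev construction -/

/-- The vertices of the cube complex `X(𝓗)` that the Sageev construction associates with a
collection `𝓗` of half-spaces, ordered by inclusion and with involution `H ↦ Hᶜ`: the principal
ultrafilters on `𝓗`. -/
@[ext]
structure SageevVertex {V : Type*} (𝓗 : Set (Set V)) where
  carrier : Set (Set V)
  subset : carrier ⊆ 𝓗
  /-- exactly one of each pair of opposite half-spaces is chosen -/
  choice : ∀ H ∈ 𝓗, Xor (H ∈ carrier) (Hᶜ ∈ carrier)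
  /-- no two chosen half-spaces are disjoint -/
  meet : ∀ H ∈ carrier, ∀ K ∈ carrier, ¬ H ⊆ Kᶜ
  /-- the descending chain condition -/
  dcc : carrier.IsWF

namespace SageevVertex

variable {V : Type*} {𝓗 : Set (Set V)}

instance : Membership (Set V) (SageevVertex 𝓗) := ⟨fun σ H => H ∈ σ.carrier⟩

/-- Two principal ultrafilters are adjacent when they differ on a single hyperplane. -/
def graph (𝓗 : Set (Set V)) : SimpleGraph (SageevVertex 𝓗) where
  Adj σ τ := ∃ H, σ.carrier \ τ.carrier = {H} ∧ τ.carrier \ σ.carrier = {Hᶜ}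
  symm := ⟨fun σ τ ⟨H, h1, h2⟩ => ⟨Hᶜ, h2, by rw [compl_compl]; exact h1⟩⟩
  loopless := ⟨fun σ ⟨H, h1, _⟩ => by
    rw [Set.sdiff_self] at h1
    exact (Set.singleton_ne_empty H) h1.symm⟩

/-- The Sageev complex `X(𝓗)`: cubes are added whenever their `1`-skeleta are present. -/
def complex (𝓗 : Set (Set V)) : CubeComplex (SageevVertex 𝓗) := (graph 𝓗).cubeCompletion

/-- The half-space of `X(𝓗)` corresponding to `H ∈ 𝓗`. -/
def half (𝓗 : Set (Set V)) (H : Set V) : Set (SageevVertex 𝓗) := {σ | H ∈ σ}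

/-- The interval `[σ, τ]`: the half-spaces that contain `τ` but not `σ`. -/
def interval (σ τ : SageevVertex 𝓗) : Set (Set V) := {H ∈ 𝓗 | τ ∈ half 𝓗 H ∧ σ ∉ half 𝓗 H}

/-- Elements that preserve `𝓗` act on the vertices of `X(𝓗)` through their action on `𝓗`. -/
instance {G : Type*} [Group G] [MulAction G V] :
    MulAction (MulAction.stabilizer G 𝓗) (SageevVertex 𝓗) where
  smul g σ :=
    { carrier := (g : G) • σ.carrier
      subset := by
        have h : (g : G) • 𝓗 = 𝓗 := g.2
        calc (g : G) • σ.carrier ⊆ (g : G) • 𝓗 := Set.smul_set_mono σ.subset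
          _ = 𝓗 := h
      choice := by
        intro H hH
        have h : (g : G) • 𝓗 = 𝓗 := g.2
        rw [← h, Set.mem_smul_set_iff_inv_smul_mem] at hH
        rw [Set.mem_smul_set_iff_inv_smul_mem, Set.mem_smul_set_iff_inv_smul_mem,
          Set.smul_set_compl]
        exact σ.choice _ hH
      meet := by
        intro H hH K hK hHK
        rw [Set.mem_smul_set_iff_inv_smul_mem] at hH hK
        refine σ.meet _ hH _ hK ?_
        rw [← Set.smul_set_compl]
        exact Set.smul_set_mono hHK
      dcc := by
        rw [Set.isWF_iff_no_descending_seq]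
        intro f hf hmem
        refine Set.isWF_iff_no_descending_seq.1 σ.dcc (fun n => (g : G)⁻¹ • f n) ?_ ?_
        · intro m n hmn
          have h1 : f n ⊂ f m := hf hmn
          refine ⟨Set.smul_set_mono h1.1, fun h2 => h1.2 ?_⟩
          exact Set.smul_set_subset_smul_set_iff.1 h2
        · intro n
          exact Set.mem_smul_set_iff_inv_smul_mem.1 (hmem n) }
  one_smul σ := SageevVertex.ext (one_smul G σ.carrier)
  mul_smul g h σ := SageevVertex.ext (mul_smul (g : G) (h : G) σ.carrier)

end SageevVertex

/-! ### Automorphisms, axes, and the essential characteristic set -/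

/-- `G` acts on the cube complex `X` by automorphisms. -/
class CubicalAction {V : Type*} (G : Type*) [Group G] [MulAction G V] (X : CubeComplex V) :
    Prop where
  smul_mem : ∀ (g : G), ∀ C ∈ X.cubes, g • C ∈ X.cubes

namespace CubeComplex

variable {V : Type*} (X : CubeComplex V) {G : Type*} [Group G] [MulAction G V]

/-- `g` acts without inversion: no half-space is exchanged with its opposite. -/
def ActsWithoutInversion (g : G) : Prop := ∀ H ∈ X.halfspaces, g • H ≠ Hᶜ

/-- The translation distance `ℓ_g`, the minimum of `d(x, gx)` over the vertices `x`. -/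
noncomputable def translationDist (g : G) : ℕ := ⨅ v : V, X.graph.dist v (g • v)

def IsHyperbolic (g : G) : Prop := X.ActsWithoutInversion g ∧ 0 < X.translationDist g

/-- `L` is a combinatorial axis of `g`, parametrized in the forward direction: a bi-infinite
geodesic on which `g` acts as translation by `ℓ_g`. -/
def IsAxis (g : G) (L : ℤ → V) : Prop :=
  (∀ m n : ℤ, X.graph.dist (L m) (L n) = (m - n).natAbs) ∧
    ∀ n : ℤ, g • L n = L (n + X.translationDist g)

/-- The positive half-space axis `𝔸_g⁺`: the half-spaces dual to a positively oriented edge in a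
combinatorial axis of `g`. -/
def axisPos (g : G) : Set (Set V) :=
  {H ∈ X.halfspaces | ∃ L : ℤ → V, X.IsAxis g L ∧ ∃ n : ℤ, L n ∉ H ∧ L (n + 1) ∈ H}

/-- The full half-space axis `𝔸_g = 𝔸_g⁺ ⊔ 𝔸_g⁻`. -/
def axis (g : G) : Set (Set V) := X.axisPos g ∪ {H | Hᶜ ∈ X.axisPos g}

section Invariance

variable [CubicalAction G X]

theorem smul_adj (g : G) {u v : V} (h : X.graph.Adj u v) : X.graph.Adj (g • u) (g • v) := by
  have h1 : g • ({u, v} : Set V) ∈ X.cubes := CubicalAction.smul_mem g _ (X.edge_mem u v h)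
  have hne : g • u ≠ g • v := fun h0 => h.ne (MulAction.injective g h0)
  have h2 : g • ({u, v} : Set V) = {g • u, g • v} := by
    rw [← Set.image_smul, Set.image_pair]
  rw [h2] at h1
  obtain ⟨n, ⟨e⟩⟩ := X.isCube _ h1
  have hcon : ∀ x y : Fin n → Bool, x ≠ y → (e x).1 ≠ (e y).1 := fun x y hxy h0 =>
    hxy (e.injective (Subtype.ext h0))
  have hex : ∃ x y : Fin n → Bool, (hypercube n).Adj x y := by
    rcases n with _ | n
    · exfalso
      apply hne
      have := e.symm.injective (Subsingleton.elim (e.symm ⟨g • u, by simp⟩)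
        (e.symm ⟨g • v, by simp⟩))
      exact congrArg Subtype.val this
    · refine ⟨fun _ => false, Function.update (fun _ => false) 0 true, 0, by simp, ?_⟩
      intro j hj
      by_contra hj0
      exact hj (by simp [Function.update_of_ne hj0])
  obtain ⟨x, y, hxy⟩ := hex
  have ha : X.graph.Adj (e x).1 (e y).1 := e.map_rel_iff.2 hxy
  have hx := (e x).2
  have hy := (e y).2
  rcases hx with hx | hx <;> rcases hy with hy | hy
  · exact absurd (hx.trans hy.symm) ha.ne
  · rw [hx, Set.mem_singleton_iff.1 hy] at ha
    exact ha
  · rw [hy, Set.mem_singleton_iff.1 hx] at ha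
    exact ha.symm
  · exact absurd ((Set.mem_singleton_iff.1 hx).trans (Set.mem_singleton_iff.1 hy).symm) ha.ne

theorem smul_hyperplane (g : G) {e f : Sym2 V} (h : f ∈ X.hyperplane e) :
    f.map (g • ·) ∈ X.hyperplane (e.map (g • ·)) := by
  change Relation.EqvGen _ _ _ at h
  change Relation.EqvGen _ _ _
  induction h with
  | rel e f h =>
    refine Relation.EqvGen.rel _ _ ?_
    obtain ⟨a, b, c, d, h1, h2, h3, h4, h5, rfl, rfl⟩ := h
    refine ⟨g • a, g • b, g • c, g • d, X.smul_adj g h1, X.smul_adj g h2, X.smul_adj g h3,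
      X.smul_adj g h4, ?_, rfl, rfl⟩
    have h6 := CubicalAction.smul_mem g _ h5
    simpa only [← Set.image_smul, Set.image_insert_eq, Set.image_singleton] using h6
  | refl e => exact Relation.EqvGen.refl _
  | symm e f _ ih => exact Relation.EqvGen.symm _ _ ih
  | trans e f k _ _ ih1 ih2 => exact Relation.EqvGen.trans _ _ _ ih1 ih2

theorem smul_reachable (g : G) {e : Sym2 V} {u v : V}
    (h : (X.graph.deleteEdges (X.hyperplane e)).Reachable u v) :
    (X.graph.deleteEdges (X.hyperplane (e.map (g • ·)))).Reachable (g • u) (g • v) := by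
  let φ : X.graph.deleteEdges (X.hyperplane e) →g
      X.graph.deleteEdges (X.hyperplane (e.map (g • ·))) :=
    { toFun := (g • ·)
      map_rel' := by
        intro a b hab
        rw [SimpleGraph.deleteEdges_adj] at hab ⊢
        refine ⟨X.smul_adj g hab.1, fun h0 => hab.2 ?_⟩
        have h1 := X.smul_hyperplane g⁻¹ h0
        simpa [Sym2.map_map, Function.comp_def] using h1 }
  exact h.map φ

theorem smul_mem_halfspaces (g : G) {H : Set V} (hH : H ∈ X.halfspaces) :
    g • H ∈ X.halfspaces := by
  obtain ⟨e, he, v, rfl⟩ := hH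
  refine ⟨e.map (g • ·), ?_, g • v, ?_⟩
  · induction e with
    | _ a b => exact X.smul_adj g he
  · ext w
    rw [Set.mem_smul_set_iff_inv_smul_mem]
    constructor
    · intro h
      simpa using X.smul_reachable g h
    · intro h
      have h1 := X.smul_reachable g⁻¹ h
      simpa [Sym2.map_map, Function.comp_def] using h1

theorem smul_mem_axisPos (g : G) {H : Set V} (hH : H ∈ X.axisPos g) : g • H ∈ X.axisPos g := by
  obtain ⟨h1, L, hL, n, h2, h3⟩ := hH
  refine ⟨X.smul_mem_halfspaces g h1, L, hL, n + X.translationDist g, ?_, ?_⟩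
  · rwa [← hL.2, Set.smul_mem_smul_set_iff]
  · rw [add_right_comm, ← hL.2, Set.smul_mem_smul_set_iff]
    exact h3

theorem inv_smul_mem_axisPos (g : G) {H : Set V} (hH : H ∈ X.axisPos g) :
    g⁻¹ • H ∈ X.axisPos g := by
  obtain ⟨h1, L, hL, n, h2, h3⟩ := hH
  have key : ∀ m : ℤ, L m = g • L (m - X.translationDist g) := fun m => by
    rw [hL.2, sub_add_cancel]
  refine ⟨X.smul_mem_halfspaces g⁻¹ h1, L, hL, n - X.translationDist g, ?_, ?_⟩
  · rw [Set.mem_inv_smul_set_iff, ← key]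
    exact h2
  · rw [Set.mem_inv_smul_set_iff, show n - (X.translationDist g : ℤ) + 1 =
      n + 1 - X.translationDist g by ring, ← key]
    exact h3

theorem zpowers_le_stabilizer_axis (g : G) :
    Subgroup.zpowers g ≤ MulAction.stabilizer G (X.axis g) := by
  rw [Subgroup.zpowers_le, MulAction.mem_stabilizer_iff]
  ext H
  rw [Set.mem_smul_set_iff_inv_smul_mem]
  constructor
  · rintro (h | h)
    · left
      simpa using X.smul_mem_axisPos g h
    · right
      have h1 := X.smul_mem_axisPos g h
      rw [← Set.smul_set_compl] at h1
      simpa using h1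
  · rintro (h | h)
    · exact Or.inl (X.inv_smul_mem_axisPos g h)
    · right
      have h1 := X.inv_smul_mem_axisPos g h
      rw [Set.smul_set_compl] at h1
      exact h1

end Invariance

/-- The vertices of the essential characteristic set `X(𝔸_g)` of `g`. -/
abbrev EssVertex (g : G) : Type _ := SageevVertex (X.axis g)

/-- The essential characteristic set of `g`: the Sageev complex `X(𝔸_g)`. -/
abbrev ess (g : G) : CubeComplex (X.EssVertex g) := SageevVertex.complex (X.axis g)

/-- The action of `⟨g⟩` on the essential characteristic set, induced by its action on `𝔸_g`. -/
instance [CubicalAction G X] (g : G) : MulAction (Subgroup.zpowers g) (X.EssVertex g) :=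
  MulAction.compHom _ (Subgroup.inclusion (X.zpowers_le_stabilizer_axis g))

/-- `⟨g⟩` acts non-transversely on the essential characteristic set: for `H ∈ 𝔸_g`, the
half-spaces of `X(𝔸_g)` given by `H` and `gH` are not transverse. -/
def ActsNonTransversely (g : G) : Prop :=
  ∀ H ∈ X.axis g,
    ¬ Transverse (SageevVertex.half (X.axis g) H) (SageevVertex.half (X.axis g) (g • H))

/-- The elements of `𝔸_g⁺` dual to the edges of a cube `C` of the essential characteristic set. -/
def dualPos (g : G) (C : Set (X.EssVertex g)) : Set (Set V) :=
  {H ∈ X.axisPos g | ∃ x ∈ C, ∃ y ∈ C, (X.ess g).graph.Adj x y ∧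
    x ∉ SageevVertex.half (X.axis g) H ∧ y ∈ SageevVertex.half (X.axis g) H}

/-- `o` is the minimal vertex of the cube `C`: the elements of `𝔸_g⁺` dual to `C` form the interval
`[o, y]` for a vertex `y` of `C`. -/
def IsMinimalVertex (g : G) (C : Set (X.EssVertex g)) (o : X.EssVertex g) : Prop :=
  o ∈ C ∧ ∃ y ∈ C, X.dualPos g C = SageevVertex.interval o y

/-- `[A, gA]`, computed in `𝔸_g⁺` ordered by inclusion. -/
def closedSpan (g : G) (A : Set (Set V)) : Set (Set V) :=
  {K ∈ X.axisPos g | ∃ H ∈ A ∪ g • A, ∃ H' ∈ A ∪ g • A, H' ⊆ K ∧ K ⊆ H}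

/-- `[A, gA) = [A, gA] - gA`. -/
def halfOpenSpan (g : G) (A : Set (Set V)) : Set (Set V) := X.closedSpan g A \ (g • A)

end CubeComplex

/-! ### The standard cubing of `ℝ^d` -/

/-- The standard integer cubing of `ℝ^d`: the vertices are the integer points, the edges are the
unit segments parallel to a coordinate axis, and all cubes are filled in. -/
def stdCubing (d : ℕ) : CubeComplex (Fin d → ℤ) :=
  SimpleGraph.cubeCompletion
    { Adj := fun x y => ∃ i, (y i = x i + 1 ∨ x i = y i + 1) ∧ ∀ j, j ≠ i → x j = y j
      symm := ⟨fun _ _ ⟨i, h1, h2⟩ => ⟨i, h1.symm, fun j hj => (h2 j hj).symm⟩⟩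
      loopless := ⟨fun _ ⟨_, h1, _⟩ => by omega⟩ }

/-- The cube `[0,1]^d`. -/
def unitCube (d : ℕ) : Set (Fin d → ℤ) := {x | ∀ i, x i = 0 ∨ x i = 1}

/-- `𝓗^i`, the set of the half-spaces `H^i_n = {x | x_i ≥ n + 1/2}` of `ℝ^d` with `n ∈ ℤ`. -/
def coordHalfspaces (d : ℕ) (i : Fin d) : Set (Set (Fin d → ℤ)) :=
  {K | ∃ n : ℤ, K = {x | (n : ℝ) + 1 / 2 ≤ (x i : ℝ)}}

/-- `𝓗⁺(ℝ^d)`, the union of the sets `𝓗^i`. -/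
def stdPosHalfspaces (d : ℕ) : Set (Set (Fin d → ℤ)) := ⋃ i, coordHalfspaces d i

/-! ### Faces of cubes -/

/-! The theorem is an equivariant form of Dilworth's theorem for the poset of positive half-spaces,
translated into geometry through ultrafilters.

Geometry enters only to show that this poset is ranked. From simple connectivity and flag links one
needs that a geodesic crosses a hyperplane at most once. Edge paths are considered up to pushing
across squares, and a path is reduced if no such pushing creates a backtrack. Prolonging a reduced
path by an edge, or cancelling its last edge, is well defined up to squares (`step`), and it
respects backtracks and squares. So homotopic paths act alike, and reduced paths with common
endpoints differ by square moves (`IsCAT0.swapEq_of_reduced`). This gives the quadrangle condition.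
With the bipartiteness of the graph it follows that parallel edges are oriented alike by the
distance from any vertex (`IsCAT0.sameSide_iff`).

Fix an axis of `g` and rank each positive half-space by the place where the axis enters it. Ranks
are distinct, they reverse inclusion, and `g` raises them by the translation length `ℓ`. Two
positive half-spaces are never disjoint and never cover everything, since both contain a forward ray
of the axis and both miss a backward ray. Non-transversality gives `gH ⊂ H`. Hence ranks that agree
modulo `ℓ` belong to one `g`-orbit, which is a chain, and antichains have at most `ℓ` members
(`card_antichain_le`). Let `d` be the width and `A` an antichain of size `d`.

The span of `A` and `gA` is finite, so it is covered by `d` chains, each meeting `A` once and `gA`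
once. Translates of these pieces by powers of `g` fit together into `d` bi-infinite chains that `g`
permutes and shifts (`exists_equivariant_coloring`, `exists_equivariant_chains`). One chain can be
enlarged beforehand to a maximal one, which makes it tightly nested.

A principal ultrafilter cuts each chain at one place and so has `d` integer coordinates. The image
consists of the points compatible with the inclusions between members of the chains
(`IsSageevChart.exists_vertex`). Changing one hyperplane is a unit step in one coordinate, and a
suitably chosen step towards another vertex is always possible, so the coordinates are isometric
(`IsSageevChart.exists_closer`). Cubes of dimension `d` correspond to antichains of size `d`. Taking
`A` dual to `C` and numbering the chains so that `A` has index zero sends `C` to the unit cube. Then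
`g` permutes the coordinates and translates, and the last two claims are read off from the indices.
-/

theorem hypercube_adj_iff {n : ℕ} {x y : Fin n → Bool} :
    (hypercube n).Adj x y ↔ ∃ i, y = Function.update x i (!x i) := by
  constructor
  · rintro ⟨i, hi, hu⟩
    refine ⟨i, funext fun j => ?_⟩
    by_cases hj : j = i
    · subst hj
      cases hx : x j <;> cases hy : y j <;> simp_all
    · rw [Function.update_of_ne hj]
      by_contra hne
      exact hj (hu j (Ne.symm hne))
  · rintro ⟨i, rfl⟩
    refine ⟨i, by simp, fun j hj => ?_⟩
    by_contra hne
    exact hj (by rw [Function.update_of_ne hne])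

/-- The face of a hypercube through `a` in the directions `ι`. -/
noncomputable def hypercubeFace {m n : ℕ} (a : Fin n → Bool) (ι : Fin m ↪ Fin n) :
    hypercube m ↪g hypercube n := by
  classical
  refine ⟨⟨fun y l => xor (a l) (decide (∃ k, ι k = l ∧ y k = true)), ?_⟩, ?_⟩
  · intro y y' h
    funext k
    have := congrFun h (ι k)
    simpa using this
  · intro y y'
    change (∃! l, xor (a l) (decide (∃ k, ι k = l ∧ y k = true)) ≠
      xor (a l) (decide (∃ k, ι k = l ∧ y' k = true))) ↔ ∃! k, y k ≠ y' k
    have key : ∀ k, (xor (a (ι k)) (decide (∃ k', ι k' = ι k ∧ y k' = true)) ≠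
      xor (a (ι k)) (decide (∃ k', ι k' = ι k ∧ y' k' = true))) ↔ y k ≠ y' k := by
      intro k
      simp
    have key2 : ∀ l, (xor (a l) (decide (∃ k, ι k = l ∧ y k = true)) ≠
      xor (a l) (decide (∃ k, ι k = l ∧ y' k = true))) → ∃ k, ι k = l := by
      intro l hl
      by_contra hne
      push Not at hne
      simp [hne] at hl
    constructor
    · rintro ⟨l, hl, hu⟩
      obtain ⟨k, rfl⟩ := key2 l hl
      exact ⟨k, (key k).1 hl, fun k' hk' => ι.injective (hu _ ((key k').2 hk'))⟩
    · rintro ⟨k, hk, hu⟩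
      refine ⟨ι k, (key k).2 hk, fun l hl => ?_⟩
      obtain ⟨k', rfl⟩ := key2 l hl
      rw [hu k' ((key k').1 hl)]

theorem hypercubeFace_apply {m n : ℕ} (a : Fin n → Bool) (ι : Fin m ↪ Fin n) (y : Fin m → Bool)
    (k : Fin m) : hypercubeFace a ι y (ι k) = xor (a (ι k)) (y k) := by
  change xor (a (ι k)) (decide (∃ k', ι k' = ι k ∧ y k' = true)) = _
  congr 1
  simp

theorem hypercubeFace_apply_of_notMem {m n : ℕ} (a : Fin n → Bool) (ι : Fin m ↪ Fin n)
    (y : Fin m → Bool) (l : Fin n) (hl : ∀ k, ι k ≠ l) : hypercubeFace a ι y l = a l := by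
  change xor (a l) (decide (∃ k', ι k' = l ∧ y k' = true)) = _
  simp [hl]

theorem hypercube_no_triangle {n : ℕ} {x y z : Fin n → Bool} (hxy : (hypercube n).Adj x y)
    (hyz : (hypercube n).Adj y z) : ¬ (hypercube n).Adj x z := by
  rintro ⟨k, hk, hku⟩
  obtain ⟨i, hi, hiu⟩ := hxy
  obtain ⟨j, hj, hju⟩ := hyz
  have h1 : ∀ l, l ≠ i → x l = y l := fun l hl => by_contra fun h => hl (hiu l h)
  have h2 : ∀ l, l ≠ j → y l = z l := fun l hl => by_contra fun h => hl (hju l h)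
  by_cases hij : i = j
  · subst hij
    by_cases hki : k = i
    · subst hki
      revert hi hj hk
      cases x k <;> cases y k <;> cases z k <;> simp
    · exact hk ((h1 k hki).trans (h2 k hki))
  · have e1 : x i ≠ z i := by rw [← h2 i hij]; exact hi
    have e2 : x j ≠ z j := by rw [h1 j (Ne.symm hij)]; exact hj
    exact hij ((hku i e1).trans (hku j e2).symm)

/-! ### Squares, links and cubes spanned by three squares. -/

namespace CubeComplex

variable {V : Type*} (X : CubeComplex V)

theorem face_image_mem {C : Set V} (hC : C ∈ X.cubes) {m n : ℕ}
    (e : hypercube n ≃g X.graph.induce C) (ψ : hypercube m ↪g hypercube n) :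
    Set.range (fun y => (e (ψ y) : V)) ∈ X.cubes := by
  refine X.face_mem C hC _ ?_ ⟨m, ?_⟩
  · rintro _ ⟨y, rfl⟩
    exact (e (ψ y)).2
  · let f : hypercube m ↪g X.graph :=
      (SimpleGraph.Embedding.induce C).comp (e.toEmbedding.comp ψ)
    exact ⟨f.isoInduceRange⟩

/-- `a, b, c, d` are the successive vertices of a square of `X`. -/
structure Square (a b c d : V) : Prop where
  ab : X.graph.Adj a b
  bc : X.graph.Adj b c
  cd : X.graph.Adj c d
  da : X.graph.Adj d a
  ac : a ≠ c
  bd : b ≠ d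
  mem : {a, b, c, d} ∈ X.cubes

variable {X}

theorem Square.rotate {a b c d : V} (h : X.Square a b c d) : X.Square b c d a := by
  refine ⟨h.bc, h.cd, h.da, h.ab, h.bd, h.ac.symm, ?_⟩
  convert h.mem using 1
  ext x
  simp only [Set.mem_insert_iff, Set.mem_singleton_iff]
  tauto

theorem Square.reflect {a b c d : V} (h : X.Square a b c d) : X.Square a d c b := by
  refine ⟨h.da.symm, h.cd.symm, h.bc.symm, h.ab.symm, h.ac, h.bd.symm, ?_⟩
  convert h.mem using 1
  ext x
  simp only [Set.mem_insert_iff, Set.mem_singleton_iff]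
  tauto

theorem ncard_cube {C : Set V} (hC : C ∈ X.cubes) : ∃ n, C.ncard = 2 ^ n := by
  obtain ⟨n, ⟨e⟩⟩ := X.isCube C hC
  refine ⟨n, ?_⟩
  rw [← Nat.card_coe_set_eq, ← Nat.card_congr e.toEquiv]
  simp

/-- The number of vertices of a cube is a power of two. This excludes closed paths of length four in
which exactly one pair of opposite vertices coincides. -/
theorem ncard_cube_ne_three {C : Set V} (hC : C ∈ X.cubes) : C.ncard ≠ 3 := by
  obtain ⟨n, hn⟩ := ncard_cube hC
  rw [hn]
  rcases n with _ | _ | n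
  · norm_num
  · norm_num
  · intro h
    have : 2 ^ (n + 2) = 4 * 2 ^ n := by ring
    omega

/-- A closed edge path of length four around a cube is a square, unless it is a single edge. -/
theorem square_or_degenerate {a b c d : V} (hab : X.graph.Adj a b) (hbc : X.graph.Adj b c)
    (hcd : X.graph.Adj c d) (hda : X.graph.Adj d a) (h : {a, b, c, d} ∈ X.cubes) :
    X.Square a b c d ∨ (a = c ∧ b = d) := by
  by_cases hac : a = c
  · subst hac
    right
    refine ⟨rfl, ?_⟩
    by_contra hbd
    refine ncard_cube_ne_three h ?_
    have : ({a, b, a, d} : Set V) = {a, b, d} := by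
      ext x
      simp only [Set.mem_insert_iff, Set.mem_singleton_iff]
      tauto
    rw [this, Set.ncard_eq_three]
    exact ⟨a, b, d, hab.ne, hda.ne.symm, hbd, rfl⟩
  · left
    refine ⟨hab, hbc, hcd, hda, hac, ?_, h⟩
    intro hbd
    subst hbd
    refine ncard_cube_ne_three h ?_
    have : ({a, b, c, b} : Set V) = {a, b, c} := by
      ext x
      simp only [Set.mem_insert_iff, Set.mem_singleton_iff]
      tauto
    rw [this, Set.ncard_eq_three]
    exact ⟨a, b, c, hab.ne, hac, hbc.ne, rfl⟩

/-- Cubes span induced subgraphs and hypercubes have no triangles. Consequently a square contributes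
exactly its two sides at `a` to the link of `a`. -/
theorem Square.not_adj {a b c d : V} (h : X.Square a b c d) : ¬ X.graph.Adj a c := by
  intro hac
  obtain ⟨n, ⟨e⟩⟩ := X.isCube _ h.mem
  let C : Set V := {a, b, c, d}
  let a' : C := ⟨a, by simp [C]⟩
  let b' : C := ⟨b, by simp [C]⟩
  let c' : C := ⟨c, by simp [C]⟩
  have key : ∀ x y : C, X.graph.Adj x.1 y.1 → (hypercube n).Adj (e.symm x) (e.symm y) := by
    intro x y hxy
    exact e.symm.map_rel_iff.2 hxy
  exact hypercube_no_triangle (key a' b' h.ab) (key b' c' h.bc) (key a' c' hac)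

theorem Square.linkSimplex_eq {a b c d : V} (h : X.Square a b c d) :
    X.linkSimplex a {a, b, c, d} = {b, d} := by
  ext x
  simp only [linkSimplex, Set.mem_ofPred_eq, Set.mem_insert_iff, Set.mem_singleton_iff]
  constructor
  · rintro ⟨rfl | rfl | rfl | rfl, hx⟩
    · exact absurd hx (X.graph.irrefl)
    · exact Or.inl rfl
    · exact absurd hx h.not_adj
    · exact Or.inr rfl
  · rintro (rfl | rfl)
    · exact ⟨by simp, h.ab⟩
    · exact ⟨by simp, h.da.symm⟩

/-- In a simplicial link a square is determined by two adjacent edges. -/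
theorem Square.unique (hX : ∀ v, X.IsFlagLink v) {a b c c' d : V} (h : X.Square a b c d)
    (h' : X.Square a b c' d) : c = c' := by
  have hs := (hX a).1 _ h.mem _ h'.mem (by simp) (by simp)
    (h.linkSimplex_eq.trans h'.linkSimplex_eq.symm)
  have hc : c ∈ ({a, b, c', d} : Set V) := by rw [← hs]; simp
  simp only [Set.mem_insert_iff, Set.mem_singleton_iff] at hc
  rcases hc with hc | hc | hc | hc
  · exact absurd hc h.ac.symm
  · exact absurd hc h.bc.ne.symm
  · exact hc
  · exact absurd hc h.cd.ne

theorem square_of_hypercube {C : Set V} (hC : C ∈ X.cubes) {n : ℕ}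
    (e : hypercube n ≃g X.graph.induce C) (a : Fin n → Bool) {i j : Fin n} (hij : i ≠ j) :
    X.Square (e a : V) (e (Function.update a i (!a i)) : V)
      (e (Function.update (Function.update a i (!a i)) j (!a j)) : V)
      (e (Function.update a j (!a j)) : V) := by
  have hcomm : Function.update (Function.update a i (!a i)) j (!a j) =
      Function.update (Function.update a j (!a j)) i (!a i) := Function.update_comm hij _ _ _
  have adj : ∀ x y, (hypercube n).Adj x y → X.graph.Adj (e x : V) (e y : V) := fun x y h =>
    e.map_rel_iff.2 h
  have inj : ∀ x y, x ≠ y → (e x : V) ≠ (e y : V) := fun x y h h0 =>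
    h (e.injective (Subtype.ext h0))
  refine ⟨adj _ _ (hypercube_adj_iff.2 ⟨i, rfl⟩), adj _ _ (hypercube_adj_iff.2 ⟨j, ?_⟩),
    (adj _ _ (hypercube_adj_iff.2 ⟨i, ?_⟩)).symm, (adj _ _ (hypercube_adj_iff.2 ⟨j, rfl⟩)).symm,
    inj _ _ ?_, inj _ _ ?_, ?_⟩
  · rw [Function.update_of_ne hij.symm]
  · rw [hcomm, Function.update_of_ne hij]
  · intro h
    have := congrFun h j
    simp at this
  · intro h
    have := congrFun h j
    rw [Function.update_of_ne hij.symm] at this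
    simp at this
  · let ι : Fin 2 ↪ Fin n := ⟨![i, j], by
      intro p q
      fin_cases p <;> fin_cases q <;> simp [hij, hij.symm]⟩
    convert X.face_image_mem hC e (hypercubeFace a ι) using 1
    have hf : ∀ y : Fin 2 → Bool, hypercubeFace a ι y =
        Function.update (Function.update a i (xor (a i) (y 0))) j (xor (a j) (y 1)) := by
      intro y
      funext l
      by_cases hj : l = j
      · subst hj
        rw [Function.update_self]
        exact hypercubeFace_apply a ι y 1
      · rw [Function.update_of_ne hj]
        by_cases hi : l = i
        · subst hi
          rw [Function.update_self]
          exact hypercubeFace_apply a ι y 0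
        · rw [Function.update_of_ne hi]
          refine hypercubeFace_apply_of_notMem a ι y l ?_
          intro k
          fin_cases k
          · exact Ne.symm hi
          · exact Ne.symm hj
    have hi' : Function.update (Function.update a i (!a i)) j (a j) =
        Function.update a i (!a i) := by
      rw [Function.update_eq_self_iff, Function.update_of_ne hij.symm]
    ext x
    simp only [Set.mem_insert_iff, Set.mem_singleton_iff, Set.mem_range, hf]
    constructor
    · rintro (rfl | rfl | rfl | rfl)
      · exact ⟨![false, false], by simp⟩
      · exact ⟨![true, false], by simp [hi']⟩
      · exact ⟨![true, true], by simp⟩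
      · exact ⟨![false, true], by simp⟩
    · rintro ⟨y, rfl⟩
      rcases h0 : y 0 <;> rcases h1 : y 1 <;> simp [hi']

/-- Three squares that pairwise share an edge at `w` bound a `3`-cube. -/
theorem exists_opposite_vertex (hX : ∀ v, X.IsFlagLink v) {w x y z p q r : V}
    (h1 : X.Square w x p y) (h2 : X.Square w y q z) (h3 : X.Square w x r z) :
    ∃ c, X.Square x p c r ∧ X.Square y p c q ∧ X.Square z r c q := by
  classical
  obtain ⟨C, hC, hw, hlink⟩ := (hX w).2 {x, y, z} (by
    intro a ha
    simp only [Finset.mem_insert, Finset.mem_singleton] at ha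
    rcases ha with rfl | rfl | rfl
    exacts [h1.ab, h2.ab, h2.da.symm]) (by
    have key : ∀ {a b c : V}, X.Square w a c b →
        ∃ Q ∈ X.cubes, w ∈ Q ∧ X.linkSimplex w Q = {a, b} :=
      fun h => ⟨_, h.mem, by simp, h.linkSimplex_eq⟩
    intro a ha b hb hab
    simp only [Finset.mem_insert, Finset.mem_singleton] at ha hb
    rcases ha with rfl | rfl | rfl <;> rcases hb with rfl | rfl | rfl
    exacts [absurd rfl hab, key h1, key h3, key h1.reflect, absurd rfl hab, key h2,
      key h3.reflect, key h2.reflect, absurd rfl hab])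
  obtain ⟨n, ⟨e⟩⟩ := X.isCube C hC
  obtain ⟨a, ha⟩ := e.surjective ⟨w, hw⟩
  have hdir : ∀ v ∈ ({x, y, z} : Finset V), ∃ i, (e (Function.update a i (!a i)) : V) = v := by
    intro v hv
    have hv' : v ∈ X.linkSimplex w C := by rw [hlink]; exact hv
    obtain ⟨b, hb⟩ := e.surjective ⟨v, hv'.1⟩
    have : (hypercube n).Adj a b := by
      refine e.map_rel_iff.1 ?_
      rw [ha, hb]
      exact hv'.2
    obtain ⟨i, rfl⟩ := hypercube_adj_iff.1 this
    exact ⟨i, by rw [hb]⟩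
  obtain ⟨i, hi⟩ := hdir x (by simp)
  obtain ⟨j, hj⟩ := hdir y (by simp)
  obtain ⟨k, hk⟩ := hdir z (by simp)
  have ha' : (e a : V) = w := by rw [ha]
  have hij : i ≠ j := by rintro rfl; exact h1.bd (hi.symm.trans hj)
  have hjk : j ≠ k := by rintro rfl; exact h2.bd (hj.symm.trans hk)
  have hik : i ≠ k := by rintro rfl; exact h3.bd (hi.symm.trans hk)
  have s1 := square_of_hypercube hC e a hij
  have s2 := square_of_hypercube hC e a hjk
  have s3 := square_of_hypercube hC e a hik
  rw [ha', hi, hj] at s1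
  rw [ha', hj, hk] at s2
  rw [ha', hi, hk] at s3
  have e1 := h1.unique hX s1
  have e2 := h2.unique hX s2
  have e3 := h3.unique hX s3
  have t1 := square_of_hypercube hC e (Function.update a i (!a i)) hjk
  have t2 := square_of_hypercube hC e (Function.update a j (!a j)) hik
  have t3 := square_of_hypercube hC e (Function.update a k (!a k)) hij
  rw [hi, Function.update_of_ne hij.symm, Function.update_of_ne hik.symm, ← e1, ← e3] at t1
  rw [hj, Function.update_of_ne hij, Function.update_of_ne hjk.symm,
    Function.update_comm hij.symm, ← e1, ← e2] at t2
  rw [hk, Function.update_of_ne hik, Function.update_of_ne hjk,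
    Function.update_comm hik.symm, ← e3, Function.update_comm hjk.symm _ _ a, ← e2,
    Function.update_comm hjk.symm] at t3
  exact ⟨_, t1, t2, t3⟩

end CubeComplex

/-! ### Edge paths up to square moves -/

namespace CubeComplex

variable {V : Type*} (X : CubeComplex V)

/-- Edge paths, listed from their last vertex to their first, that differ by pushing across
squares. -/
inductive SwapEq : List V → List V → Prop
  | refl (l : List V) : SwapEq l l
  | symm {l l' : List V} : SwapEq l l' → SwapEq l' l
  | trans {l l' l'' : List V} : SwapEq l l' → SwapEq l' l'' → SwapEq l l''
  | cons {l l' : List V} (x : V) : SwapEq l l' → SwapEq (x :: l) (x :: l')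
  | square {v w z t : V} (l : List V) (h : X.Square v w z t) :
      SwapEq (z :: w :: v :: l) (z :: t :: v :: l)

variable {X}

namespace SwapEq

theorem head?_eq {l l' : List V} (h : X.SwapEq l l') : l.head? = l'.head? := by
  induction h with
  | refl l => rfl
  | symm _ ih => exact ih.symm
  | trans _ _ ih1 ih2 => exact ih1.trans ih2
  | cons x _ _ => rfl
  | square l h => rfl

theorem head_eq {x y : V} {l l' : List V} (h : X.SwapEq (x :: l) (y :: l')) : x = y := by
  simpa using h.head?_eq

theorem length_eq {l l' : List V} (h : X.SwapEq l l') : l.length = l'.length := by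
  induction h with
  | refl l => rfl
  | symm _ ih => exact ih.symm
  | trans _ _ ih1 ih2 => exact ih1.trans ih2
  | cons x _ ih => simp [ih]
  | square l h => rfl

theorem getLast?_eq {l l' : List V} (h : X.SwapEq l l') : l.getLast? = l'.getLast? := by
  induction h with
  | refl l => rfl
  | symm _ ih => exact ih.symm
  | trans _ _ ih1 ih2 => exact ih1.trans ih2
  | cons x _ ih => simp [List.getLast?_cons, ih]
  | square l h => simp [List.getLast?_cons]

theorem isChain_iff {l l' : List V} (h : X.SwapEq l l') :
    l.IsChain X.graph.Adj ↔ l'.IsChain X.graph.Adj := by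
  induction h with
  | refl l => rfl
  | symm _ ih => exact ih.symm
  | trans _ _ ih1 ih2 => exact ih1.trans ih2
  | cons x h ih => rw [List.isChain_cons, List.isChain_cons, ih, h.head?_eq]
  | square l h =>
    simp only [List.isChain_cons_cons, h.bc.symm, h.ab.symm, h.cd, h.da, true_and]

/-- The effect of square moves on the final edge of a path. -/
theorem cons_cases (hX : ∀ v, X.IsFlagLink v) {x y : V} {p p' : List V}
    (h : X.SwapEq (x :: p) (y :: p')) :
    X.SwapEq p p' ∨ ∃ w t w' q, X.Square x w t w' ∧ X.SwapEq p (w :: t :: q) ∧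
      X.SwapEq p' (w' :: t :: q) := by
  suffices H : ∀ n, ∀ l l', X.SwapEq l l' → l.length = n + 1 → ∀ x p y p', l = x :: p →
      l' = y :: p' → X.SwapEq p p' ∨ ∃ w t w' q, X.Square x w t w' ∧ X.SwapEq p (w :: t :: q) ∧
      X.SwapEq p' (w' :: t :: q) from H p.length _ _ h rfl _ _ _ _ rfl rfl
  clear h
  intro n
  induction n using Nat.strong_induction_on with
  | _ n IH =>
  intro l l' h
  induction h with
  | refl l =>
    rintro - x p y p' rfl h
    obtain ⟨rfl, rfl⟩ := List.cons.inj h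
    exact Or.inl (refl _)
  | symm h ih =>
    intro hn x p y p' h1 h2
    rcases ih (h.length_eq.trans hn) y p' x p h2 h1 with h3 | ⟨w, t, w', q, h3, h4, h5⟩
    · exact Or.inl h3.symm
    · subst h1 h2
      obtain rfl := h.head_eq
      exact Or.inr ⟨w', t, w, q, h3.reflect, h5, h4⟩
  | @trans l1 l2 l3 h12 h23 ih1 ih2 =>
    rintro hn x1 p1 x3 p3 rfl rfl
    have hn2 := h12.length_eq.symm.trans hn
    rcases l2 with _ | ⟨x2, p2⟩
    · simp at hn2
    obtain rfl := h12.head_eq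
    obtain rfl := h23.head_eq
    rcases ih1 hn _ _ _ _ rfl rfl with a | ⟨w1, t, w2, q, s12, a1, a2⟩
    · rcases ih2 hn2 _ _ _ _ rfl rfl with b | ⟨w2', t', w3, q', s23, b2, b3⟩
      · exact Or.inl (a.trans b)
      · exact Or.inr ⟨w2', t', w3, q', s23, a.trans b2, b3⟩
    rcases ih2 hn2 _ _ _ _ rfl rfl with b | ⟨w2', t', w3, q', s23, b2, b3⟩
    · exact Or.inr ⟨w1, t, w2, q, s12, a1, b.symm.trans a2⟩
    have hq := a2.symm.trans b2
    obtain rfl := hq.head_eq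
    have hl : q.length + 2 = n := by
      have := a2.length_eq
      simp only [List.length_cons, Nat.add_right_cancel_iff] at this hn2
      omega
    -- Both moves replace the final edge. The tails at the middle vertex either agree up to squares,
    -- and then both squares have the same three vertices and the two replacements cancel, or they
    -- differ by a third square there. In that case the three squares lie in a cube, whose opposite
    -- vertex `c` gives a single square from the first path to the last.
    rcases IH (q.length + 1) (by omega) _ _ hq rfl _ _ _ _ rfl rfl with b | ⟨a, s, a', r, ss, c2, c3⟩
    · obtain rfl := b.head_eq
      obtain rfl := s12.reflect.rotate.unique hX s23.rotate
      exact Or.inl (a1.trans ((b.cons _).trans b3.symm))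
    · obtain rfl := c2.head_eq
      obtain rfl := c3.head_eq
      obtain ⟨c, hc1, hc2, hc3⟩ := exists_opposite_vertex hX
        s12.reflect.rotate.reflect ss s23.rotate.reflect
      refine Or.inr ⟨w1, c, w3, s :: r, hc1, ?_, ?_⟩
      · exact (a1.trans (c2.cons _)).trans (square _ hc2.rotate.rotate.rotate)
      · exact (b3.trans (c3.cons _)).trans (square _ hc3.rotate.rotate.rotate)
  | cons x h ih =>
    rintro - x p y p' h1 h2
    obtain ⟨rfl, rfl⟩ := List.cons.inj h1
    obtain ⟨rfl, rfl⟩ := List.cons.inj h2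
    exact Or.inl h
  | square l h =>
    rintro - x p y p' h1 h2
    obtain ⟨rfl, rfl⟩ := List.cons.inj h1
    obtain ⟨rfl, rfl⟩ := List.cons.inj h2
    exact Or.inr ⟨_, _, _, l, h.rotate.rotate.reflect, refl _, refl _⟩

end SwapEq

/-- Edge paths that contain a backtrack. -/
inductive Backtracks : List V → Prop
  | here (x y : V) (l : List V) : Backtracks (x :: y :: x :: l)
  | cons (x : V) {l : List V} : Backtracks l → Backtracks (x :: l)

theorem Backtracks.shorten {l : List V} (h : Backtracks l) :
    ∃ l' : List V, l'.length + 2 = l.length ∧ l'.head? = l.head? ∧ l'.getLast? = l.getLast? ∧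
      (l.IsChain X.graph.Adj → l'.IsChain X.graph.Adj) := by
  induction h with
  | here x y l =>
    refine ⟨x :: l, rfl, rfl, by simp [List.getLast?_cons], fun h => ?_⟩
    rw [List.isChain_cons_cons, List.isChain_cons_cons] at h
    exact h.2.2
  | cons x h ih =>
    obtain ⟨l', h1, h2, h3, h4⟩ := ih
    refine ⟨x :: l', by simp [← h1], rfl, by simp [List.getLast?_cons, h3], fun h => ?_⟩
    rw [List.isChain_cons] at h ⊢
    rw [h2]
    exact ⟨h.1, h4 h.2⟩

variable (X) in
/-- No sequence of square moves produces a backtrack. -/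
def Reduced (l : List V) : Prop := ∀ l', X.SwapEq l l' → ¬ Backtracks l'

theorem Reduced.congr {l l' : List V} (h : X.Reduced l) (e : X.SwapEq l l') : X.Reduced l' :=
  fun _ e' => h _ (e.trans e')

theorem Reduced.of_cons {x : V} {l : List V} (h : X.Reduced (x :: l)) : X.Reduced l :=
  fun _ e' hb => h _ (e'.cons x) (hb.cons x)

theorem Reduced.not_swapEq_cons {x y : V} {l s : List V} (h : X.Reduced (x :: l)) :
    ¬ X.SwapEq l (y :: x :: s) :=
  fun e => h _ (e.cons x) (.here _ _ _)

/-- A reduced path can be prolonged by an edge unless it ends with the reversed edge. -/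
theorem Reduced.cons (hX : ∀ v, X.IsFlagLink v) {x : V} {l : List V} (h : X.Reduced l)
    (hne : ∀ y s, ¬ X.SwapEq l (y :: x :: s)) : X.Reduced (x :: l) := by
  intro r hr hb
  suffices H : ∀ n, ∀ l : List V, l.length = n → ∀ x r, X.SwapEq (x :: l) r → Backtracks r →
      ¬ X.Reduced l ∨ ∃ y s, X.SwapEq l (y :: x :: s) by
    rcases H _ l rfl x r hr hb with h' | ⟨y, s, h'⟩
    exacts [h' h, hne y s h']
  clear! l x r
  intro n
  induction n using Nat.strong_induction_on with
  | _ n IH =>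
  intro l hn x r hr hb
  cases hb with
  | here z y b =>
    obtain rfl := hr.head_eq
    rcases hr.cons_cases hX with h1 | ⟨w, t, w', q, hs, h1, h2⟩
    · exact Or.inr ⟨_, _, h1⟩
    · obtain rfl := h2.head_eq
      -- The first case would identify opposite vertices of a square. In the second, the new square
      -- shares three vertices with `hs`, so its fourth vertex is `w`, and `l` is equivalent to a
      -- path ending in the backtrack `w`, `t`, `w`.
      rcases h2.cons_cases hX with h3 | ⟨u, s, u', z, hs', h3, h4⟩
      · exact absurd h3.head_eq hs.ac
      · obtain rfl := h3.head_eq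
        obtain rfl := h4.head_eq
        obtain rfl := hs'.unique hX hs.reflect.rotate.reflect
        exact Or.inl fun hl => hl _ (h1.trans (h4.cons _)) (.here _ _ _)
  | @cons z r' hb' =>
    obtain rfl := hr.head_eq
    rcases hr.cons_cases hX with h1 | ⟨w, t, w', q, hs, h1, h2⟩
    · exact Or.inl fun hl => hl _ h1 hb'
    · have hlen : q.length + 2 = n := by
        rw [← hn, h1.length_eq]
        simp
      -- The backtrack lies in a path obtained by prolonging the shorter path `t :: q` to `w'`. If
      -- that path ends with the reversed edge from `w'`, pushing across the square `hs` makes `l`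
      -- end with a reversed edge from `x`.
      rcases IH (t :: q).length (by simp only [List.length_cons]; omega) _ rfl w' r' h2.symm hb'
        with h3 | ⟨y, s, h3⟩
      · exact Or.inl fun hl => h3 (hl.congr h1).of_cons
      · obtain rfl := h3.head_eq
        exact Or.inr ⟨w, w' :: s, (h1.trans (h3.cons _)).trans
          (.square _ hs.reflect.rotate)⟩

/-! ### The action of edge paths on reduced paths. -/

open Classical in
variable (X) in
/-- Prolong a reduced path by an edge to `w`, or delete its last edge if that one comes from `w`. -/
noncomputable def step (l : List V) (w : V) : List V :=
  if h : ∃ s y, X.SwapEq l (y :: w :: s) then w :: h.choose else w :: l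

theorem step_of_not {l : List V} {w : V} (h : ∀ y s, ¬ X.SwapEq l (y :: w :: s)) :
    X.step l w = w :: l := by
  rw [step, dif_neg]
  rintro ⟨s, y, h'⟩
  exact h y s h'

/-- Independence of the chosen tail: if two tails through the same vertex `w` were not equivalent,
they would differ by a square with both of its sides leading to `w`. -/
theorem step_of_swapEq (hX : ∀ v, X.IsFlagLink v) {l s : List V} {y w : V}
    (h : X.SwapEq l (y :: w :: s)) : X.SwapEq (X.step l w) (w :: s) := by
  have hex : ∃ s y, X.SwapEq l (y :: w :: s) := ⟨s, y, h⟩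
  rw [step, dif_pos hex]
  obtain ⟨y', h'⟩ := hex.choose_spec
  rcases (h'.symm.trans h).cons_cases hX with h1 | ⟨a, t, a', q, hs, h1, h2⟩
  · exact h1
  · exact absurd (h1.head_eq.symm.trans h2.head_eq) hs.bd

theorem step_cases (l : List V) (w : V) :
    (∃ y s, X.SwapEq l (y :: w :: s)) ∨ ∀ y s, ¬ X.SwapEq l (y :: w :: s) := by
  by_cases h : ∃ y s, X.SwapEq l (y :: w :: s)
  · exact Or.inl h
  · push Not at h
    exact Or.inr h

theorem step_congr (hX : ∀ v, X.IsFlagLink v) {l l' : List V} (h : X.SwapEq l l') (w : V) :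
    X.SwapEq (X.step l w) (X.step l' w) := by
  rcases step_cases (X := X) l w with ⟨y, s, h1⟩ | h1
  · exact (step_of_swapEq hX h1).trans (step_of_swapEq hX (h.symm.trans h1)).symm
  · rw [step_of_not h1, step_of_not fun y s h2 => h1 y s (h.trans h2)]
    exact h.cons w

theorem head?_step (l : List V) (w : V) : (X.step l w).head? = some w := by
  rw [step]
  split_ifs <;> rfl

theorem Reduced.step (hX : ∀ v, X.IsFlagLink v) {l : List V} (h : X.Reduced l) (w : V) :
    X.Reduced (X.step l w) := by
  rcases step_cases (X := X) l w with ⟨y, s, h1⟩ | h1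
  · exact (h.congr h1).of_cons.congr (step_of_swapEq hX h1).symm
  · rw [step_of_not h1]
    exact h.cons hX h1

/-- Invariance of the action under backtracks: of the two steps, one cancels what the other adds. -/
theorem step_step (hX : ∀ v, X.IsFlagLink v) {l : List V} {v : V} (h : X.Reduced l)
    (hv : l.head? = some v) (w : V) : X.SwapEq (X.step (X.step l w) v) l := by
  rcases step_cases (X := X) l w with ⟨y, s, h1⟩ | h1
  · have hy : v = y := by simpa [hv] using h1.head?_eq
    subst hy
    refine (step_congr hX (step_of_swapEq hX h1) v).trans ?_
    rw [step_of_not (fun y s h2 => (h.congr h1).not_swapEq_cons h2)]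
    exact h1.symm
  · obtain ⟨l, rfl⟩ : ∃ l', l = v :: l' := by
      cases l with
      | nil => simp at hv
      | cons a l => exact ⟨l, by simpa using hv⟩
    rw [step_of_not h1]
    exact step_of_swapEq hX (.refl _)

/-- Invariance under squares. If both sides cancel, the path already ends by running through the
square from `z`, and two edges are deleted either way. If only one cancels, both routes end by
crossing the opposite side. If none cancels, both routes add two edges, which differ by the square.
-/
theorem step_square (hX : ∀ v, X.IsFlagLink v) {l : List V} {v w z t : V}
    (hv : l.head? = some v) (hs : X.Square v w z t) :
    X.SwapEq (X.step (X.step l w) z) (X.step (X.step l t) z) := by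
  obtain ⟨l, rfl⟩ : ∃ l', l = v :: l' := by
    cases l with
    | nil => simp at hv
    | cons a l => exact ⟨l, by simpa using hv⟩
  clear hv
  have mixed : ∀ {w t : V}, X.Square v w z t → (∃ y s, X.SwapEq (v :: l) (y :: w :: s)) →
      (∀ y s, ¬ X.SwapEq (v :: l) (y :: t :: s)) →
      X.SwapEq (X.step (X.step (v :: l) w) z) (X.step (X.step (v :: l) t) z) := by
    rintro w t hs ⟨y, s, h1⟩ h2
    obtain rfl := h1.head_eq
    have e1 : X.step (w :: s) z = z :: w :: s := by
      refine step_of_not fun y s' h3 => h2 v (z :: s') ?_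
      obtain rfl := h3.head_eq
      exact (h1.trans (h3.cons v)).trans (.square _ hs.rotate.rotate.reflect)
    have e2 := step_congr hX (step_of_swapEq hX h1) z
    rw [e1] at e2
    refine e2.trans ?_
    rw [step_of_not h2]
    exact (step_of_swapEq hX ((h1.cons t).trans
      (.square s hs.reflect.rotate.rotate.rotate))).symm
  rcases step_cases (X := X) (v :: l) w with h1 | h1 <;>
    rcases step_cases (X := X) (v :: l) t with h2 | h2
  · obtain ⟨y, s, h1⟩ := h1
    obtain ⟨y', s', h2⟩ := h2
    obtain rfl := h1.head_eq
    obtain rfl := h2.head_eq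
    rcases (h1.symm.trans h2).cons_cases hX with h3 | ⟨a, c, a', q, hs', h3, h4⟩
    · exact absurd h3.head_eq hs.bd
    · obtain rfl := h3.head_eq
      obtain rfl := h4.head_eq
      obtain rfl := hs.unique hX hs'
      refine (step_of_swapEq hX ((step_of_swapEq hX h1).trans h3)).trans
        (step_of_swapEq hX ((step_of_swapEq hX h2).trans h4)).symm
  · exact mixed hs h1 h2
  · exact (mixed hs.reflect h2 h1).symm
  · rw [step_of_not h1, step_of_not h2]
    have key : ∀ {w t : V}, X.Square v w z t → (∀ y s, ¬ X.SwapEq (v :: l) (y :: t :: s)) →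
        X.step (w :: v :: l) z = z :: w :: v :: l := by
      intro w t hs h2
      refine step_of_not fun y s h3 => ?_
      rcases h3.cons_cases hX with h4 | ⟨a, c, a', q, hs', h4, h5⟩
      · exact hs.ac h4.head_eq
      · obtain rfl := h3.head_eq
        obtain rfl := h4.head_eq
        obtain rfl := h5.head_eq
        obtain rfl := hs'.unique hX hs.reflect.rotate.rotate.rotate
        exact h2 _ _ h4
    rw [key hs h2, key hs.reflect h1]
    exact .square _ hs

end CubeComplex

/-! ### Geodesics and hyperplanes of CAT(0) cube complexes -/

namespace CubeComplex

variable {V : Type*} {X : CubeComplex V}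

variable (X) in
/-- The reduced form of the concatenation of the reduced path `l` with an edge path. -/
noncomputable def act : ∀ {u v : V}, X.graph.Walk u v → List V → List V
  | _, _, .nil, l => l
  | _, _, .cons (v := w) _ p, l => act p (X.step l w)

theorem act_append {u v w : V} (p : X.graph.Walk u v) (q : X.graph.Walk v w) (l : List V) :
    X.act (p.append q) l = X.act q (X.act p l) := by
  induction p generalizing l with
  | nil => rfl
  | cons h p ih => exact ih _ _

theorem act_congr (hX : ∀ v, X.IsFlagLink v) {u v : V} (p : X.graph.Walk u v) {l l' : List V}
    (h : X.SwapEq l l') : X.SwapEq (X.act p l) (X.act p l') := by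
  induction p generalizing l l' with
  | nil => exact h
  | cons _ p ih => exact ih (step_congr hX h _)

theorem head?_act {u v : V} (p : X.graph.Walk u v) {l : List V} (h : l.head? = some u) :
    (X.act p l).head? = some v := by
  induction p generalizing l with
  | nil => exact h
  | cons _ p ih => exact ih (head?_step _ _)

theorem Reduced.act (hX : ∀ v, X.IsFlagLink v) {u v : V} (p : X.graph.Walk u v) {l : List V}
    (h : X.Reduced l) : X.Reduced (X.act p l) := by
  induction p generalizing l with
  | nil => exact h
  | cons _ p ih => exact ih (h.step hX _)

theorem act_reverse (hX : ∀ v, X.IsFlagLink v) {u v : V} (p : X.graph.Walk u v) {l : List V}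
    (hl : X.Reduced l) (hu : l.head? = some u) : X.SwapEq (X.act p.reverse (X.act p l)) l := by
  induction p generalizing l with
  | nil => exact .refl _
  | @cons u w v h p ih =>
    rw [SimpleGraph.Walk.reverse_cons, act_append]
    exact (step_congr hX (ih (hl.step hX w) (head?_step _ _)) u).trans (step_step hX hl hu w)

/-- Homotopic paths act in the same way on reduced paths. -/
theorem Homotopic.act (hX : ∀ v, X.IsFlagLink v) {u v : V} {p q : X.graph.Walk u v}
    (h : X.Homotopic p q) {l : List V} (hl : X.Reduced l) (hu : l.head? = some u) :
    X.SwapEq (X.act p l) (X.act q l) := by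
  induction h with
  | refl p => exact .refl _
  | symm _ ih => exact ih.symm
  | trans _ _ ih1 ih2 => exact ih1.trans ih2
  | @backtrack v w x p h q =>
    rw [act_append, act_append]
    exact act_congr hX q (step_step hX (hl.act hX p) (head?_act p hu) w)
  | @square a b c d v p hab hbc had hdc q hsq =>
    rw [act_append, act_append]
    refine act_congr hX q ?_
    rcases square_or_degenerate hab hbc hdc.symm had.symm hsq with h | ⟨rfl, rfl⟩
    · exact step_square hX (head?_act p hu) h
    · exact .refl _

/-- Going along `p` and back along `q` is null-homotopic, so it acts trivially. -/
theorem IsCAT0.act_swapEq (hX : X.IsCAT0) {u v : V} (p q : X.graph.Walk u v) {l : List V}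
    (hl : X.Reduced l) (hu : l.head? = some u) : X.SwapEq (X.act p l) (X.act q l) := by
  have h1 : X.SwapEq (X.act q.reverse (X.act p l)) l := by
    rw [← act_append]
    exact (hX.simplyConnected.2 u (p.append q.reverse)).act hX.flagLink hl hu
  have h2 := act_reverse hX.flagLink q.reverse (hl.act hX.flagLink p) (head?_act p hu)
  rw [SimpleGraph.Walk.reverse_reverse] at h2
  exact h2.symm.trans (act_congr hX.flagLink q h1)

theorem reduced_singleton (b : V) : X.Reduced [b] := by
  intro l h hb
  have := h.length_eq
  rcases hb with ⟨x, y, l⟩ | ⟨x, hb⟩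
  · simp at this
  · cases hb <;> simp at this

/-- A reduced path is recovered by letting it act, edge by edge, on its one-vertex initial piece,
because none of these steps cancels. -/
theorem exists_act_swapEq {b v : V} (l : List V) (hc : l.IsChain X.graph.Adj) (hl : X.Reduced l)
    (hv : l.head? = some v) (hb : l.getLast? = some b) :
    ∃ p : X.graph.Walk b v, X.SwapEq (X.act p [b]) l := by
  induction l generalizing v with
  | nil => simp at hv
  | cons x l ih =>
    obtain rfl : x = v := by simpa using hv
    cases l with
    | nil =>
      obtain rfl : x = b := by simpa using hb
      exact ⟨.nil, .refl _⟩
    | cons y l =>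
      rw [List.isChain_cons_cons] at hc
      obtain ⟨p, hp⟩ := ih hc.2 hl.of_cons rfl (by simpa [List.getLast?_cons] using hb)
      refine ⟨p.append (.cons hc.1.symm .nil), ?_⟩
      rw [act_append]
      change X.SwapEq (X.step _ _) _
      rw [step_of_not]
      · exact hp.cons x
      · exact fun z s h => hl.not_swapEq_cons (hp.symm.trans h)

/-- Reduced edge paths with the same endpoints differ by square moves. -/
theorem IsCAT0.swapEq_of_reduced (hX : X.IsCAT0) {l l' : List V}
    (hc : l.IsChain X.graph.Adj) (hc' : l'.IsChain X.graph.Adj) (hl : X.Reduced l)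
    (hl' : X.Reduced l') {b v : V} (hv : l.head? = some v) (hv' : l'.head? = some v)
    (hb : l.getLast? = some b) (hb' : l'.getLast? = some b) : X.SwapEq l l' := by
  obtain ⟨p, hp⟩ := exists_act_swapEq l hc hl hv hb
  obtain ⟨q, hq⟩ := exists_act_swapEq l' hc' hl' hv' hb'
  exact hp.symm.trans ((hX.act_swapEq p q (reduced_singleton b) rfl).trans hq)

theorem dist_lt_length {b v : V} (l : List V) (hc : l.IsChain X.graph.Adj)
    (hv : l.head? = some v) (hb : l.getLast? = some b) : X.graph.dist v b < l.length := by
  suffices ∃ p : X.graph.Walk v b, p.length + 1 = l.length by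
    obtain ⟨p, hp⟩ := this
    have := SimpleGraph.dist_le p
    omega
  induction l generalizing v with
  | nil => simp at hv
  | cons x l ih =>
    obtain rfl : x = v := by simpa using hv
    cases l with
    | nil =>
      obtain rfl : x = b := by simpa using hb
      exact ⟨.nil, rfl⟩
    | cons y l =>
      rw [List.isChain_cons_cons] at hc
      obtain ⟨p, hp⟩ := ih hc.2 rfl (by simpa [List.getLast?_cons] using hb)
      exact ⟨.cons hc.1 p, by simpa using hp⟩

theorem exists_geodesic_list (hX : X.graph.Connected) (v b : V) : ∃ l : List V,
    l.IsChain X.graph.Adj ∧ l.head? = some v ∧ l.getLast? = some b ∧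
      l.length = X.graph.dist v b + 1 := by
  obtain ⟨p, hp⟩ := hX.exists_walk_length_eq_dist v b
  rw [← hp]
  clear hp
  induction p with
  | @nil u => exact ⟨[u], by simp⟩
  | @cons u w v h p ih =>
    obtain ⟨l, h1, h2, h3, h4⟩ := ih
    refine ⟨u :: l, ?_, rfl, ?_, by simp [h4]⟩
    · rw [List.isChain_cons, h2]
      refine ⟨fun y hy => ?_, h1⟩
      obtain rfl : w = y := by simpa using hy
      exact h
    · simp [List.getLast?_cons, h3]

/-- Square moves preserve length and endpoints, and cutting out a backtrack would give a path
shorter than the distance. -/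
theorem reduced_of_length_eq {b v : V} {l : List V} (hc : l.IsChain X.graph.Adj)
    (hv : l.head? = some v) (hb : l.getLast? = some b) (hl : l.length = X.graph.dist v b + 1) :
    X.Reduced l := by
  intro l' h hbt
  obtain ⟨l'', h1, h2, h3, h4⟩ := hbt.shorten (X := X)
  have := dist_lt_length l'' (h4 (h.isChain_iff.1 hc)) (h2.trans (h.head?_eq.symm.trans hv))
    (h3.trans (h.getLast?_eq.symm.trans hb))
  have := h.length_eq
  omega

/-- The quadrangle condition. -/
theorem IsCAT0.exists_square (hX : X.IsCAT0) {b v u w : V} (hvu : X.graph.Adj v u)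
    (hvw : X.graph.Adj v w) (huw : u ≠ w) (hu : X.graph.dist v b = X.graph.dist u b + 1)
    (hw : X.graph.dist v b = X.graph.dist w b + 1) :
    ∃ t, X.Square v u t w ∧ X.graph.dist t b < X.graph.dist u b := by
  have key : ∀ {u}, X.graph.Adj v u → X.graph.dist v b = X.graph.dist u b + 1 →
      ∃ l : List V, l.IsChain X.graph.Adj ∧ l.head? = some u ∧ l.getLast? = some b ∧
      l.length = X.graph.dist u b + 1 ∧ (v :: l).IsChain X.graph.Adj ∧ X.Reduced (v :: l) ∧
      (v :: l).getLast? = some b := by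
    intro u hvu hu
    obtain ⟨l, h1, h2, h3, h4⟩ := exists_geodesic_list hX.simplyConnected.1 u b
    have h5 : (v :: l).IsChain X.graph.Adj := by
      rw [List.isChain_cons, h2]
      refine ⟨fun y hy => ?_, h1⟩
      obtain rfl : u = y := by simpa using hy
      exact hvu
    have h6 : (v :: l).getLast? = some b := by simp [List.getLast?_cons, h3]
    exact ⟨l, h1, h2, h3, h4, h5, reduced_of_length_eq h5 rfl h6 (by simp [h4, hu]), h6⟩
  obtain ⟨l, a1, a2, a3, a4, a5, a6, a7⟩ := key hvu hu
  obtain ⟨l', b1, b2, b3, b4, b5, b6, b7⟩ := key hvw hw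
  -- The geodesics from `v` to `b` through `u` and through `w` are reduced with the same endpoints.
  -- Since they leave `v` by different edges, a square at `v` relates them.
  rcases (hX.swapEq_of_reduced a5 b5 a6 b6 rfl rfl a7 b7).cons_cases hX.flagLink with
    h | ⟨x, t, y, q, hs, h1, h2⟩
  · rw [h.head?_eq, b2] at a2
    exact absurd (by simpa using a2.symm) huw
  · obtain rfl : u = x := by
      have := h1.head?_eq
      rw [a2] at this
      simpa using this
    obtain rfl : w = y := by
      have := h2.head?_eq
      rw [b2] at this
      simpa using this
    refine ⟨t, hs, ?_⟩
    have hc := h1.isChain_iff.1 a1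
    rw [List.isChain_cons_cons] at hc
    have h3 := dist_lt_length (t :: q) hc.2 rfl (b := b) (by
      have := h1.getLast?_eq
      rw [a3] at this
      simpa [List.getLast?_cons] using this.symm)
    have h4 := h1.length_eq
    simp only [List.length_cons] at h3 h4
    omega

theorem Homotopic.length_mod_two {u v : V} {p q : X.graph.Walk u v} (h : X.Homotopic p q) :
    p.length % 2 = q.length % 2 := by
  induction h with
  | refl p => rfl
  | symm _ ih => exact ih.symm
  | trans _ _ ih1 ih2 => exact ih1.trans ih2
  | backtrack p h q =>
    simp only [SimpleGraph.Walk.length_append, SimpleGraph.Walk.length_cons]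
    omega
  | square p hab hbc had hdc q hsq =>
    simp only [SimpleGraph.Walk.length_append, SimpleGraph.Walk.length_cons]

/-- Homotopies preserve the parity of length, so closed paths are even. Equal distances would close
up to an odd path. -/
theorem IsCAT0.dist_ne (hX : X.IsCAT0) {u v : V} (h : X.graph.Adj u v) (b : V) :
    X.graph.dist u b ≠ X.graph.dist v b := by
  intro heq
  obtain ⟨p, hp⟩ := hX.simplyConnected.1.exists_walk_length_eq_dist u b
  obtain ⟨q, hq⟩ := hX.simplyConnected.1.exists_walk_length_eq_dist v b
  have := (hX.simplyConnected.2 b (p.reverse.append (.cons h q))).length_mod_two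
  simp only [SimpleGraph.Walk.length_append, SimpleGraph.Walk.length_cons,
    SimpleGraph.Walk.length_reverse, SimpleGraph.Walk.length_nil] at this
  omega

theorem IsCAT0.dist_cases (hX : X.IsCAT0) {u v : V} (h : X.graph.Adj u v) (b : V) :
    X.graph.dist u b = X.graph.dist v b + 1 ∨ X.graph.dist v b = X.graph.dist u b + 1 := by
  have h1 := hX.dist_ne h b
  have h2 := hX.simplyConnected.1.dist_triangle (u := u) (v := v) (w := b)
  have h3 := hX.simplyConnected.1.dist_triangle (u := v) (v := u) (w := b)
  rw [SimpleGraph.dist_eq_one_iff_adj.2 h] at h2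
  rw [SimpleGraph.dist_eq_one_iff_adj.2 h.symm] at h3
  omega

/-- Otherwise `b` and `d` are both one step farther from `p` than `a` and `c`. The quadrangle
condition at `b` gives a square on `a`, `b`, `c` whose fourth vertex is nearer than `a`, and
uniqueness of squares says that this vertex is `d`. -/
theorem IsCAT0.dist_lt_of_square (hX : X.IsCAT0) {a b c d : V} (h : X.Square a b c d) (p : V)
    (hab : X.graph.dist a p < X.graph.dist b p) : X.graph.dist d p < X.graph.dist c p := by
  by_contra hcd
  have h1 := hX.dist_cases h.ab p
  have h2 := hX.dist_cases h.bc p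
  have h3 := hX.dist_cases h.cd p
  have h4 := hX.dist_cases h.da p
  obtain ⟨t, hs, ht⟩ := hX.exists_square (b := p) h.ab.symm h.bc h.ac (by omega) (by omega)
  obtain rfl := hs.unique hX.flagLink h.rotate.reflect
  omega

theorem IsCAT0.dist_lt_iff_of_square (hX : X.IsCAT0) {a b c d : V} (h : X.Square a b c d)
    (p : V) : X.graph.dist a p < X.graph.dist b p ↔ X.graph.dist d p < X.graph.dist c p :=
  ⟨hX.dist_lt_of_square h p, hX.dist_lt_of_square h.reflect.rotate p⟩

/-! ### Sides of edges, hyperplanes and half-spaces. -/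

variable (X) in
/-- `p` and `q` lie on the same side of the edge `e`: they have the same nearest endpoint. -/
def SameSide (p q : V) (e : Sym2 V) : Prop :=
  ∀ u v, e = s(u, v) → (X.graph.dist u p < X.graph.dist v p ↔ X.graph.dist u q < X.graph.dist v q)

/-- Every vertex orients opposite sides of a square alike, and this propagates along the chain of
squares that defines the hyperplane. -/
theorem IsCAT0.sameSide_iff (hX : X.IsCAT0) {e f : Sym2 V} (h : f ∈ X.hyperplane e) (p q : V) :
    X.SameSide p q e ↔ X.SameSide p q f := by
  change Relation.EqvGen _ _ _ at h
  induction h with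
  | refl => rfl
  | symm _ _ _ ih => exact ih.symm
  | trans _ _ _ _ _ ih1 ih2 => exact ih1.trans ih2
  | rel e f h =>
    obtain ⟨a, b, c, d, hab, hbc, hcd, hda, hm, rfl, rfl⟩ := h
    have key : ∀ x y : V, X.SameSide p q s(x, y) ↔
        (X.graph.dist x p < X.graph.dist y p ↔ X.graph.dist x q < X.graph.dist y q) ∧
        (X.graph.dist y p < X.graph.dist x p ↔ X.graph.dist y q < X.graph.dist x q) := by
      intro x y
      constructor
      · exact fun h => ⟨h x y rfl, h y x Sym2.eq_swap⟩
      · rintro ⟨h1, h2⟩ u v huv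
        rcases Sym2.eq_iff.1 huv with ⟨rfl, rfl⟩ | ⟨rfl, rfl⟩
        exacts [h1, h2]
    rw [key, key]
    rcases square_or_degenerate hab hbc hcd hda hm with h | ⟨rfl, rfl⟩
    · have hr := h.reflect.rotate.rotate.rotate
      have hr' : X.Square b a d c := hr
      rw [hX.dist_lt_iff_of_square h p, hX.dist_lt_iff_of_square h q,
        hX.dist_lt_iff_of_square hr' p, hX.dist_lt_iff_of_square hr' q]
    · exact and_comm

/-- A bi-infinite geodesic crosses a hyperplane at most once. -/
theorem IsCAT0.geodesic_notMem_hyperplane (hX : X.IsCAT0) {L : ℤ → V}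
    (hL : ∀ m n : ℤ, X.graph.dist (L m) (L n) = (m - n).natAbs) {m n : ℤ} (hmn : n ≠ m) :
    s(L m, L (m + 1)) ∉ X.hyperplane s(L n, L (n + 1)) := by
  wlog hlt : n < m generalizing m n
  · intro h
    exact this hmn.symm (by omega) (Relation.EqvGen.symm _ _ h)
  intro h
  -- Since `n < m`, the vertices `L m` and `L (m + 1)` lie on the same side of the edge at `n`, yet
  -- each is nearest to a different end of the edge that they span.
  have h1 := (hX.sameSide_iff h (L m) (L (m + 1))).1 (by
    intro u v huv
    rcases Sym2.eq_iff.1 huv with ⟨rfl, rfl⟩ | ⟨rfl, rfl⟩ <;> simp only [hL] <;> omega)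
  have h2 := h1 _ _ rfl
  simp only [hL] at h2
  omega

/-- A half-space is determined by an oriented edge dual to it. -/
theorem halfspace_eq {H : Set V} (hH : H ∈ X.halfspaces) {x y : V} (hxy : X.graph.Adj x y)
    (hx : x ∉ H) (hy : y ∈ H) :
    H = {w | (X.graph.deleteEdges (X.hyperplane s(x, y))).Reachable y w} := by
  obtain ⟨e, he, v, rfl⟩ := hH
  have hmem : s(x, y) ∈ X.hyperplane e := by
    by_contra hne
    refine hx (SimpleGraph.Reachable.trans hy (SimpleGraph.Adj.reachable ?_))
    rw [SimpleGraph.deleteEdges_adj]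
    exact ⟨hxy.symm, by rwa [Sym2.eq_swap]⟩
  have heq : X.hyperplane s(x, y) = X.hyperplane e := by
    ext f
    exact ⟨fun h => Relation.EqvGen.trans _ _ _ hmem h,
      fun h => Relation.EqvGen.trans _ _ _ (Relation.EqvGen.symm _ _ hmem) h⟩
  rw [heq]
  ext w
  exact ⟨fun h => SimpleGraph.Reachable.trans (SimpleGraph.Reachable.symm hy) h,
    fun h => SimpleGraph.Reachable.trans hy h⟩

theorem halfspace_unique {H K : Set V} (hH : H ∈ X.halfspaces) (hK : K ∈ X.halfspaces) {x y : V}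
    (hxy : X.graph.Adj x y) (hx : x ∉ H) (hy : y ∈ H) (hx' : x ∉ K) (hy' : y ∈ K) : H = K :=
  (halfspace_eq hH hxy hx hy).trans (halfspace_eq hK hxy hx' hy').symm

/-- Only finitely many half-spaces separate two vertices. -/
theorem finite_separating (hX : X.graph.Connected) (x y : V) :
    {H ∈ X.halfspaces | x ∉ H ∧ y ∈ H}.Finite := by
  obtain ⟨p⟩ := hX.preconnected x y
  induction p with
  | nil =>
    convert Set.finite_empty
    ext H
    simp
  | @cons u w v h p ih =>
    have h1 : {H ∈ X.halfspaces | u ∉ H ∧ w ∈ H}.Subsingleton := fun H hH K hK =>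
      halfspace_unique hH.1 hK.1 h hH.2.1 hH.2.2 hK.2.1 hK.2.2
    refine (h1.finite.union ih).subset ?_
    rintro H ⟨h1, h2, h3⟩
    by_cases hw : w ∈ H
    · exact Or.inl ⟨h1, h2, hw⟩
    · exact Or.inr ⟨h1, hw, h3⟩

theorem adj_of_geodesic {L : ℤ → V}
    (hL : ∀ m n : ℤ, X.graph.dist (L m) (L n) = (m - n).natAbs) (n : ℤ) :
    X.graph.Adj (L n) (L (n + 1)) := by
  rw [← SimpleGraph.dist_eq_one_iff_adj, hL]
  omega

/-- A half-space that is crossed positively by a geodesic contains exactly a positive ray of it. -/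
theorem IsCAT0.mem_iff_of_geodesic (hX : X.IsCAT0) {L : ℤ → V}
    (hL : ∀ m n : ℤ, X.graph.dist (L m) (L n) = (m - n).natAbs) {H : Set V}
    (hH : H ∈ X.halfspaces) {n : ℤ} (hn : L n ∉ H) (hn' : L (n + 1) ∈ H) (m : ℤ) :
    L m ∈ H ↔ n < m := by
  have hstep : ∀ j, j ≠ n → (L j ∈ H ↔ L (j + 1) ∈ H) := by
    intro j hj
    have hadj : (X.graph.deleteEdges (X.hyperplane s(L n, L (n + 1)))).Adj (L j) (L (j + 1)) := by
      rw [SimpleGraph.deleteEdges_adj]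
      exact ⟨adj_of_geodesic hL j, hX.geodesic_notMem_hyperplane hL hj.symm⟩
    rw [halfspace_eq hH (adj_of_geodesic hL n) hn hn']
    exact ⟨fun h => SimpleGraph.Reachable.trans h hadj.reachable,
      fun h => SimpleGraph.Reachable.trans h hadj.symm.reachable⟩
  have hup : ∀ k : ℕ, L (n + 1 + k) ∈ H := by
    intro k
    induction k with
    | zero => simpa using hn'
    | succ k ih =>
      have := (hstep (n + 1 + k) (by omega)).1 ih
      rwa [add_assoc (n + 1)] at this
  have hdown : ∀ k : ℕ, L (n - k) ∉ H := by
    intro k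
    induction k with
    | zero => simpa using hn
    | succ k ih =>
      intro h
      have := (hstep (n - (k + 1 : ℕ)) (by omega)).1 h
      rw [show n - ((k + 1 : ℕ) : ℤ) + 1 = n - k by push_cast; ring] at this
      exact ih this
  constructor
  · intro h
    by_contra hlt
    refine hdown (n - m).toNat ?_
    rwa [show n - ((n - m).toNat : ℤ) = m by omega]
  · intro h
    have := hup (m - n - 1).toNat
    rwa [show n + 1 + ((m - n - 1).toNat : ℤ) = m by omega] at this

end CubeComplex

/-! ### The half-space axis of a hyperbolic automorphism -/

/-- A collection `P` of sets, ranked by integers compatibly with inclusion, in which no two members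
are disjoint or cover the whole space. -/
structure IsRankedSystem {V : Type*} (P : Set (Set V)) (pos : Set V → ℤ) : Prop where
  not_subset_compl : ∀ H ∈ P, ∀ K ∈ P, ¬ H ⊆ Kᶜ
  not_compl_subset : ∀ H ∈ P, ∀ K ∈ P, ¬ Hᶜ ⊆ K
  injOn : Set.InjOn pos P
  le_of_subset : ∀ H ∈ P, ∀ K ∈ P, H ⊆ K → pos K ≤ pos H

theorem IsRankedSystem.lt_of_ssubset {V : Type*} {P : Set (Set V)} {pos : Set V → ℤ}
    (h : IsRankedSystem P pos) {H K : Set V} (hH : H ∈ P) (hK : K ∈ P) (hHK : H ⊂ K) :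
    pos K < pos H :=
  lt_of_le_of_ne (h.le_of_subset H hH K hK hHK.subset) fun h0 => hHK.ne (h.injOn hK hH h0).symm

namespace CubeComplex

variable {V : Type*} {X : CubeComplex V} {G : Type*} [Group G] [MulAction G V]

/-- The ultrafilter of the half-spaces that contain the vertex `x`. -/
def ultrafilterAt (hX : X.graph.Connected) {𝓗 : Set (Set V)}
    (h𝓗 : ∀ H ∈ 𝓗, H ∈ X.halfspaces ∨ Hᶜ ∈ X.halfspaces)
    (hc : ∀ H ∈ 𝓗, Hᶜ ∈ 𝓗) (x : V) : SageevVertex 𝓗 where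
  carrier := {H ∈ 𝓗 | x ∈ H}
  subset _ h := h.1
  choice H hH := by
    by_cases hx : x ∈ H
    · exact Or.inl ⟨⟨hH, hx⟩, fun h => h.2 hx⟩
    · exact Or.inr ⟨⟨hc H hH, hx⟩, fun h => hx h.2⟩
  meet H hH K hK h := h hH.2 hK.2
  dcc := by
    rw [Set.isWF_iff_no_descending_seq]
    intro f hf hmem
    -- From index one on, every term contains `x` and misses a fixed point `y` of `f 0 \ f 1`, so
    -- infinitely many half-spaces or complements would separate `x` from `y`.
    have h01 : f 1 ⊂ f 0 := hf (by norm_num)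
    obtain ⟨y, -, hy⟩ := Set.exists_of_ssubset h01
    have hfin : ({H ∈ X.halfspaces | y ∉ H ∧ x ∈ H} ∪
        compl '' {H ∈ X.halfspaces | x ∉ H ∧ y ∈ H}).Finite :=
      (finite_separating hX y x).union ((finite_separating hX x y).image _)
    refine Set.infinite_of_injective_forall_mem (f := fun n => f (n + 1)) ?_ ?_ hfin
    · intro m n hmn
      simpa using hf.injective hmn
    · intro n
      have hyn : y ∉ f (n + 1) := fun h => hy (hf.antitone (by omega : 1 ≤ n + 1) h)
      have hxn := hmem (n + 1)
      rcases h𝓗 _ hxn.1 with h | h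
      · exact Or.inl ⟨h, hyn, hxn.2⟩
      · exact Or.inr ⟨_, ⟨h, fun h' => h' hxn.2, hyn⟩, compl_compl _⟩

theorem compl_mem_axis {g : G} {H : Set V} (h : H ∈ X.axis g) : Hᶜ ∈ X.axis g := by
  rcases h with h | h
  · exact Or.inr (by rwa [Set.mem_ofPred_eq, compl_compl])
  · exact Or.inl h

variable [CubicalAction G X]

/-- Every positive half-space is crossed positively by every axis. -/
theorem IsCAT0.exists_forall_mem_iff (hX : X.IsCAT0) {g : G} (hg : 0 < X.translationDist g)
    {H : Set V} (hH : H ∈ X.axisPos g) {L : ℤ → V} (hL : X.IsAxis g L) :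
    ∃ n : ℤ, ∀ m, L m ∈ H ↔ n < m := by
  obtain ⟨hHs, L₀, hL₀, n₀, h1, h2⟩ := hH
  have h0 := hX.mem_iff_of_geodesic hL₀.1 hHs h1 h2
  have hpow : ∀ {L : ℤ → V}, X.IsAxis g L → ∀ (k : ℤ) n,
      g ^ k • L n = L (n + k * X.translationDist g) := by
    intro L hL k n
    induction k using Int.induction_on with
    | zero => simp
    | succ k ih =>
      rw [add_comm, zpow_add, mul_smul, ih, zpow_one, hL.2]
      congr 1
      ring
    | pred k ih =>
      rw [sub_eq_neg_add, zpow_add, mul_smul, ih, zpow_neg_one, inv_smul_eq_iff, hL.2]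
      congr 1
      ring
  have hmem : ∀ k m : ℤ, L₀ m ∈ g ^ k • H ↔ n₀ + k * X.translationDist g < m := by
    intro k m
    rw [Set.mem_smul_set_iff_inv_smul_mem, ← zpow_neg, hpow hL₀, h0]
    constructor <;> intro h <;> linarith
  have hinj : Function.Injective fun k : ℤ => g ^ k • H := by
    intro k k' hk
    have hk : g ^ k • H = g ^ k' • H := hk
    have e1 : ¬ n₀ + k * X.translationDist g < n₀ + k' * X.translationDist g := by
      rw [← hmem, hk, hmem]
      exact lt_irrefl _
    have e2 : ¬ n₀ + k' * X.translationDist g < n₀ + k * X.translationDist g := by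
      rw [← hmem, ← hk, hmem]
      exact lt_irrefl _
    have e3 : (k : ℤ) * X.translationDist g = k' * X.translationDist g := by linarith
    exact mul_right_cancel₀ (by positivity) e3
  have hpowH : ∀ k : ℤ, g ^ k • H ∈ X.halfspaces := fun k => X.smul_mem_halfspaces _ hHs
  have hinjN : Function.Injective fun k : ℕ => g ^ (k : ℤ) • H := fun a b h => by
    exact_mod_cast hinj h
  have hinjN' : Function.Injective fun k : ℕ => g ^ (-(k : ℤ)) • H := fun a b h => by
    have := hinj h
    omega
  have hℓ : (1 : ℤ) ≤ X.translationDist g := by exact_mod_cast hg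
  -- If no vertex `g ^ a • L 0` with `a ≥ 0` lay in `H`, all backward translates of `H` would miss
  -- `L 0`, while all beyond a certain power contain `L₀ 0`. The offset `n₀.toNat + 1` is that
  -- power. The existence of `b` is symmetric.
  obtain ⟨a, ha⟩ : ∃ a : ℕ, L (a * X.translationDist g) ∈ H := by
    by_contra hcon
    push Not at hcon
    refine Set.infinite_of_injective_forall_mem
      (f := fun k : ℕ => g ^ (-((k + n₀.toNat + 1 : ℕ) : ℤ)) • H) ?_ ?_
      (finite_separating hX.simplyConnected.1 (L 0) (L₀ 0))
    · intro i j hij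
      have := hinjN' hij
      omega
    · intro k
      refine ⟨hpowH _, ?_, ?_⟩
      · rw [Set.mem_smul_set_iff_inv_smul_mem, ← zpow_neg, neg_neg, hpow hL, zero_add]
        exact hcon _
      · rw [hmem]
        push_cast
        nlinarith [Int.self_le_toNat n₀]
  obtain ⟨b, hb⟩ : ∃ b : ℕ, L (-b * X.translationDist g) ∉ H := by
    by_contra hcon
    push Not at hcon
    refine Set.infinite_of_injective_forall_mem
      (f := fun k : ℕ => g ^ ((k + (-n₀).toNat + 1 : ℕ) : ℤ) • H) ?_ ?_
      (finite_separating hX.simplyConnected.1 (L₀ 0) (L 0))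
    · intro i j hij
      have := hinjN hij
      omega
    · intro k
      refine ⟨hpowH _, ?_, ?_⟩
      · rw [hmem]
        push_cast
        nlinarith [Int.self_le_toNat (-n₀)]
      · rw [Set.mem_smul_set_iff_inv_smul_mem, ← zpow_neg, hpow hL, zero_add]
        exact hcon _
  obtain ⟨n, hn, hn'⟩ : ∃ n, L n ∉ H ∧ L (n + 1) ∈ H := by
    by_contra hcon
    push Not at hcon
    have hstep : ∀ k : ℕ, L (-b * X.translationDist g + k) ∉ H := by
      intro k
      induction k with
      | zero => simpa using hb
      | succ k ih =>
        have := hcon _ ih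
        rwa [add_assoc] at this
    refine hstep ((a + b) * X.translationDist g) ?_
    convert ha using 2
    push_cast
    ring
  exact ⟨n, hX.mem_iff_of_geodesic hL.1 hHs hn hn'⟩

/-- The positive half-spaces are ranked by the order in which an axis crosses them; an automorphism
that acts non-transversely moves each of them properly into itself. -/
theorem IsCAT0.exists_isRankedSystem (hX : X.IsCAT0) {g : G} (hg : X.IsHyperbolic g)
    (hnt : X.ActsNonTransversely g) :
    ∃ pos : Set V → ℤ, IsRankedSystem (X.axisPos g) pos ∧
      ∀ H ∈ X.axisPos g, g • H ⊂ H ∧ pos (g • H) = pos H + X.translationDist g := by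
  classical
  by_cases hne : ∃ L, X.IsAxis g L
  swap
  -- Without an axis there are no positive half-spaces and every claim is vacuous.
  · have hempty : ∀ H, H ∉ X.axisPos g := by
      rintro H ⟨-, L, hL, -⟩
      exact hne ⟨L, hL⟩
    exact ⟨0, ⟨fun H hH => absurd hH (hempty H), fun H hH => absurd hH (hempty H),
      fun H hH => absurd hH (hempty H), fun H hH => absurd hH (hempty H)⟩,
      fun H hH => absurd hH (hempty H)⟩
  obtain ⟨L, hL⟩ := hne
  have hex := fun H (hH : H ∈ X.axisPos g) => hX.exists_forall_mem_iff hg.2 hH hL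
  choose! pos hpos using hex
  have hℓ : (0 : ℤ) < X.translationDist g := by exact_mod_cast hg.2
  have hsmul : ∀ H ∈ X.axisPos g, pos (g • H) = pos H + X.translationDist g := by
    intro H hH
    have h1 := hpos _ (X.smul_mem_axisPos g hH)
    have h2 : ∀ m, L m ∈ g • H ↔ pos H + X.translationDist g < m := by
      intro m
      have : g • L (m - X.translationDist g) = L m := by
        rw [hL.2, sub_add_cancel]
      rw [← this, Set.smul_mem_smul_set_iff, hpos H hH]
      constructor <;> intro h <;> linarith
    refine le_antisymm (not_lt.1 fun h => ?_) (not_lt.1 fun h => ?_)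
    · exact lt_irrefl _ ((h1 _).1 ((h2 _).2 h))
    · exact lt_irrefl _ ((h2 _).1 ((h1 _).2 h))
  have hrank : IsRankedSystem (X.axisPos g) pos := by
    refine ⟨fun H hH K hK h => ?_, fun H hH K hK h => ?_, fun H hH K hK h => ?_,
      fun H hH K hK h => ?_⟩
    · have h1 := (hpos H hH (max (pos H) (pos K) + 1)).2 (by omega)
      have h2 := (hpos K hK (max (pos H) (pos K) + 1)).2 (by omega)
      exact h h1 h2
    · have h1 : L (min (pos H) (pos K)) ∈ Hᶜ := fun h0 => by
        have := (hpos H hH _).1 h0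
        omega
      have := (hpos K hK _).1 (h h1)
      omega
    · refine halfspace_unique hH.1 hK.1 (adj_of_geodesic hL.1 (pos H)) ?_ ?_ ?_ ?_
      · rw [hpos H hH]; omega
      · rw [hpos H hH]; omega
      · rw [hpos K hK]; omega
      · rw [hpos K hK]; omega
    · by_contra hlt
      have := (hpos K hK (pos K)).1 (h ((hpos H hH _).2 (by omega)))
      omega
  refine ⟨pos, hrank, fun H hH => ⟨?_, hsmul H hH⟩⟩
  have hgH := X.smul_mem_axisPos g hH
  have hax : ∀ H ∈ X.axis g, H ∈ X.halfspaces ∨ Hᶜ ∈ X.halfspaces := by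
    rintro H (h | h)
    exacts [Or.inl h.1, Or.inr h.1]
  -- Vertices of `X` induce vertices of the essential set, so four nonempty intersections in `X`
  -- would give transversality there. Points of the axis witness three of them, which leaves `Hᶜ ∩ g
  -- • H` empty.
  let σ := ultrafilterAt hX.simplyConnected.1 hax (fun _ h => compl_mem_axis h)
  have hσ : ∀ x, ∀ K ∈ X.axisPos g, σ x ∈ SageevVertex.half (X.axis g) K ↔ x ∈ K :=
    fun x K hK => ⟨fun h => h.2, fun h => ⟨Or.inl hK, h⟩⟩
  have h3 : ¬ (Hᶜ ∩ g • H).Nonempty := by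
    rintro ⟨x, hx, hx'⟩
    refine hnt H (Or.inl hH) ⟨⟨σ (L (pos H + X.translationDist g + 1)), ?_, ?_⟩,
      ⟨σ (L (pos H + 1)), ?_, ?_⟩, ⟨σ x, ?_, ?_⟩, ⟨σ (L (pos H)), ?_, ?_⟩⟩ <;>
      simp only [Set.mem_compl_iff, hσ _ _ hH, hσ _ _ hgH, hpos _ hH, hpos _ hgH, hsmul H hH]
    all_goals first | omega | assumption
  have hsub : g • H ⊆ H := by
    intro x hx
    by_contra hxH
    exact h3 ⟨x, hxH, hx⟩
  refine hsub.ssubset_of_ne fun h => ?_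
  have := hsmul H hH
  rw [h] at this
  omega

end CubeComplex

/-! ### Chain decompositions of partial orders -/

section ChainDecomposition

variable {Q : Type*} [PartialOrder Q]

/-- Pigeonhole: members of an antichain have distinct colours, so `d` of them use all `d` colours.
-/
theorem exists_color_eq_of_antichain {B : Finset Q} {col : Q → ℕ} {d : ℕ}
    (hB : IsAntichain (· ≤ ·) (B : Set Q)) (hcard : B.card = d) (hlt : ∀ x ∈ B, col x < d)
    (hcol : ∀ x ∈ B, ∀ y ∈ B, col x = col y → x ≤ y ∨ y ≤ x) {i : ℕ} (hi : i < d) :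
    ∃ z ∈ B, col z = i := by
  have hinj : Set.InjOn col B := by
    intro x hx y hy hxy
    rcases hcol x hx y hy hxy with h | h
    exacts [hB.eq hx hy h, (hB.eq hy hx h).symm]
  have himg : B.image col = Finset.range d := by
    refine Finset.eq_of_subset_of_card_le ?_ ?_
    · intro j hj
      obtain ⟨x, hx, rfl⟩ := Finset.mem_image.1 hj
      exact Finset.mem_range.2 (hlt x hx)
    · rw [Finset.card_image_of_injOn hinj, hcard, Finset.card_range]
  have : i ∈ B.image col := by rw [himg]; exact Finset.mem_range.2 hi
  simpa using this

/-- Dilworth's theorem: a finite set without antichains of more than `d` elements is covered by `d`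
chains. -/
theorem exists_chain_coloring (F : Finset Q) (d : ℕ)
    (h : ∀ B ⊆ F, IsAntichain (· ≤ ·) (B : Set Q) → B.card ≤ d) :
    ∃ col : Q → ℕ, (∀ x ∈ F, col x < d) ∧
      ∀ x ∈ F, ∀ y ∈ F, col x = col y → x ≤ y ∨ y ≤ x := by
  classical
  induction hn : F.card using Nat.strong_induction_on generalizing F d with
  | _ n IH =>
  rcases F.eq_empty_or_nonempty with rfl | hne
  · exact ⟨fun _ => 0, by simp, by simp⟩
  -- Galvin's argument: set aside a maximal element `a` and cover the rest by as many chains as its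
  -- largest antichain `B₀` has members. Let `x i` be the top element of chain `i` among those in
  -- antichains of that size. The `x i` are pairwise incomparable. If `a` lies above some `x i`,
  -- removing `a` and the part of chain `i` below `x i` lowers the width. Otherwise `a` together
  -- with the `x i` is an antichain, and `a` may receive a colour of its own.
  obtain ⟨a, ha⟩ := F.exists_maximal hne
  have hsub : F.erase a ⊆ F := Finset.erase_subset _ _
  have hcardlt : (F.erase a).card < n := by
    rw [← hn]; exact Finset.card_erase_lt_of_mem ha.1
  let T : Finset (Finset Q) := (F.erase a).powerset.filter fun B => IsAntichain (· ≤ ·) (B : Set Q)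
  have hT : ∀ B, B ∈ T ↔ B ⊆ F.erase a ∧ IsAntichain (· ≤ ·) (B : Set Q) := by
    intro B; simp [T]
  obtain ⟨B₀, hB₀, hmax⟩ := T.exists_max_image Finset.card ⟨∅, (hT _).2 ⟨by simp, by simp⟩⟩
  rw [hT] at hB₀
  have hmax' : ∀ B ⊆ F.erase a, IsAntichain (· ≤ ·) (B : Set Q) → B.card ≤ B₀.card :=
    fun B h1 h2 => hmax B ((hT B).2 ⟨h1, h2⟩)
  have hkd : B₀.card ≤ d := h _ (hB₀.1.trans hsub) hB₀.2
  obtain ⟨col, hlt, hcol⟩ := IH _ hcardlt (F.erase a) B₀.card hmax' rfl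
  have hmeet : ∀ B ⊆ F.erase a, IsAntichain (· ≤ ·) (B : Set Q) → B.card = B₀.card →
      ∀ i < B₀.card, ∃ z ∈ B, col z = i := fun B h1 h2 h3 i hi =>
    exists_color_eq_of_antichain h2 h3 (fun x hx => hlt x (h1 hx))
      (fun x hx y hy => hcol x (h1 hx) y (h1 hy)) hi
  have hx : ∀ i < B₀.card, ∃ x ∈ F.erase a, col x = i ∧
      (∃ B ⊆ F.erase a, IsAntichain (· ≤ ·) (B : Set Q) ∧ B.card = B₀.card ∧ x ∈ B) ∧
      ∀ B ⊆ F.erase a, IsAntichain (· ≤ ·) (B : Set Q) → B.card = B₀.card →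
        ∀ z ∈ B, col z = i → z ≤ x := by
    intro i hi
    let S := (F.erase a).filter fun x => col x = i ∧
      ∃ B ⊆ F.erase a, IsAntichain (· ≤ ·) (B : Set Q) ∧ B.card = B₀.card ∧ x ∈ B
    obtain ⟨z, hz, hzi⟩ := hmeet B₀ hB₀.1 hB₀.2 rfl i hi
    obtain ⟨x, hx⟩ := S.exists_maximal ⟨z, Finset.mem_filter.2
      ⟨hB₀.1 hz, hzi, B₀, hB₀.1, hB₀.2, rfl, hz⟩⟩
    have hxS := Finset.mem_filter.1 hx.1
    refine ⟨x, hxS.1, hxS.2.1, hxS.2.2, fun B h1 h2 h3 z hz hzi => ?_⟩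
    have hzS : z ∈ S := Finset.mem_filter.2 ⟨h1 hz, hzi, B, h1, h2, h3, hz⟩
    rcases hcol z (h1 hz) x hxS.1 (hzi.trans hxS.2.1.symm) with h4 | h4
    exacts [h4, hx.2 hzS h4]
  have : Nonempty Q := ⟨a⟩
  choose! x hxF hxcol hxB hxmax using hx
  have hanti : ∀ i < B₀.card, ∀ j < B₀.card, x i ≤ x j → i = j := by
    intro i hi j hj hij
    by_contra hne
    obtain ⟨B, h1, h2, h3, h4⟩ := hxB j hj
    obtain ⟨y, hy, hyi⟩ := hmeet B h1 h2 h3 i hi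
    have hyx := hxmax i hi B h1 h2 h3 y hy hyi
    have := h2.eq hy h4 (hyx.trans hij)
    rw [this, hxcol j hj] at hyi
    exact hne hyi.symm
  by_cases hcase : ∃ i < B₀.card, x i ≤ a
  · obtain ⟨i, hi, hia⟩ := hcase
    let K := insert a ((F.erase a).filter fun z => col z = i ∧ z ≤ x i)
    have hKchain : ∀ y ∈ K, ∀ z ∈ K, y ≤ z ∨ z ≤ y := by
      have key : ∀ y ∈ K, y = a ∨ (y ∈ F.erase a ∧ col y = i ∧ y ≤ x i) := by
        intro y hy
        simpa [K] using hy
      intro y hy z hz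
      rcases key y hy with rfl | ⟨h1, h2, h3⟩ <;> rcases key z hz with rfl | ⟨h4, h5, h6⟩
      exacts [Or.inl le_rfl, Or.inr (h6.trans hia), Or.inl (h3.trans hia),
        hcol y h1 z h4 (h2.trans h5.symm)]
    have hsub' : F \ K ⊆ F.erase a := by
      intro z hz
      rw [Finset.mem_sdiff] at hz
      exact Finset.mem_erase.2 ⟨fun h0 => hz.2 (by simp [K, h0]), hz.1⟩
    have hsmall : ∀ B ⊆ F \ K, IsAntichain (· ≤ ·) (B : Set Q) → B.card ≤ B₀.card - 1 := by
      intro B h1 h2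
      have h3 := hmax' B (h1.trans hsub') h2
      by_contra hcon
      have h4 : B.card = B₀.card := by omega
      obtain ⟨z, hz, hzi⟩ := hmeet B (h1.trans hsub') h2 h4 i hi
      refine (Finset.mem_sdiff.1 (h1 hz)).2 ?_
      exact Finset.mem_insert_of_mem (Finset.mem_filter.2
        ⟨hsub' (h1 hz), hzi, hxmax i hi B (h1.trans hsub') h2 h4 z hz hzi⟩)
    obtain ⟨col', hlt', hcol'⟩ := IH _ ((Finset.card_le_card hsub').trans_lt hcardlt) (F \ K) _
      hsmall rfl
    refine ⟨fun z => if z ∈ K then B₀.card - 1 else col' z, fun z hz => ?_, fun y hy z hz => ?_⟩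
    · by_cases hzK : z ∈ K
      · simp only [hzK, if_true]; omega
      · have := hlt' z (Finset.mem_sdiff.2 ⟨hz, hzK⟩)
        simp only [hzK, if_false]; omega
    · by_cases hyK : y ∈ K <;> by_cases hzK : z ∈ K <;> simp only [hyK, hzK, if_true, if_false]
      · exact fun _ => hKchain y hyK z hzK
      · intro h0
        have := hlt' z (Finset.mem_sdiff.2 ⟨hz, hzK⟩)
        omega
      · intro h0
        have := hlt' y (Finset.mem_sdiff.2 ⟨hy, hyK⟩)
        omega
      · exact hcol' y (Finset.mem_sdiff.2 ⟨hy, hyK⟩) z (Finset.mem_sdiff.2 ⟨hz, hzK⟩)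
  · push Not at hcase
    let B := insert a ((Finset.range B₀.card).image x)
    have hinj : Set.InjOn x (Finset.range B₀.card) := by
      intro i hi j hj hij
      exact hanti i (by simpa using hi) j (by simpa using hj) hij.le
    have hBsub : B ⊆ F := by
      intro z hz
      rcases Finset.mem_insert.1 hz with rfl | hz
      · exact ha.1
      · obtain ⟨i, hi, rfl⟩ := Finset.mem_image.1 hz
        exact hsub (hxF i (Finset.mem_range.1 hi))
    have hnot : a ∉ (Finset.range B₀.card).image x := by
      intro hz
      obtain ⟨i, hi, h0⟩ := Finset.mem_image.1 hz
      exact hcase i (Finset.mem_range.1 hi) h0.le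
    have hBanti : IsAntichain (· ≤ ·) (B : Set Q) := by
      intro y hy z hz hyz hle
      rcases Finset.mem_insert.1 hy with rfl | hy' <;>
        rcases Finset.mem_insert.1 hz with rfl | hz'
      · exact hyz rfl
      · have := ha.2 (hBsub (Finset.mem_insert_of_mem hz')) hle
        exact hyz (le_antisymm hle this)
      · obtain ⟨i, hi, rfl⟩ := Finset.mem_image.1 hy'
        exact hcase i (Finset.mem_range.1 hi) hle
      · obtain ⟨i, hi, rfl⟩ := Finset.mem_image.1 hy'
        obtain ⟨j, hj, rfl⟩ := Finset.mem_image.1 hz'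
        exact hyz (congrArg x (hanti i (Finset.mem_range.1 hi) j (Finset.mem_range.1 hj) hle))
    have hBcard : B.card = B₀.card + 1 := by
      rw [Finset.card_insert_of_notMem hnot, Finset.card_image_of_injOn hinj, Finset.card_range]
    have hle := h B hBsub hBanti
    refine ⟨fun z => if z = a then B₀.card else col z, fun z hz => ?_, fun y hy z hz => ?_⟩
    · by_cases hza : z = a
      · simp only [hza, if_true]; omega
      · have := hlt z (Finset.mem_erase.2 ⟨hza, hz⟩)
        simp only [hza, if_false]; omega
    · by_cases hya : y = a <;> by_cases hza : z = a <;> simp only [hya, hza, if_true, if_false]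
      · exact fun _ => Or.inl le_rfl
      · intro h0
        have := hlt z (Finset.mem_erase.2 ⟨hza, hz⟩)
        omega
      · intro h0
        have := hlt y (Finset.mem_erase.2 ⟨hya, hy⟩)
        omega
      · exact hcol y (Finset.mem_erase.2 ⟨hya, hy⟩) z (Finset.mem_erase.2 ⟨hza, hz⟩)

/-- Dilworth's theorem for an order-convex finite set, with the first chain saturated. -/
theorem exists_chain_coloring_saturated (F : Finset Q) (d : ℕ)
    (hconv : ∀ x ∈ F, ∀ y ∈ F, ∀ z, x ≤ z → z ≤ y → z ∈ F)
    (h : ∀ B ⊆ F, IsAntichain (· ≤ ·) (B : Set Q) → B.card ≤ d) :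
    ∃ col : Q → ℕ, (∀ x ∈ F, col x < d) ∧
      (∀ x ∈ F, ∀ y ∈ F, col x = col y → x ≤ y ∨ y ≤ x) ∧
      ∀ x ∈ F, ∀ y ∈ F, col x = 0 → col y = 0 → ∀ z, x < z → z < y →
        ∃ w ∈ F, col w = 0 ∧ x < w ∧ w < y := by
  classical
  obtain ⟨col, hlt, hcol⟩ := exists_chain_coloring F d h
  -- Colour zero is replaced by a largest chain `D` of `F` containing it; the other colour classes
  -- only shrink. An element lying between two consecutive members of `D` could be added to `D`, by
  -- convexity of `F`.
  let T := F.powerset.filter fun D =>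
    (∀ x ∈ D, ∀ y ∈ D, x ≤ y ∨ y ≤ x) ∧ F.filter (fun x => col x = 0) ⊆ D
  have hT : ∀ D, D ∈ T ↔ D ⊆ F ∧ (∀ x ∈ D, ∀ y ∈ D, x ≤ y ∨ y ≤ x) ∧
      F.filter (fun x => col x = 0) ⊆ D := by
    intro D; simp only [T, Finset.mem_filter, Finset.mem_powerset]
  obtain ⟨D, hD, hmax⟩ := T.exists_max_image Finset.card ⟨F.filter (fun x => col x = 0),
    (hT _).2 ⟨Finset.filter_subset _ _, fun x hx y hy => by
      rw [Finset.mem_filter] at hx hy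
      exact hcol x hx.1 y hy.1 (hx.2.trans hy.2.symm), subset_rfl⟩⟩
  obtain ⟨hDF, hDc, hD0⟩ := (hT D).1 hD
  have hcolD : ∀ x ∈ F, x ∉ D → col x ≠ 0 := fun x hx hxD h0 =>
    hxD (hD0 (Finset.mem_filter.2 ⟨hx, h0⟩))
  have hzero : ∀ x ∈ F, (if x ∈ D then 0 else col x) = 0 → x ∈ D := by
    intro x hx h0
    by_contra hxD
    rw [if_neg hxD] at h0
    exact hcolD x hx hxD h0
  refine ⟨fun x => if x ∈ D then 0 else col x, fun x hx => ?_, fun x hx y hy => ?_, ?_⟩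
  · have := hlt x hx
    dsimp only
    split_ifs <;> omega
  · by_cases hxD : x ∈ D <;> by_cases hyD : y ∈ D <;> simp only [hxD, hyD, if_true, if_false]
    · exact fun _ => hDc x hxD y hyD
    · exact fun h0 => absurd h0.symm (hcolD y hy hyD)
    · exact fun h0 => absurd h0 (hcolD x hx hxD)
    · exact hcol x hx y hy
  · intro x hx y hy hx0 hy0 z hxz hzy
    have hxD := hzero x hx hx0
    have hyD := hzero y hy hy0
    by_contra hcon
    push Not at hcon
    have hzF := hconv x hx y hy z hxz.le hzy.le
    have hzD : z ∉ D := fun hzD => hcon z hzF (by simp [hzD]) hxz hzy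
    have hcomp : ∀ w ∈ D, w ≤ z ∨ z ≤ w := by
      intro w hw
      rcases hDc w hw x hxD with h1 | h1
      · exact Or.inl (h1.trans hxz.le)
      rcases hDc y hyD w hw with h2 | h2
      · exact Or.inr (hzy.le.trans h2)
      rcases h1.eq_or_lt with rfl | h1
      · exact Or.inl hxz.le
      rcases h2.eq_or_lt with rfl | h2
      · exact Or.inr hzy.le
      exact absurd h2 (hcon w (hDF hw) (by simp [hw]) h1)
    have := hmax (insert z D) ((hT _).2 ⟨Finset.insert_subset hzF hDF, ?_,
      hD0.trans (Finset.subset_insert _ _)⟩)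
    · rw [Finset.card_insert_of_notMem hzD] at this
      omega
    · intro u hu v hv
      rcases Finset.mem_insert.1 hu with rfl | hu' <;>
        rcases Finset.mem_insert.1 hv with rfl | hv'
      exacts [Or.inl le_rfl, (hcomp v hv').symm, hcomp u hu', hDc u hu' v hv']

/-! ### Sets of integers -/

/-- A set of integers unbounded in both directions is a locally finite linear order without ends,
hence a copy of `ℤ`. The numbering is then shifted. -/
theorem exists_strictMono_int_range_eq {T : Set ℤ} (hup : ∀ m, ∃ t ∈ T, m ≤ t)
    (hdown : ∀ m, ∃ t ∈ T, t ≤ m) {t₀ : ℤ} (ht₀ : t₀ ∈ T) :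
    ∃ f : ℤ → ℤ, StrictMono f ∧ Set.range f = T ∧ f 0 = t₀ := by
  classical
  have : Nonempty T := ⟨⟨t₀, ht₀⟩⟩
  have : NoMaxOrder T := ⟨fun a => by
    obtain ⟨t, ht, h⟩ := hup (a + 1)
    exact ⟨⟨t, ht⟩, Subtype.coe_lt_coe.1 (by change (a : ℤ) < t; omega)⟩⟩
  have : NoMinOrder T := ⟨fun a => by
    obtain ⟨t, ht, h⟩ := hdown (a - 1)
    exact ⟨⟨t, ht⟩, Subtype.coe_lt_coe.1 (by change t < (a : ℤ); omega)⟩⟩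
  let : SuccOrder T := LinearLocallyFiniteOrder.succOrder T
  let : PredOrder T := LinearLocallyFiniteOrder.predOrder T
  let e : T ≃o ℤ := orderIsoIntOfLinearSuccPredArch
  refine ⟨fun n => e.symm (n + e ⟨t₀, ht₀⟩), ?_, ?_, by simp⟩
  · intro m n hmn
    have : e.symm (m + e ⟨t₀, ht₀⟩) < e.symm (n + e ⟨t₀, ht₀⟩) := by
      rw [e.symm.lt_iff_lt]; omega
    exact this
  · ext t
    constructor
    · rintro ⟨n, rfl⟩
      exact (e.symm _).2
    · intro ht
      exact ⟨e ⟨t, ht⟩ - e ⟨t₀, ht₀⟩, by simp⟩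

theorem StrictMono.int_eq_add_of_surjective {u : ℤ → ℤ} (hu : StrictMono u)
    (hs : Function.Surjective u) (n : ℤ) : u n = n + u 0 := by
  have hstep : ∀ n, u (n + 1) = u n + 1 := by
    intro n
    obtain ⟨k, hk⟩ := hs (u n + 1)
    have h1 : n < k := hu.lt_iff_lt.1 (by omega)
    have h2 : u (n + 1) ≤ u k := hu.monotone (by omega)
    have h3 : u n < u (n + 1) := hu (by omega)
    omega
  induction n using Int.induction_on with
  | zero => simp
  | succ k ih => rw [hstep, ih]; ring
  | pred k ih =>
    have := hstep (-k - 1)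
    rw [sub_add_cancel, ih] at this
    linarith

end ChainDecomposition

/-! ### Equivariant chain decompositions -/

section EquivariantChains

variable {Q : Type*} [PartialOrder Q]

/-- The elements between an antichain `A` and its image `g A`. -/
def antichainSpan (g : Q ≃o Q) (A : Finset Q) : Set Q :=
  {x | (∃ a ∈ A, x ≤ a) ∧ ∃ a ∈ A, g a ≤ x}

/-- Otherwise `x` could be added to `A`. -/
theorem exists_comparable_of_maximum {A : Finset Q} (hA : IsAntichain (· ≤ ·) (A : Set Q))
    (hmax : ∀ B : Finset Q, IsAntichain (· ≤ ·) (B : Set Q) → B.card ≤ A.card) (x : Q) :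
    ∃ a ∈ A, x ≤ a ∨ a ≤ x := by
  classical
  by_contra hcon
  push Not at hcon
  have hx : x ∉ A := fun hx => (hcon x hx).1 le_rfl
  have := hmax (insert x A) (by
    rw [Finset.coe_insert]
    refine hA.insert ?_ ?_
    · exact fun b hb _ => (hcon b hb).2
    · exact fun b hb _ => (hcon b hb).1)
  rw [Finset.card_insert_of_notMem hx] at this
  omega

variable {pos : Q → ℤ} {g : Q ≃o Q} {ℓ : ℤ}

theorem pos_zpow (hgpos : ∀ x, pos (g x) = pos x + ℓ) (n : ℤ) (x : Q) :
    pos ((g ^ n : Q ≃o Q) x) = pos x + n * ℓ := by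
  induction n using Int.induction_on with
  | zero => simp
  | succ k ih =>
    rw [add_comm (k : ℤ), zpow_add, zpow_one, RelIso.mul_apply, hgpos, ih]
    ring
  | pred k ih =>
    have h1 : pos ((g ^ (-(k : ℤ)) : Q ≃o Q) x) = pos ((g ^ (-(k : ℤ) - 1) : Q ≃o Q) x) + ℓ := by
      rw [← hgpos, ← RelIso.mul_apply]
      congr 2
      rw [← zpow_one_add]
      congr 1
      ring
    rw [ih] at h1
    linarith

theorem finite_antichainSpan (hpos : Function.Injective pos) (hle : ∀ x y, x ≤ y → pos y ≤ pos x)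
    (A : Finset Q) : (antichainSpan g A).Finite := by
  have : (antichainSpan g A) ⊆ ⋃ a ∈ A, ⋃ b ∈ A, pos ⁻¹' Set.Icc (pos a) (pos (g b)) := by
    rintro x ⟨⟨a, ha, hxa⟩, b, hb, hbx⟩
    simp only [Set.mem_iUnion]
    exact ⟨a, ha, b, hb, hle _ _ hxa, hle _ _ hbx⟩
  refine Set.Finite.subset ?_ this
  exact A.finite_toSet.biUnion fun a _ => A.finite_toSet.biUnion fun b _ =>
    (Set.finite_Icc _ _).preimage hpos.injOn

/-- The coloring of the span `[A, gA]` by `d` chains, the first of which is saturated. -/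
theorem exists_fin_coloring (hpos : Function.Injective pos)
    (hle : ∀ x y, x ≤ y → pos y ≤ pos x) {d : ℕ} (A : Finset Q)
    (hmax : ∀ B : Finset Q, IsAntichain (· ≤ ·) (B : Set Q) → B.card ≤ d) :
    ∃ col : Q → Fin d, (∀ x ∈ antichainSpan g A, ∀ y ∈ antichainSpan g A,
        col x = col y → x ≤ y ∨ y ≤ x) ∧
      ∀ hd : 0 < d, ∀ x ∈ antichainSpan g A, ∀ y ∈ antichainSpan g A,
        col x = ⟨0, hd⟩ → col y = ⟨0, hd⟩ → ∀ z, x < z → z < y →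
        ∃ w ∈ antichainSpan g A, col w = ⟨0, hd⟩ ∧ x < w ∧ w < y := by
  classical
  have hfin := finite_antichainSpan (g := g) hpos hle A
  obtain ⟨col, h1, h2, h3⟩ := exists_chain_coloring_saturated hfin.toFinset d (by
    intro x hx y hy z hxz hzy
    rw [Set.Finite.mem_toFinset] at *
    exact ⟨hy.1.imp fun a ha => ⟨ha.1, hzy.trans ha.2⟩, hx.2.imp fun a ha => ⟨ha.1, ha.2.trans hxz⟩⟩)
    (fun B _ hB => hmax B hB)
  simp only [Set.Finite.mem_toFinset] at h1 h2 h3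
  have hd : ∀ x : Q, 0 < d := fun x => by
    have := hmax {x} (by simp)
    rw [Finset.card_singleton] at this
    omega
  -- Reduction modulo `d` only supplies values in `Fin d` off the span, where colours are arbitrary.
  have hval : ∀ x ∈ antichainSpan g A, col x % d = col x := fun x hx => Nat.mod_eq_of_lt (h1 x hx)
  refine ⟨fun x => ⟨col x % d, Nat.mod_lt _ (hd x)⟩, ?_, ?_⟩
  · intro x hx y hy hxy
    simp only [Fin.mk.injEq, hval x hx, hval y hy] at hxy
    exact h2 x hx y hy hxy
  · intro hd x hx y hy hx0 hy0 z hxz hzy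
    simp only [Fin.mk.injEq, hval x hx, hval y hy] at hx0 hy0
    obtain ⟨w, hw, hw0, h⟩ := h3 x hx y hy hx0 hy0 z hxz hzy
    exact ⟨w, hw, by simp [hw0], h⟩

/-- The level of `x` is the largest `n` such that `x` lies below a member of `g ^ n A`, and `g ^
(-n) x` then lies in the span of `A` and `gA`, where a chain colouring exists. Each colour occurs
exactly once in `A` and once in `gA`, so comparing the two defines a permutation `τ`. At level `n`
the colouring is transported by `g ^ n` and twisted by `τ ^ n`. Pieces of one colour at successive
levels meet at a member of a translate of `A`, and elements at different levels are comparable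
through it. -/
theorem exists_equivariant_coloring (hpos : Function.Injective pos)
    (hle : ∀ x y, x ≤ y → pos y ≤ pos x) (hℓ : 0 < ℓ) (hg : ∀ x, g x < x)
    (hgpos : ∀ x, pos (g x) = pos x + ℓ) {d : ℕ} {A : Finset Q}
    (hA : IsAntichain (· ≤ ·) (A : Set Q)) (hcard : A.card = d)
    (hmax : ∀ B : Finset Q, IsAntichain (· ≤ ·) (B : Set Q) → B.card ≤ d) :
    ∃ (color : Q → Fin d) (τ : Equiv.Perm (Fin d)) (α : Fin d → Q),
      (∀ x y, color x = color y → x ≤ y ∨ y ≤ x) ∧ (∀ x, color (g x) = τ (color x)) ∧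
      (∀ i, α i ∈ A) ∧ (∀ i, color (α i) = i) ∧
      ∀ hd : 0 < d, ∀ x ∈ antichainSpan g A, ∀ y ∈ antichainSpan g A,
        color x = ⟨0, hd⟩ → color y = ⟨0, hd⟩ → ∀ z, x < z → z < y →
        ∃ w, color w = ⟨0, hd⟩ ∧ x < w ∧ w < y := by
  classical
  obtain ⟨col, hcol, hsat⟩ := exists_fin_coloring (g := g) hpos hle A hmax
  have hAspan : ∀ a ∈ A, a ∈ antichainSpan g A := fun a ha => ⟨⟨a, ha, le_rfl⟩, a, ha, (hg a).le⟩
  have hgAspan : ∀ a ∈ A, g a ∈ antichainSpan g A :=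
    fun a ha => ⟨⟨a, ha, (hg a).le⟩, a, ha, le_rfl⟩
  have hAeq : ∀ a ∈ A, ∀ b ∈ A, a ≤ b → a = b := fun a ha b hb h => hA.eq ha hb h
  -- the colors of the elements of `A`
  have hα : ∀ i, ∃ a ∈ A, col a = i := by
    intro i
    obtain ⟨z, hz, h⟩ := exists_color_eq_of_antichain (col := fun x => (col x : ℕ)) hA hcard
      (fun x _ => (col x).2) (fun x hx y hy hxy => hcol x (hAspan x hx) y (hAspan y hy)
        (Fin.ext hxy)) i.2
    exact ⟨z, hz, Fin.ext h⟩
  choose α hαA hαcol using hα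
  have hαeq : ∀ a ∈ A, α (col a) = a := by
    intro a ha
    rcases hcol _ (hAspan _ (hαA (col a))) a (hAspan a ha) (hαcol _) with h | h
    exacts [hAeq _ (hαA _) _ ha h, (hAeq _ ha _ (hαA _) h).symm]
  let τ₀ : Fin d → Fin d := fun i => col (g (α i))
  have hτ₀ : Function.Injective τ₀ := by
    intro i j hij
    have : α i = α j := by
      rcases hcol _ (hgAspan _ (hαA i)) _ (hgAspan _ (hαA j)) hij with h | h <;>
        rw [OrderIso.le_iff_le] at h
      exacts [hAeq _ (hαA i) _ (hαA j) h, (hAeq _ (hαA j) _ (hαA i) h).symm]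
    rw [← hαcol i, this, hαcol]
  let τ : Equiv.Perm (Fin d) := Equiv.ofBijective τ₀ (Finite.injective_iff_bijective.1 hτ₀)
  have hτ : ∀ i, τ i = col (g (α i)) := fun _ => rfl
  -- the level of an element
  let D : ℤ → Q → Prop := fun n x => ∃ a ∈ A, x ≤ (g ^ n : Q ≃o Q) a
  have hcomp : ∀ (n : ℤ) x, ∃ a ∈ A, x ≤ (g ^ n : Q ≃o Q) a ∨ (g ^ n : Q ≃o Q) a ≤ x := by
    intro n x
    obtain ⟨a, ha, h⟩ := exists_comparable_of_maximum hA (hcard ▸ hmax) ((g ^ n : Q ≃o Q).symm x)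
    refine ⟨a, ha, ?_⟩
    rwa [OrderIso.symm_apply_le, OrderIso.le_symm_apply] at h
  have hganti : ∀ x, Antitone fun n : ℤ => (g ^ n : Q ≃o Q) x := by
    intro x
    refine antitone_int_of_succ_le fun n => ?_
    rw [zpow_add, zpow_one, RelIso.mul_apply, OrderIso.le_iff_le]
    exact (hg x).le
  have hDbdd : ∀ x, ∃ N, ∀ n, D n x → n ≤ N := by
    intro x
    obtain ⟨m, hm⟩ := (A.finite_toSet.image pos).bddBelow
    refine ⟨max 0 (pos x - m), ?_⟩
    rintro n ⟨a, ha, h⟩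
    have h1 := hle _ _ h
    have h2 := hm ⟨a, ha, rfl⟩
    rw [pos_zpow hgpos] at h1
    by_contra hlt
    rw [not_le, max_lt_iff] at hlt
    nlinarith
  have hDex : ∀ x, ∃ n, D n x := by
    intro x
    obtain ⟨M, hM⟩ := (A.finite_toSet.image pos).bddAbove
    refine ⟨-(max 0 (M - pos x) + 1), ?_⟩
    obtain ⟨a, ha, h | h⟩ := hcomp (-(max 0 (M - pos x) + 1)) x
    · exact ⟨a, ha, h⟩
    · exfalso
      have h1 := hle _ _ h
      have h2 := hM ⟨a, ha, rfl⟩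
      rw [pos_zpow hgpos] at h1
      have h3 := le_max_left 0 (M - pos x)
      have h4 := le_max_right 0 (M - pos x)
      nlinarith
  have hDanti : ∀ x m n, n ≤ m → D m x → D n x := by
    rintro x m n hnm ⟨a, ha, h⟩
    exact ⟨a, ha, h.trans (hganti a hnm)⟩
  have hlev : ∀ x, ∃ n, D n x ∧ ∀ m, D m x → m ≤ n := fun x =>
    Int.exists_greatest_of_bdd (hDbdd x) (hDex x)
  choose lev hlevD hlevmax using hlev
  have hlevu : ∀ x n, D n x → ¬ D (n + 1) x → lev x = n := by
    intro x n h1 h2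
    refine le_antisymm (not_lt.1 fun h => h2 (hDanti x _ _ h (hlevD x))) (hlevmax x n h1)
  have hDg : ∀ x (n m : ℤ), D n x ↔ D (n + m) ((g ^ m : Q ≃o Q) x) := by
    intro x n m
    refine exists_congr fun a => and_congr_right fun _ => ?_
    rw [add_comm, zpow_add, RelIso.mul_apply, OrderIso.le_iff_le]
  have hlevnot : ∀ x, ¬ D (lev x + 1) x := fun x h => by
    have := hlevmax x _ h
    omega
  have hlevg : ∀ x (m : ℤ), lev ((g ^ m : Q ≃o Q) x) = lev x + m := by
    intro x m
    refine hlevu _ _ ((hDg _ _ _).1 (hlevD x)) fun h => hlevnot x ?_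
    rw [hDg _ _ m]
    convert h using 1
    ring
  let base : Q → Q := fun x => (g ^ (-lev x) : Q ≃o Q) x
  have hbase : ∀ x, (g ^ lev x : Q ≃o Q) (base x) = x := by
    intro x
    rw [← RelIso.mul_apply, ← zpow_add, add_neg_cancel, zpow_zero, RelIso.one_apply]
  have hspan : ∀ x, base x ∈ antichainSpan g A := by
    intro x
    constructor
    · have := (hDg x (lev x) (-lev x)).1 (hlevD x)
      rw [add_neg_cancel] at this
      obtain ⟨a, ha, h⟩ := this
      rw [zpow_zero, RelIso.one_apply] at h
      exact ⟨a, ha, h⟩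
    · obtain ⟨a, ha, h | h⟩ := hcomp 1 (base x)
      · refine absurd ?_ (hlevnot x)
        rw [hDg _ _ (-lev x), add_neg_cancel_comm]
        exact ⟨a, ha, h⟩
      · exact ⟨a, ha, by simpa using h⟩
  let color : Q → Fin d := fun x => (τ ^ lev x) (col (base x))
  have hcolor : ∀ x, color x = (τ ^ lev x) (col (base x)) := fun _ => rfl
  have hcolorg : ∀ x (m : ℤ), color ((g ^ m : Q ≃o Q) x) = (τ ^ m) (color x) := by
    intro x m
    have : base ((g ^ m : Q ≃o Q) x) = base x := by
      change (g ^ (-lev ((g ^ m : Q ≃o Q) x)) : Q ≃o Q) ((g ^ m : Q ≃o Q) x) =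
        (g ^ (-lev x) : Q ≃o Q) x
      rw [hlevg, ← RelIso.mul_apply, ← zpow_add]
      congr 2
      ring
    rw [hcolor, hcolor, hlevg, this, ← Equiv.Perm.mul_apply, ← zpow_add, add_comm]
  have hcolor0 : ∀ x, lev x = 0 → color x = col x := by
    intro x hx
    rw [hcolor, hx, zpow_zero, Equiv.Perm.one_apply]
    change col ((g ^ (-lev x) : Q ≃o Q) x) = col x
    rw [hx, neg_zero, zpow_zero, RelIso.one_apply]
  have hDA : ∀ a ∈ A, lev a = 0 := by
    intro a ha
    refine hlevu a 0 ⟨a, ha, by simp⟩ ?_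
    rintro ⟨b, hb, h⟩
    rw [zero_add, zpow_one] at h
    obtain rfl := hAeq a ha b hb (h.trans (hg b).le)
    exact absurd h (hg a).not_ge
  have hcolorA : ∀ i, color (α i) = i := fun i => by
    rw [hcolor0 _ (hDA _ (hαA i)), hαcol]
  -- Both sides have the same colour, hence are comparable. The opposite inequality would put `α (τ
  -- j)` below `α j`, forcing them to be equal and `α j ≤ g (α j)`.
  have hkey : ∀ j, g (α j) ≤ α (τ j) := by
    intro j
    rcases hcol _ (hgAspan _ (hαA j)) _ (hAspan _ (hαA (τ j))) ((hτ j).symm.trans (hαcol _).symm)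
      with h | h
    · exact h
    · have := hAeq _ (hαA _) _ (hαA j) (h.trans (hg _).le)
      rw [this] at h
      exact absurd h (hg _).not_ge
  -- The member of `g ^ n A` that has colour `i`. An element of colour `i` and level `n` lies
  -- between `β i (n + 1)` and `β i n`.
  let β : Fin d → ℤ → Q := fun i n => (g ^ n : Q ≃o Q) (α ((τ ^ (-n)) i))
  have hβ : ∀ i n, β i n = (g ^ n : Q ≃o Q) (α ((τ ^ (-n)) i)) := fun _ _ => rfl
  have hβanti : ∀ i, Antitone (β i) := by
    intro i
    refine antitone_int_of_succ_le fun n => ?_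
    have h := hkey ((τ ^ (-(n + 1))) i)
    rw [← Equiv.Perm.mul_apply, ← zpow_one_add, show 1 + -(n + 1) = -n by ring] at h
    rw [hβ, hβ, zpow_add g, zpow_one, RelIso.mul_apply, OrderIso.le_iff_le]
    exact h
  have hβle : ∀ x, x ≤ β (color x) (lev x) := by
    intro x
    rw [hβ, hcolor, ← Equiv.Perm.mul_apply, ← zpow_add, neg_add_cancel, zpow_zero,
      Equiv.Perm.one_apply]
    nth_rewrite 1 [← hbase x]
    rw [OrderIso.le_iff_le]
    rcases hcol _ (hspan x) _ (hAspan _ (hαA (col (base x)))) (hαcol _).symm with h | h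
    · exact h
    · obtain ⟨a, ha, h'⟩ := (hspan x).1
      exact h'.trans (hAeq _ (hαA _) _ ha (h.trans h')).ge
  have hβge : ∀ x, β (color x) (lev x + 1) ≤ x := by
    intro x
    rw [hβ, hcolor, ← Equiv.Perm.mul_apply, ← zpow_add, show -(lev x + 1) + lev x = -1 by ring]
    nth_rewrite 3 [← hbase x]
    rw [zpow_add, RelIso.mul_apply, OrderIso.le_iff_le, zpow_one]
    rcases hcol _ (hgAspan _ (hαA ((τ ^ (-1 : ℤ)) (col (base x))))) _ (hspan x)
      (by rw [← hτ, ← Equiv.Perm.mul_apply, ← zpow_one_add]; rfl) with h | h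
    · exact h
    · refine absurd ?_ (hlevnot x)
      rw [hDg _ _ (-lev x), add_neg_cancel_comm]
      exact ⟨_, hαA _, by rw [zpow_one]; exact h⟩
  have hcc : ∀ x y, lev x ≤ lev y → color x = color y → x ≤ y ∨ y ≤ x := by
    intro x y hxy h
    rcases hxy.eq_or_lt with hl | hl
    · rw [hcolor, hcolor, hl] at h
      rw [← hbase x, ← hbase y, hl, OrderIso.le_iff_le, OrderIso.le_iff_le]
      exact hcol _ (hspan x) _ (hspan y) ((τ ^ lev y).injective h)
    · right
      have h1 := hβle y
      rw [← h] at h1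
      exact h1.trans ((hβanti _ hl).trans (hβge x))
  have hspancol : ∀ x ∈ antichainSpan g A, color x = col x := by
    rintro x ⟨⟨a, ha, hxa⟩, b, hb, hbx⟩
    -- The span consists of level zero together with `gA`, which has level one. On `gA` the twist by
    -- `τ` restores the original colour, so the saturation of the first chain survives.
    by_cases h1 : D 1 x
    · obtain ⟨a', ha', h1⟩ := h1
      rw [zpow_one] at h1
      obtain rfl := hAeq b hb a' ha' ((OrderIso.le_iff_le g).1 (hbx.trans h1))
      obtain rfl := le_antisymm h1 hbx
      have h2 := hcolorg b 1
      rw [zpow_one, zpow_one, hcolor0 b (hDA b hb), hτ, hαeq b hb] at h2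
      exact h2
    · exact hcolor0 x (hlevu x 0 ⟨a, ha, by simpa using hxa⟩ (by rwa [zero_add]))
  refine ⟨color, τ, α, fun x y h => ?_, fun x => ?_, hαA, hcolorA, ?_⟩
  · rcases le_total (lev x) (lev y) with hl | hl
    exacts [hcc x y hl h, (hcc y x hl h.symm).symm]
  · have := hcolorg x 1
    rwa [zpow_one, zpow_one] at this
  · intro hd x hx y hy hx0 hy0 z hxz hzy
    rw [hspancol x hx] at hx0
    rw [hspancol y hy] at hy0
    obtain ⟨w, hw, hw0, h⟩ := hsat hd x hx y hy hx0 hy0 z hxz hzy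
    exact ⟨w, (hspancol w hw).trans hw0, h⟩

/-- A partial order ranked by the integers, with an automorphism `g` that moves every element
strictly down, is a disjoint union of `d` bi-infinite chains permuted by `g`, where `d` is the
size of a maximum antichain `A`. The chains can be numbered so that they meet `A` in their zeroth
elements, and the first chain can be chosen to be saturated between `A` and `g A`. -/
theorem exists_equivariant_chains (hpos : Function.Injective pos)
    (hle : ∀ x y, x ≤ y → pos y ≤ pos x) (hℓ : 0 < ℓ) (hg : ∀ x, g x < x)
    (hgpos : ∀ x, pos (g x) = pos x + ℓ) {d : ℕ} {A : Finset Q}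
    (hA : IsAntichain (· ≤ ·) (A : Set Q)) (hcard : A.card = d)
    (hmax : ∀ B : Finset Q, IsAntichain (· ≤ ·) (B : Set Q) → B.card ≤ d) :
    ∃ (c : Fin d → ℤ → Q) (σ : Equiv.Perm (Fin d)) (t : Fin d → ℤ),
      (∀ i, StrictAnti (c i)) ∧ (∀ i j n m, c i n = c j m → i = j ∧ n = m) ∧
      (∀ x, ∃ i n, c i n = x) ∧ (∀ x, x ∈ A ↔ ∃ i, c i 0 = x) ∧
      (∀ i n, g (c i n) = c (σ i) (n + t i)) ∧
      ∀ hd : 0 < d, ∀ n, c ⟨0, hd⟩ n ∈ antichainSpan g A → c ⟨0, hd⟩ (n + 1) ∈ antichainSpan g A →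
        ∀ z, c ⟨0, hd⟩ (n + 1) < z → ¬ z < c ⟨0, hd⟩ n := by
  obtain ⟨color, τ, α, hcol, hcolg, hαA, hα, hsat⟩ :=
    exists_equivariant_coloring hpos hle hℓ hg hgpos hA hcard hmax
  have hlt : ∀ x y, x < y → pos y < pos x := fun x y h =>
    lt_of_le_of_ne (hle x y h.le) fun h0 => h.ne (hpos h0).symm
  have hcollt : ∀ x y, color x = color y → pos x < pos y → y < x := by
    intro x y h hp
    rcases hcol x y h with h1 | h1
    · exact absurd (hle _ _ h1) hp.not_ge
    · exact lt_of_le_of_ne h1 fun h0 => hp.ne (by rw [h0])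
  have hcolgn : ∀ x (n : ℤ), color ((g ^ n : Q ≃o Q) x) = (τ ^ n) (color x) := by
    intro x n
    induction n using Int.induction_on with
    | zero => simp
    | succ k ih =>
      rw [add_comm (k : ℤ), zpow_add, zpow_one, RelIso.mul_apply, hcolg, ih, zpow_add, zpow_one,
        Equiv.Perm.mul_apply]
    | pred k ih =>
      apply τ.injective
      rw [← hcolg, ← RelIso.mul_apply, ← zpow_one_add, ← Equiv.Perm.mul_apply, ← zpow_one_add,
        show (1 : ℤ) + (-k - 1) = -k by ring]
      exact ih
  have hpoint : ∀ i (n : ℤ), ∃ a ∈ A, color ((g ^ n : Q ≃o Q) a) = i := fun i n =>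
    ⟨α ((τ ^ (-n)) i), hαA _, by
      rw [hcolgn, hα, ← Equiv.Perm.mul_apply, ← zpow_add, add_neg_cancel, zpow_zero,
        Equiv.Perm.one_apply]⟩
  -- Every translate of `A` contains an element of colour `i`, so the ranks in this colour are
  -- unbounded both ways. They are numbered from the member of `A`.
  have hf : ∀ i, ∃ f : ℤ → ℤ, StrictMono f ∧ Set.range f = pos '' {x | color x = i} ∧
      f 0 = pos (α i) := by
    intro i
    refine exists_strictMono_int_range_eq (fun m => ?_) (fun m => ?_) ⟨α i, hα i, rfl⟩
    · obtain ⟨b, hb⟩ := (A.finite_toSet.image pos).bddBelow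
      obtain ⟨a, ha, h⟩ := hpoint i (max 0 (m - b))
      refine ⟨_, ⟨_, h, rfl⟩, ?_⟩
      have h1 := hb ⟨a, ha, rfl⟩
      rw [pos_zpow hgpos]
      have h3 := le_max_left 0 (m - b)
      have h4 := le_max_right 0 (m - b)
      nlinarith
    · obtain ⟨b, hb⟩ := (A.finite_toSet.image pos).bddAbove
      obtain ⟨a, ha, h⟩ := hpoint i (-max 0 (b - m))
      refine ⟨_, ⟨_, h, rfl⟩, ?_⟩
      have h1 := hb ⟨a, ha, rfl⟩
      rw [pos_zpow hgpos]
      have h3 := le_max_left 0 (b - m)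
      have h4 := le_max_right 0 (b - m)
      nlinarith
  choose f hfmono hfrange hf0 using hf
  have hc : ∀ i n, ∃ x, color x = i ∧ pos x = f i n := fun i n => by
    have : f i n ∈ pos '' {x | color x = i} := by rw [← hfrange]; exact ⟨n, rfl⟩
    exact this
  choose c hccol hcpos using hc
  have hcanti : ∀ i, StrictAnti (c i) := fun i m n hmn =>
    hcollt _ _ ((hccol i m).trans (hccol i n).symm) (by rw [hcpos, hcpos]; exact hfmono i hmn)
  have hcsurj : ∀ x, ∃ n, c (color x) n = x := by
    intro x
    have : pos x ∈ Set.range (f (color x)) := by rw [hfrange]; exact ⟨x, rfl, rfl⟩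
    obtain ⟨n, hn⟩ := this
    exact ⟨n, hpos (by rw [hcpos, hn])⟩
  have hc0 : ∀ i, c i 0 = α i := fun i => hpos (by rw [hcpos, hf0])
  -- On indices, `g` induces a strictly increasing bijection of `ℤ`, which is a translation, by `u i
  -- 0`.
  have hgc : ∀ i n, ∃ m, c (τ i) m = g (c i n) := by
    intro i n
    have := hcsurj (g (c i n))
    rwa [hcolg, hccol] at this
  choose u hu using hgc
  have humono : ∀ i, StrictMono (u i) := by
    intro i m n hmn
    rw [← (hcanti (τ i)).lt_iff_gt, hu, hu, OrderIso.lt_iff_lt]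
    exact hcanti i hmn
  have husurj : ∀ i, Function.Surjective (u i) := by
    intro i m
    obtain ⟨x, hx⟩ := g.surjective (c (τ i) m)
    have hxi : color x = i := by
      apply τ.injective
      rw [← hcolg, hx, hccol]
    obtain ⟨n, hn⟩ := hcsurj x
    rw [hxi] at hn
    refine ⟨n, (hcanti (τ i)).injective ?_⟩
    rw [hu, hn, hx]
  refine ⟨c, τ, fun i => u i 0, hcanti, fun i j n m h => ?_, fun x => ⟨_, hcsurj x⟩, fun x => ?_,
    fun i n => ?_, ?_⟩
  · obtain rfl : i = j := by rw [← hccol i n, h, hccol]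
    exact ⟨rfl, (hcanti i).injective h⟩
  · constructor
    · intro hx
      refine ⟨color x, (hc0 _).trans ?_⟩
      rcases hcol _ _ (hα (color x)) with h | h
      exacts [hA.eq (hαA _) hx h, (hA.eq hx (hαA _) h).symm]
    · rintro ⟨i, rfl⟩
      rw [hc0]
      exact hαA i
  · rw [← hu, (humono i).int_eq_add_of_surjective (husurj i) n]
  · intro hd n hn hn' z hz hz'
    obtain ⟨w, hw, h1, h2⟩ := hsat hd _ hn' _ hn (hccol _ _) (hccol _ _) z hz hz'
    obtain ⟨k, hk⟩ := hcsurj w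
    rw [hw] at hk
    rw [← hk, (hcanti _).lt_iff_gt] at h1 h2
    omega

end EquivariantChains

/-! ### The standard cubing -/

section StdCubing

variable {d : ℕ}

/-- The cube of the standard cubing with minimal vertex `v` and directions `ι`. -/
noncomputable def stdFace {m : ℕ} (v : Fin d → ℤ) (ι : Fin m ↪ Fin d) :
    hypercube m ↪g (stdCubing d).graph := by
  classical
  let F : (Fin m → Bool) → Fin d → ℤ := fun y l => v l + if ∃ k, ι k = l ∧ y k = true then 1 else 0
  have hF : ∀ y k, F y (ι k) = v (ι k) + if y k then 1 else 0 := by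
    intro y k
    simp [F]
  have hF' : ∀ y l, (∀ k, ι k ≠ l) → F y l = v l := by
    intro y l hl
    simp [F, hl]
  refine ⟨⟨F, ?_⟩, ?_⟩
  · intro y y' h
    funext k
    have := congrFun h (ι k)
    rw [hF, hF] at this
    cases hy : y k <;> cases hy' : y' k <;> simp_all
  · intro y y'
    change (∃ l, (F y' l = F y l + 1 ∨ F y l = F y' l + 1) ∧ ∀ j, j ≠ l → F y j = F y' j) ↔
      ∃! k, y k ≠ y' k
    constructor
    · rintro ⟨l, hl, hu⟩
      have hk : ∃ k, ι k = l := by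
        by_contra hne
        push Not at hne
        rw [hF' y l hne, hF' y' l hne] at hl
        omega
      obtain ⟨k, rfl⟩ := hk
      rw [hF, hF] at hl
      refine ⟨k, fun h => by simp [h] at hl, fun k' hk' => ?_⟩
      by_contra hne
      have h2 := hu (ι k') fun h => hne (ι.injective h)
      rw [hF, hF] at h2
      cases hy : y k' <;> cases hy' : y' k' <;> simp_all
    · rintro ⟨k, hk, hu⟩
      refine ⟨ι k, ?_, fun l hl => ?_⟩
      · rw [hF, hF]
        cases hy : y k <;> cases hy' : y' k <;> simp_all
      · by_cases hne : ∃ k', ι k' = l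
        · obtain ⟨k', rfl⟩ := hne
          have : y k' = y' k' := by
            by_contra h
            exact hl (congrArg ι (hu k' h))
          rw [hF, hF, this]
        · push Not at hne
          rw [hF' y l hne, hF' y' l hne]

theorem stdFace_apply {m : ℕ} (v : Fin d → ℤ) (ι : Fin m ↪ Fin d) (y : Fin m → Bool)
    (k : Fin m) : stdFace v ι y (ι k) = v (ι k) + if y k then 1 else 0 := by
  classical
  change v (ι k) + (if ∃ k', ι k' = ι k ∧ y k' = true then 1 else 0) = _
  simp

theorem stdFace_apply_of_notMem {m : ℕ} (v : Fin d → ℤ) (ι : Fin m ↪ Fin d) (y : Fin m → Bool)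
    (l : Fin d) (hl : ∀ k, ι k ≠ l) : stdFace v ι y l = v l := by
  classical
  change v l + (if ∃ k', ι k' = l ∧ y k' = true then 1 else 0) = _
  simp [hl]

theorem SimpleGraph.range_mem_cubeCompletion {V : Type*} {G : SimpleGraph V} {m : ℕ}
    (f : hypercube m ↪g G) : Set.range f ∈ G.cubeCompletion.cubes :=
  ⟨m, ⟨f.isoInduceRange⟩⟩

theorem stdCubing_square_mem (x : Fin d → ℤ) {i j : Fin d} (hij : i ≠ j) :
    {x, Function.update x i (x i + 1),
      Function.update (Function.update x i (x i + 1)) j (x j + 1),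
      Function.update x j (x j + 1)} ∈ (stdCubing d).cubes := by
  let ι : Fin 2 ↪ Fin d := ⟨![i, j], by
    intro p q
    fin_cases p <;> fin_cases q <;> simp [hij, hij.symm]⟩
  suffices h : {x, Function.update x i (x i + 1),
      Function.update (Function.update x i (x i + 1)) j (x j + 1),
      Function.update x j (x j + 1)} = Set.range (stdFace x ι) by
    rw [h]
    exact SimpleGraph.range_mem_cubeCompletion _
  have hf : ∀ y : Fin 2 → Bool, stdFace x ι y =
      Function.update (Function.update x i (x i + if y 0 then 1 else 0)) j
        (x j + if y 1 then 1 else 0) := by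
    intro y
    funext l
    by_cases hj : l = j
    · subst hj
      rw [Function.update_self]
      exact stdFace_apply x ι y 1
    · rw [Function.update_of_ne hj]
      by_cases hi : l = i
      · subst hi
        rw [Function.update_self]
        exact stdFace_apply x ι y 0
      · rw [Function.update_of_ne hi]
        refine stdFace_apply_of_notMem x ι y l ?_
        intro k
        fin_cases k
        · exact Ne.symm hi
        · exact Ne.symm hj
  have hi' : Function.update (Function.update x i (x i + 1)) j (x j) =
      Function.update x i (x i + 1) := by
    rw [Function.update_eq_self_iff, Function.update_of_ne hij.symm]
  ext z
  simp only [Set.mem_insert_iff, Set.mem_singleton_iff, Set.mem_range, hf]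
  constructor
  · rintro (rfl | rfl | rfl | rfl)
    · exact ⟨![false, false], by simp⟩
    · exact ⟨![true, false], by simp [hi']⟩
    · exact ⟨![true, true], by simp⟩
    · exact ⟨![false, true], by simp⟩
  · rintro ⟨y, rfl⟩
    rcases h0 : y 0 <;> rcases h1 : y 1 <;> simp [hi']

/-- Opposite sides of a square in the standard cubing are parallel. -/
theorem stdCubing_parallel {a b c e : Fin d → ℤ} (hab : (stdCubing d).graph.Adj a b)
    (hbc : (stdCubing d).graph.Adj b c) (hce : (stdCubing d).graph.Adj c e)
    (hea : (stdCubing d).graph.Adj e a) (hac : a ≠ c) (hbe : b ≠ e) (l : Fin d) :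
    c l = b l + e l - a l := by
  obtain ⟨i, hi, hi'⟩ := hab
  obtain ⟨k, hk, hk'⟩ := hbc
  obtain ⟨m, hm, hm'⟩ := hce
  obtain ⟨j, hj, hj'⟩ := hea
  by_cases hij : i = j
  · subst hij
    exfalso
    have hne : b i ≠ e i := fun h => hbe (funext fun l => by
      by_cases hl : l = i
      · rw [hl, h]
      · rw [← hi' l hl, hj' l hl])
    have hki : k = i := by
      by_contra hki
      have h1 := hk' i (Ne.symm hki)
      by_cases hmi : m = i
      · subst hmi; omega
      · have := hm' i (Ne.symm hmi); omega
    have hmi : m = i := by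
      by_contra hmi
      have := hm' i (Ne.symm hmi)
      subst hki
      omega
    subst hki
    subst hmi
    refine hac (funext fun l => ?_)
    by_cases hl : l = m
    · subst hl; omega
    · rw [hi' l hl, hk' l hl]
  · have hbi : a i = e i := (hj' i hij).symm
    have hbj : a j = b j := hi' j (Ne.symm hij)
    have hki : k ≠ i := by
      rintro rfl
      have h1 := hk' j (Ne.symm hij)
      have hmj : m = j := by
        by_contra hmj
        have := hm' j (Ne.symm hmj)
        omega
      subst hmj
      refine hac (funext fun l => ?_)
      by_cases hl : l = k
      · subst hl
        rw [hm' l hij, hbi]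
      · rw [hi' l hl, hk' l hl]
    have hci := hk' i (Ne.symm hki)
    have hmi : m = i := by
      by_contra hmi
      have := hm' i (Ne.symm hmi)
      omega
    subst hmi
    have hcj := hm' j (Ne.symm hij)
    by_cases hl : l = m
    · subst hl; omega
    · have h1 := hm' l hl
      have h2 := hi' l hl
      omega

/-! #### The combinatorial metric -/

/-- The `ℓ¹`-distance between integer points. -/
def latticeDist (x y : Fin d → ℤ) : ℕ := ∑ i, (x i - y i).natAbs

theorem latticeDist_triangle (x y z : Fin d → ℤ) :
    latticeDist x z ≤ latticeDist x y + latticeDist y z := by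
  rw [latticeDist, latticeDist, latticeDist, ← Finset.sum_add_distrib]
  exact Finset.sum_le_sum fun i _ => by omega

theorem latticeDist_self (x : Fin d → ℤ) : latticeDist x x = 0 := by
  simp [latticeDist]

theorem latticeDist_le_one {x y : Fin d → ℤ} (h : (stdCubing d).graph.Adj x y) :
    latticeDist x y ≤ 1 := by
  obtain ⟨i, hi, hu⟩ := h
  rw [latticeDist, Finset.sum_eq_single i]
  · omega
  · intro j _ hj
    rw [hu j hj]
    simp
  · simp

theorem latticeDist_lt {x x' y : Fin d → ℤ} {i : Fin d} (hu : ∀ j, j ≠ i → x' j = x j)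
    (hi : (x' i - y i).natAbs < (x i - y i).natAbs) : latticeDist x' y < latticeDist x y := by
  refine Finset.sum_lt_sum (fun j _ => ?_) ⟨i, Finset.mem_univ _, hi⟩
  by_cases hj : j = i
  · subst hj; exact hi.le
  · rw [hu j hj]

/-- An edge changes the lattice distance by at most one, which bounds walks from below, and greedy
descent produces a walk that attains the bound. It serves both the standard cubing and the Sageev
complex. -/
theorem SimpleGraph.edist_eq_latticeDist {W : Type*} {G : SimpleGraph W} {φ : W → Fin d → ℤ}
    (h1 : ∀ u v, G.Adj u v → latticeDist (φ u) (φ v) ≤ 1)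
    (h2 : ∀ u v, u ≠ v → ∃ u', G.Adj u u' ∧ latticeDist (φ u') (φ v) < latticeDist (φ u) (φ v))
    (u v : W) : G.edist u v = latticeDist (φ u) (φ v) := by
  have hlow : ∀ {u v : W} (p : G.Walk u v), latticeDist (φ u) (φ v) ≤ p.length := by
    intro u v p
    induction p with
    | nil => rw [latticeDist_self]; simp
    | cons h p ih =>
      rw [SimpleGraph.Walk.length_cons]
      have := h1 _ _ h
      exact (latticeDist_triangle _ _ _).trans (by rw [add_comm]; exact add_le_add ih this)
  have hup : ∀ n, ∀ u, latticeDist (φ u) (φ v) = n → ∃ p : G.Walk u v, p.length ≤ n := by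
    intro n
    induction n using Nat.strong_induction_on with
    | _ n ih =>
    intro u hn
    by_cases huv : u = v
    · subst huv
      exact ⟨.nil, by simp⟩
    · obtain ⟨u', hadj, hlt⟩ := h2 u v huv
      obtain ⟨p, hp⟩ := ih _ (hn ▸ hlt) u' rfl
      exact ⟨.cons hadj p, by rw [SimpleGraph.Walk.length_cons]; omega⟩
  obtain ⟨p, hp⟩ := hup _ u rfl
  refine le_antisymm ((SimpleGraph.edist_le p).trans (by exact_mod_cast hp)) ?_
  obtain ⟨q, hq⟩ := (p.reachable).exists_walk_length_eq_edist
  rw [← hq]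
  exact_mod_cast hlow q

theorem stdCubing_exists_closer (x y : Fin d → ℤ) (i : Fin d) (hi : x i ≠ y i) :
    ∃ z, (stdCubing d).graph.Adj x z ∧ latticeDist z y < latticeDist x y ∧
      (∀ j, j ≠ i → z j = x j) ∧ (x i < y i ∧ z i = x i + 1 ∨ y i < x i ∧ z i = x i - 1) := by
  rcases hi.lt_or_gt with h | h
  · refine ⟨Function.update x i (x i + 1), ⟨i, by simp, fun j hj => by
      rw [Function.update_of_ne hj]⟩, latticeDist_lt (i := i) (fun j hj => by
      rw [Function.update_of_ne hj]) (by rw [Function.update_self]; omega), fun j hj => by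
      rw [Function.update_of_ne hj], Or.inl ⟨h, by simp⟩⟩
  · refine ⟨Function.update x i (x i - 1), ⟨i, by simp, fun j hj => by
      rw [Function.update_of_ne hj]⟩, latticeDist_lt (i := i) (fun j hj => by
      rw [Function.update_of_ne hj]) (by rw [Function.update_self]; omega), fun j hj => by
      rw [Function.update_of_ne hj], Or.inr ⟨h, by simp⟩⟩

theorem stdCubing_edist (x y : Fin d → ℤ) :
    (stdCubing d).graph.edist x y = latticeDist x y := by
  refine SimpleGraph.edist_eq_latticeDist (φ := id) (fun u v h => latticeDist_le_one h) ?_ x y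
  intro u v huv
  obtain ⟨i, hi⟩ := Function.ne_iff.1 huv
  obtain ⟨z, h1, h2, -⟩ := stdCubing_exists_closer u v i hi
  exact ⟨z, h1, h2⟩

/-! #### Half-spaces -/

/-- The edge `e` crosses from the level `n` to the level `n + 1` of the coordinate `i`. -/
def CrossesLevel (i : Fin d) (n : ℤ) (e : Sym2 (Fin d → ℤ)) : Prop :=
  ∃ u v, e = s(u, v) ∧ u i = n ∧ v i = n + 1 ∧ ∀ j, j ≠ i → u j = v j

/-- Opposite sides of a genuine square are translates of each other in a direction other than `i`. A
degenerate square is one edge traversed to and fro. -/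
theorem CrossesLevel.of_opposite {i : Fin d} {n : ℤ} {e f : Sym2 (Fin d → ℤ)}
    (h : (stdCubing d).OppositeEdges e f) (he : CrossesLevel i n e) : CrossesLevel i n f := by
  obtain ⟨a, b, c, p, hab, hbc, hcp, hpa, hm, rfl, rfl⟩ := h
  rcases CubeComplex.square_or_degenerate hab hbc hcp hpa hm with h | ⟨rfl, rfl⟩
  swap
  · rwa [Sym2.eq_swap]
  have key : ∀ {a b c p : Fin d → ℤ}, (stdCubing d).Square a b c p →
      (a i = n ∧ b i = n + 1 ∧ ∀ j, j ≠ i → a j = b j) →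
      (p i = n ∧ c i = n + 1 ∧ ∀ j, j ≠ i → p j = c j) := by
    rintro a b c p h ⟨h1, h2, h3⟩
    have hpar := stdCubing_parallel h.ab h.bc h.cd h.da h.ac h.bd
    obtain ⟨j, hj, hj'⟩ := h.da
    have hji : i ≠ j := by
      rintro rfl
      rcases hj with hj | hj
      · refine h.ac (funext fun l => ?_)
        have := hpar l
        by_cases hl : l = i
        · subst hl; omega
        · have := h3 l hl
          have := hj' l hl
          omega
      · refine h.bd (funext fun l => ?_)
        by_cases hl : l = i
        · subst hl; omega
        · rw [hj' l hl, h3 l hl]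
    refine ⟨(hj' i hji).trans h1, ?_, fun l hl => ?_⟩
    · have := hpar i
      have := hj' i hji
      omega
    · have := hpar l
      have := h3 l hl
      omega
  obtain ⟨u, v, huv, h1⟩ := he
  rcases Sym2.eq_iff.1 huv with ⟨rfl, rfl⟩ | ⟨rfl, rfl⟩
  · exact ⟨p, c, rfl, key h h1⟩
  · exact ⟨c, p, Sym2.eq_swap, key h.reflect.rotate.rotate.rotate h1⟩

/-- The first edge is pushed across unit squares in directions other than `i`, each time nearer to
the second. -/
theorem stdCubing_eqvGen {i : Fin d} {n : ℤ} {e f : Sym2 (Fin d → ℤ)}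
    (he : CrossesLevel i n e) (hf : CrossesLevel i n f) :
    Relation.EqvGen (stdCubing d).OppositeEdges e f := by
  obtain ⟨u, u', rfl, h1, h2, h3⟩ := he
  obtain ⟨v, v', rfl, h4, h5, h6⟩ := hf
  have hupd : ∀ {u u' : Fin d → ℤ}, u i = n → u' i = n + 1 → (∀ j, j ≠ i → u j = u' j) →
      u' = Function.update u i (u i + 1) := by
    intro u u' h1 h2 h3
    funext j
    by_cases hj : j = i
    · subst hj; rw [Function.update_self, h1, h2]
    · rw [Function.update_of_ne hj, h3 j hj]
  rw [hupd h1 h2 h3, hupd h4 h5 h6]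
  clear! u' v'
  have step : ∀ (x : Fin d → ℤ) (j : Fin d), j ≠ i →
      (stdCubing d).OppositeEdges s(x, Function.update x i (x i + 1))
        s(Function.update x j (x j + 1),
          Function.update (Function.update x j (x j + 1)) i (x i + 1)) := by
    intro x j hj
    refine ⟨x, Function.update x i (x i + 1),
      Function.update (Function.update x i (x i + 1)) j (x j + 1), Function.update x j (x j + 1),
      ⟨i, by simp, fun l hl => by rw [Function.update_of_ne hl]⟩,
      ⟨j, by simp [Function.update_of_ne hj], fun l hl => by rw [Function.update_of_ne hl]⟩,
      ⟨i, ?_, fun l hl => ?_⟩,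
      ⟨j, by simp, fun l hl => by rw [Function.update_of_ne hl]⟩,
      stdCubing_square_mem x hj.symm, rfl, ?_⟩
    · rw [Function.update_of_ne hj.symm, Function.update_of_ne hj.symm, Function.update_self]
      exact Or.inr rfl
    · by_cases hlj : l = j
      · subst hlj; simp
      · rw [Function.update_of_ne hlj, Function.update_of_ne hlj, Function.update_of_ne hl]
    · rw [Function.update_comm hj]
  induction hn : latticeDist u v using Nat.strong_induction_on generalizing u with
  | _ m ih =>
  by_cases huv : u = v
  · subst huv
    exact .refl _
  obtain ⟨j, hj⟩ := Function.ne_iff.1 huv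
  have hji : j ≠ i := by
    rintro rfl
    exact hj (h1.trans h4.symm)
  obtain ⟨z, hz1, hz2, hz3, hz4⟩ := stdCubing_exists_closer u v j hj
  have hzi : z i = n := (hz3 i hji.symm).trans h1
  refine .trans _ _ _ ?_ (ih _ (hn ▸ hz2) z hzi rfl)
  rcases hz4 with ⟨-, hz4⟩ | ⟨-, hz4⟩
  · have hzu : z = Function.update u j (u j + 1) := by
      funext l
      by_cases hl : l = j
      · subst hl; simp [hz4]
      · rw [Function.update_of_ne hl, hz3 l hl]
    have := step u j hji
    rw [← hzu] at this
    rw [hzi, ← h1]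
    exact .rel _ _ this
  · have hzu : u = Function.update z j (z j + 1) := by
      funext l
      by_cases hl : l = j
      · subst hl; simp [hz4]
      · rw [Function.update_of_ne hl, hz3 l hl]
    have := step z j hji
    rw [← hzu] at this
    rw [h1, ← hzi]
    exact .symm _ _ (.rel _ _ this)

theorem stdCubing_hyperplane {i : Fin d} {n : ℤ} {e : Sym2 (Fin d → ℤ)}
    (he : CrossesLevel i n e) : (stdCubing d).hyperplane e = {f | CrossesLevel i n f} := by
  ext f
  refine ⟨fun h => ?_, fun h => stdCubing_eqvGen he h⟩
  have key : ∀ {e f}, Relation.EqvGen (stdCubing d).OppositeEdges e f →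
      (CrossesLevel i n e ↔ CrossesLevel i n f) := by
    intro e f h
    induction h with
    | rel e f h =>
      refine ⟨fun he => he.of_opposite h, fun hf => hf.of_opposite ?_⟩
      obtain ⟨a, b, c, p, hab, hbc, hcp, hpa, hm, rfl, rfl⟩ := h
      refine ⟨p, c, b, a, hcp.symm, hbc.symm, hab.symm, hpa.symm, ?_, rfl, rfl⟩
      convert hm using 1
      ext x
      simp only [Set.mem_insert_iff, Set.mem_singleton_iff]
      tauto
    | refl => rfl
    | symm _ _ _ ih => exact ih.symm
    | trans _ _ _ _ _ ih1 ih2 => exact ih1.trans ih2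
  exact (key h).1 he

/-- A path that avoids the hyperplane never changes side. Conversely, a path that approaches `w`
coordinate by coordinate is monotone in each of them, so it stays on the common side. -/
theorem stdCubing_reachable_iff {i : Fin d} {n : ℤ} {e : Sym2 (Fin d → ℤ)}
    (he : CrossesLevel i n e) (v w : Fin d → ℤ) :
    ((stdCubing d).graph.deleteEdges ((stdCubing d).hyperplane e)).Reachable v w ↔
      (n < v i ↔ n < w i) := by
  rw [stdCubing_hyperplane he]
  constructor
  · rintro ⟨p⟩
    induction p with
    | nil => rfl
    | @cons a b c h p ih =>
      refine Iff.trans ?_ ih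
      rw [SimpleGraph.deleteEdges_adj] at h
      obtain ⟨⟨j, hj, hj'⟩, h2⟩ := h
      by_cases hji : i = j
      · subst hji
        by_contra hcon
        refine h2 ?_
        rcases hj with hj | hj
        · exact ⟨a, b, rfl, by omega, by omega, hj'⟩
        · exact ⟨b, a, Sym2.eq_swap, by omega, by omega, fun l hl => (hj' l hl).symm⟩
      · rw [hj' i hji]
  · intro hvw
    induction hn : latticeDist v w using Nat.strong_induction_on generalizing v with
    | _ m ih =>
    by_cases h : v = w
    · subst h
      exact SimpleGraph.Reachable.refl _
    obtain ⟨j, hj⟩ := Function.ne_iff.1 h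
    obtain ⟨z, hz1, hz2, hz3, hz4⟩ := stdCubing_exists_closer v w j hj
    have hside : n < v i ↔ n < z i := by
      by_cases hji : i = j
      · subst hji; omega
      · rw [hz3 i hji]
    refine SimpleGraph.Reachable.trans (SimpleGraph.Adj.reachable ?_)
      (ih _ (hn ▸ hz2) z (hside.symm.trans hvw) rfl)
    rw [SimpleGraph.deleteEdges_adj]
    refine ⟨hz1, ?_⟩
    rintro ⟨a, b, hab, ha, hb, -⟩
    rcases Sym2.eq_iff.1 hab with ⟨rfl, rfl⟩ | ⟨rfl, rfl⟩ <;> omega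

theorem mem_stdCubing_halfspaces {K : Set (Fin d → ℤ)} : K ∈ (stdCubing d).halfspaces ↔
    ∃ (i : Fin d) (n : ℤ), K = {x | n < x i} ∨ K = {x | x i ≤ n} := by
  constructor
  · rintro ⟨e, he, v, rfl⟩
    have hlev : ∃ i n, CrossesLevel i n e := by
      induction e with
      | _ a b =>
      obtain ⟨i, hi | hi, h⟩ := he
      · exact ⟨i, a i, a, b, rfl, rfl, hi, h⟩
      · exact ⟨i, b i, b, a, Sym2.eq_swap, rfl, hi, fun j hj => (h j hj).symm⟩
    obtain ⟨i, n, hlev⟩ := hlev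
    refine ⟨i, n, ?_⟩
    simp only [stdCubing_reachable_iff hlev]
    by_cases hv : n < v i
    · left; ext x; simp [hv]
    · right; ext x; simp [hv]
  · rintro ⟨i, n, h⟩
    let u : Fin d → ℤ := fun _ => n
    let w : Fin d → ℤ := Function.update u i (n + 1)
    have hlev : CrossesLevel i n s(u, w) :=
      ⟨u, w, rfl, rfl, by simp [w], fun j hj => by simp [w, Function.update_of_ne hj]⟩
    have hadj : s(u, w) ∈ (stdCubing d).graph.edgeSet :=
      ⟨i, Or.inl (by simp [w, u]), fun j hj => by simp [w, Function.update_of_ne hj]⟩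
    rcases h with rfl | rfl
    · refine ⟨_, hadj, w, ?_⟩
      ext x
      simp [stdCubing_reachable_iff hlev, w]
    · refine ⟨_, hadj, u, ?_⟩
      ext x
      simp [stdCubing_reachable_iff hlev, u]

/-! #### Embedded cubes -/

theorem stdCubing_parallel_of_embedding {n : ℕ} (f : hypercube n ↪g (stdCubing d).graph)
    (x : Fin n → Bool) {k l : Fin n} (hkl : k ≠ l) (j : Fin d) :
    f (Function.update (Function.update x l (!x l)) k (!x k)) j -
      f (Function.update x l (!x l)) j = f (Function.update x k (!x k)) j - f x j := by
  have adj : ∀ x y, (hypercube n).Adj x y → (stdCubing d).graph.Adj (f x) (f y) := fun x y h =>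
    f.map_rel_iff.2 h
  have hcomm : Function.update (Function.update x l (!x l)) k (!x k) =
      Function.update (Function.update x k (!x k)) l (!x l) := Function.update_comm hkl.symm _ _ _
  have := stdCubing_parallel (adj x (Function.update x l (!x l)) (hypercube_adj_iff.2 ⟨l, rfl⟩))
    (adj _ (Function.update (Function.update x l (!x l)) k (!x k))
      (hypercube_adj_iff.2 ⟨k, by rw [Function.update_of_ne hkl]⟩))
    (adj (Function.update x k (!x k)) _
      (hypercube_adj_iff.2 ⟨l, by rw [hcomm, Function.update_of_ne hkl.symm]⟩)).symm
    (adj _ _ (hypercube_adj_iff.2 ⟨k, rfl⟩)).symm ?_ ?_ j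
  · linarith
  · intro h
    have := congrFun (f.injective h) k
    simp at this
  · intro h
    have := congrFun (f.injective h) k
    rw [Function.update_of_ne hkl] at this
    simp at this

/-- An embedded hypercube of the standard cubing is spanned by pairwise orthogonal unit
vectors. -/
theorem exists_directions {n : ℕ} (f : hypercube n ↪g (stdCubing d).graph) :
    ∃ (π : Fin n ↪ Fin d) (ε : Fin n → ℤ) (u : Fin d → ℤ), (∀ k, ε k = 1 ∨ ε k = -1) ∧
      ∀ x k, f x (π k) = u (π k) + if x k then ε k else 0 := by
  classical
  let ind : Finset (Fin n) → Fin n → Bool := fun S k => decide (k ∈ S)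
  have hflip : ∀ S : Finset (Fin n), ∀ k, k ∉ S →
      Function.update (ind S) k (!ind S k) = ind (insert k S) := by
    intro S k hk
    funext l
    by_cases hl : l = k
    · subst hl; simp [ind, hk]
    · rw [Function.update_of_ne hl]; simp [ind, hl]
  -- The displacement in a cube direction is the same along all parallel edges, because squares of
  -- the cubing are parallelograms.
  have hpar : ∀ S : Finset (Fin n), ∀ k, k ∉ S → ∀ j,
      f (ind (insert k S)) j - f (ind S) j = f (ind {k}) j - f (ind ∅) j := by
    intro S
    induction S using Finset.induction_on with
    | empty => intro k _ j; rfl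
    | insert l S hl ih =>
      intro k hk j
      rw [Finset.mem_insert, not_or] at hk
      have := stdCubing_parallel_of_embedding f (ind S) hk.1 j
      rw [hflip S l hl, hflip S k hk.2] at this
      have h2 : Function.update (ind (insert l S)) k (!ind S k) = ind (insert k (insert l S)) := by
        rw [← hflip (insert l S) k (by simp [hk.1, hk.2])]
        simp [ind, hk.1]
      rw [h2] at this
      rw [this, ih k hk.2]
  have hdir : ∀ k, ∃ (i : Fin d) (ε : ℤ), (ε = 1 ∨ ε = -1) ∧ f (ind {k}) i - f (ind ∅) i = ε ∧
      ∀ j, j ≠ i → f (ind {k}) j - f (ind ∅) j = 0 := by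
    intro k
    have : (stdCubing d).graph.Adj (f (ind ∅)) (f (ind {k})) :=
      f.map_rel_iff.2 (hypercube_adj_iff.2 ⟨k, (hflip ∅ k (by simp)).symm⟩)
    obtain ⟨i, hi, h⟩ := this
    refine ⟨i, f (ind {k}) i - f (ind ∅) i, by omega, rfl, fun j hj => ?_⟩
    rw [h j hj, sub_self]
  choose π ε hε hπ hπ' using hdir
  -- Two cube directions along one axis would have displacements that are equal, identifying two
  -- neighbours of the base vertex, or opposite, identifying the far corner of a square with the
  -- base vertex.
  have hinj : Function.Injective π := by
    intro k l hkl
    by_contra hne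
    have h1 := hpar {l} k (by simpa using hne)
    have h2 := hπ k
    have h3 := hπ l
    rw [← hkl] at h3
    by_cases hεε : ε k = ε l
    · refine hne ?_
      have : f (ind {k}) = f (ind {l}) := by
        funext j
        by_cases hj : j = π k
        · subst hj; omega
        · have := hπ' k j hj
          have := hπ' l j (hkl ▸ hj)
          omega
      have := congrFun (f.injective this) k
      simp [ind, hne] at this
    · have : f (ind (insert k {l})) = f (ind ∅) := by
        funext j
        have h4 := h1 j
        by_cases hj : j = π k
        · subst hj
          have := hε k
          have := hε l
          omega
        · have := hπ' k j hj
          have := hπ' l j (hkl ▸ hj)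
          omega
      have := congrFun (f.injective this) k
      simp [ind] at this
  refine ⟨⟨π, hinj⟩, ε, f (ind ∅), hε, fun x k => ?_⟩
  have hx : x = ind (Finset.univ.filter fun k => x k = true) := by
    funext l; simp [ind]
  have key : ∀ S : Finset (Fin n), f (ind S) (π k) =
      f (ind ∅) (π k) + if k ∈ S then ε k else 0 := by
    intro S
    induction S using Finset.induction_on with
    | empty => simp
    | insert l S hl ih =>
      have h1 := hpar S l hl (π k)
      by_cases hkl : k = l
      · subst hkl
        rw [if_neg hl] at ih
        rw [if_pos (Finset.mem_insert_self _ _)]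
        have := hπ k
        omega
      · have h2 := hπ' l (π k) fun h => hkl (hinj h)
        have h3 : k ∈ insert l S ↔ k ∈ S := by simp [hkl]
        simp only [h3]
        omega
  have := key (Finset.univ.filter fun k => x k = true)
  rw [← hx] at this
  simpa using this

theorem le_of_hypercube_embedding {n : ℕ} (f : hypercube n ↪g (stdCubing d).graph) : n ≤ d := by
  obtain ⟨π, -⟩ := exists_directions f
  simpa using Fintype.card_le_of_embedding π

/-- The full-dimensional cubes of the standard cubing are the integer unit cubes. -/
theorem exists_range_eq_of_hypercube_embedding (f : hypercube d ↪g (stdCubing d).graph) :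
    ∃ v : Fin d → ℤ, Set.range f = {x | ∀ i, x i = v i ∨ x i = v i + 1} := by
  obtain ⟨π, ε, u, hε, h⟩ := exists_directions f
  have hbij : Function.Bijective π := Finite.injective_iff_bijective.1 π.injective
  let ρ := Equiv.ofBijective π hbij
  have hρ : ∀ i, π (ρ.symm i) = i := fun i => ρ.apply_symm_apply i
  -- The lower corner: the base vertex moved down by one in the directions of negative sign.
  refine ⟨fun i => u i + min 0 (ε (ρ.symm i)), ?_⟩
  ext x
  constructor
  · rintro ⟨y, rfl⟩ i
    have h1 := h y (ρ.symm i)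
    rw [hρ] at h1
    change f y i = u i + min 0 (ε (ρ.symm i)) ∨ f y i = u i + min 0 (ε (ρ.symm i)) + 1
    have h2 := hε (ρ.symm i)
    split_ifs at h1 <;> omega
  · intro hx
    refine ⟨fun k => decide (x (π k) ≠ u (π k)), funext fun i => ?_⟩
    have h1 := h (fun k => decide (x (π k) ≠ u (π k))) (ρ.symm i)
    rw [hρ] at h1
    rw [h1]
    have h2 : x i = u i + min 0 (ε (ρ.symm i)) ∨ x i = u i + min 0 (ε (ρ.symm i)) + 1 := hx i
    have h4 := hε (ρ.symm i)
    simp only [decide_eq_true_eq]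
    split_ifs with h3 <;> omega

end StdCubing

/-! ### Coordinates on Sageev complexes -/

/-- A decomposition of `P` into the bi-infinite descending chains `c i`. -/
structure IsChainSystem {V : Type*} (P : Set (Set V)) {d : ℕ} (c : Fin d → ℤ → Set V) :
    Prop where
  mem : ∀ i n, c i n ∈ P
  surj : ∀ H ∈ P, ∃ i n, c i n = H
  inj : ∀ i j n m, c i n = c j m → i = j ∧ n = m
  anti : ∀ i n m, n < m → c i m ⊂ c i n

/-- The coordinates `φ` on the vertices of the Sageev complex of `𝓗 = P ∪ {H | Hᶜ ∈ P}` given by a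
chain decomposition `c` of `P`: the `i`-th coordinate of `σ` is the number of the first member of
the `i`-th chain that does not belong to `σ`. -/
structure IsSageevChart {V : Type*} (P 𝓗 : Set (Set V)) (pos : Set V → ℤ) {d : ℕ}
    (c : Fin d → ℤ → Set V) (φ : SageevVertex 𝓗 → Fin d → ℤ) : Prop
    extends IsRankedSystem P pos, IsChainSystem P c where
  mem_iff : ∀ H, H ∈ 𝓗 ↔ H ∈ P ∨ Hᶜ ∈ P
  coord : ∀ σ i n, c i n ∈ σ ↔ n < φ σ i

section

variable {V : Type*} {P 𝓗 : Set (Set V)} {pos : Set V → ℤ} {d : ℕ} {c : Fin d → ℤ → Set V}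

theorem SageevVertex.compl_mem_iff (σ : SageevVertex 𝓗) {H : Set V} (hH : H ∈ 𝓗) :
    Hᶜ ∈ σ ↔ H ∉ σ := by
  rcases σ.choice H hH with ⟨h1, h2⟩ | ⟨h1, h2⟩
  · exact ⟨fun h => absurd h h2, fun h => absurd h1 h⟩
  · exact ⟨fun _ => h2, fun _ => h1⟩

theorem SageevVertex.mem_of_subset (σ : SageevVertex 𝓗) {H K : Set V} (hK : K ∈ 𝓗) (h : H ∈ σ)
    (hHK : H ⊆ K) : K ∈ σ := by
  by_contra hcon
  rw [← σ.compl_mem_iff hK] at hcon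
  exact σ.meet _ h _ hcon (by rwa [compl_compl])

theorem IsChainSystem.subset_iff (hc : IsChainSystem P c) (i : Fin d) {n m : ℤ} :
    c i m ⊆ c i n ↔ n ≤ m := by
  constructor
  · intro h
    by_contra hlt
    exact (hc.anti i m n (not_le.1 hlt)).not_subset h
  · intro h
    rcases h.eq_or_lt with rfl | h
    exacts [subset_rfl, (hc.anti i n m h).subset]

/-- Membership in `σ` is inherited downwards in the index. The descending chain condition, applied
to the chain and to the complements of its members, prevents `σ` from containing all of them or
none. -/
theorem exists_isSageevChart (hP : IsRankedSystem P pos) (hc : IsChainSystem P c)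
    (h𝓗 : ∀ H, H ∈ 𝓗 ↔ H ∈ P ∨ Hᶜ ∈ P) : ∃ φ, IsSageevChart P 𝓗 pos c φ := by
  have hmem : ∀ i n, c i n ∈ 𝓗 := fun i n => (h𝓗 _).2 (Or.inl (hc.mem i n))
  suffices h : ∀ (σ : SageevVertex 𝓗) i, ∃ k, ∀ n, c i n ∈ σ ↔ n < k by
    choose φ hφ using h
    exact ⟨φ, ⟨hP, hc, h𝓗, hφ⟩⟩
  intro σ i
  have hdown : ∀ n m, n ≤ m → c i m ∈ σ → c i n ∈ σ := fun n m hnm h =>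
    σ.mem_of_subset (hmem i n) h ((hc.subset_iff i).2 hnm)
  have hne : ∃ n, c i n ∈ σ := by
    by_contra hcon
    push Not at hcon
    refine Set.isWF_iff_no_descending_seq.1 σ.dcc (fun k => (c i (-(k : ℤ)))ᶜ) ?_ ?_
    · intro a b hab
      have h1 := hc.anti i (-(b : ℤ)) (-(a : ℤ)) (by omega)
      exact Set.ssubset_iff_subset_ne.2 ⟨Set.compl_subset_compl.2 h1.subset,
        fun h => h1.ne (compl_injective h).symm⟩
    · exact fun k => (σ.compl_mem_iff (hmem i _)).2 (hcon _)
  have hbd : ∃ N, ∀ n, c i n ∈ σ → n ≤ N := by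
    by_contra hcon
    push Not at hcon
    refine Set.isWF_iff_no_descending_seq.1 σ.dcc (fun k => c i k) ?_ ?_
    · intro a b hab
      exact hc.anti i a b (by exact_mod_cast hab)
    · intro k
      obtain ⟨n, hn, hk⟩ := hcon k
      exact hdown _ _ hk.le hn
  obtain ⟨k, hk, hk'⟩ := Int.exists_greatest_of_bdd hbd hne
  refine ⟨k + 1, fun n => ⟨fun h => ?_, fun h => hdown _ _ (by omega) hk⟩⟩
  have := hk' n h
  omega

namespace IsSageevChart

variable {φ : SageevVertex 𝓗 → Fin d → ℤ}

theorem chain_mem (h : IsSageevChart P 𝓗 pos c φ) (i : Fin d) (n : ℤ) : c i n ∈ 𝓗 :=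
  (h.mem_iff _).2 (Or.inl (h.mem i n))

theorem cases (h : IsSageevChart P 𝓗 pos c φ) {H : Set V} (hH : H ∈ 𝓗) :
    ∃ i n, H = c i n ∨ H = (c i n)ᶜ := by
  rcases (h.mem_iff H).1 hH with h1 | h1
  · obtain ⟨i, n, rfl⟩ := h.surj H h1
    exact ⟨i, n, Or.inl rfl⟩
  · obtain ⟨i, n, h2⟩ := h.surj _ h1
    exact ⟨i, n, Or.inr (by rw [h2, compl_compl])⟩

theorem compl_coord (h : IsSageevChart P 𝓗 pos c φ) (σ : SageevVertex 𝓗) (i : Fin d) (n : ℤ) :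
    (c i n)ᶜ ∈ σ ↔ φ σ i ≤ n := by
  rw [σ.compl_mem_iff (h.chain_mem i n), h.coord, not_lt]

theorem injective (h : IsSageevChart P 𝓗 pos c φ) : Function.Injective φ := by
  intro σ τ hστ
  have key : ∀ H ∈ 𝓗, (H ∈ σ ↔ H ∈ τ) := by
    intro H hH
    obtain ⟨i, n, rfl | rfl⟩ := h.cases hH
    · rw [h.coord, h.coord, hστ]
    · rw [h.compl_coord, h.compl_coord, hστ]
  refine SageevVertex.ext (Set.ext fun H => ⟨fun hH => ?_, fun hH => ?_⟩)
  · exact (key H (σ.subset hH)).1 hH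
  · exact (key H (τ.subset hH)).2 hH

theorem lt_of_subset (h : IsSageevChart P 𝓗 pos c φ) (σ : SageevVertex 𝓗) {i j : Fin d} {n m : ℤ}
    (hs : c i n ⊆ c j m) (hn : n < φ σ i) : m < φ σ j := by
  rw [← h.coord] at hn ⊢
  exact σ.mem_of_subset (h.chain_mem j m) hn hs

theorem ssubset_pos (h : IsSageevChart P 𝓗 pos c φ) {i j : Fin d} {n m : ℤ}
    (hs : c i n ⊆ c j m) (hne : ¬ (i = j ∧ n = m)) : pos (c j m) < pos (c i n) :=
  h.lt_of_ssubset (h.mem i n) (h.mem j m) (hs.ssubset_of_ne fun h0 => hne (h.inj _ _ _ _ h0))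

/-- The points of `ℤ^d` that are coordinates of vertices are those whose coordinates are compatible
with the inclusions among the half-spaces. -/
theorem exists_vertex (h : IsSageevChart P 𝓗 pos c φ) (k : Fin d → ℤ)
    (hk : ∀ i j n m, c i n ⊆ c j m → n < k i → m < k j) : ∃ σ, φ σ = k := by
  let T : Set (Set V) := {H | ∃ i n, H = c i n ∧ n < k i}
  let T' : Set (Set V) := {H | ∃ i n, H = (c i n)ᶜ ∧ k i ≤ n}
  have hdisj : ∀ i j n m, c i n ≠ (c j m)ᶜ := fun i j n m h0 =>
    h.not_subset_compl _ (h.mem i n) _ (h.mem j m) h0.subset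
  have hT : ∀ i n, c i n ∈ T ∪ T' ↔ n < k i := by
    intro i n
    constructor
    · rintro (⟨j, m, h1, h2⟩ | ⟨j, m, h1, h2⟩)
      · obtain ⟨rfl, rfl⟩ := h.inj _ _ _ _ h1
        exact h2
      · exact absurd h1 (hdisj _ _ _ _)
    · exact fun hn => Or.inl ⟨i, n, rfl, hn⟩
  have hT' : ∀ i n, (c i n)ᶜ ∈ T ∪ T' ↔ k i ≤ n := by
    intro i n
    constructor
    · rintro (⟨j, m, h1, h2⟩ | ⟨j, m, h1, h2⟩)
      · exact absurd h1.symm (hdisj _ _ _ _)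
      · obtain ⟨rfl, rfl⟩ := h.inj _ _ _ _ (compl_injective h1)
        exact h2
    · exact fun hn => Or.inr ⟨i, n, rfl, hn⟩
  have hcoord : ∀ σ : SageevVertex 𝓗, σ.carrier = T ∪ T' → φ σ = k := by
    intro σ hσ
    funext i
    refine le_antisymm (not_lt.1 fun h1 => ?_) (not_lt.1 fun h1 => ?_)
    · have h2 : c i (k i) ∈ σ.carrier := (h.coord _ _ _).2 h1
      rw [hσ, hT] at h2
      exact lt_irrefl _ h2
    · rw [← hT, ← hσ] at h1
      exact lt_irrefl _ ((h.coord _ _ _).1 h1)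
  refine ⟨⟨T ∪ T', ?_, ?_, ?_, ?_⟩, hcoord _ rfl⟩
  · rintro H (⟨i, n, rfl, -⟩ | ⟨i, n, rfl, -⟩)
    · exact h.chain_mem i n
    · exact (h.mem_iff _).2 (Or.inr (by rw [compl_compl]; exact h.mem i n))
  · intro H hH
    obtain ⟨i, n, rfl | rfl⟩ := h.cases hH
    · rw [hT, hT']
      rcases lt_or_ge n (k i) with h1 | h1
      exacts [Or.inl ⟨h1, h1.not_ge⟩, Or.inr ⟨h1, h1.not_gt⟩]
    · rw [compl_compl, hT, hT']
      rcases lt_or_ge n (k i) with h1 | h1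
      exacts [Or.inr ⟨h1, h1.not_ge⟩, Or.inl ⟨h1, h1.not_gt⟩]
  · rintro _ (⟨i, n, rfl, hn⟩ | ⟨i, n, rfl, hn⟩) _ (⟨j, m, rfl, hm⟩ | ⟨j, m, rfl, hm⟩) hs
    · exact h.not_subset_compl _ (h.mem i n) _ (h.mem j m) hs
    · rw [compl_compl] at hs
      exact absurd (hk _ _ _ _ hs hn) hm.not_gt
    · rw [Set.compl_subset_compl] at hs
      exact absurd (hk _ _ _ _ hs hm) hn.not_gt
    · rw [compl_compl] at hs
      exact h.not_compl_subset _ (h.mem i n) _ (h.mem j m) hs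
  · rw [Set.isWF_iff_no_descending_seq]
    intro f hf hmem
    -- Chosen positive half-spaces have ranks bounded above, and those whose complements are chosen
    -- have ranks bounded below. A descending sequence keeps the type of its first term, since no
    -- member of `P` contains or is contained in the complement of another, and each step moves the
    -- rank towards the bound by at least one.
    have hbound : ∃ M, (∀ i n, n < k i → pos (c i n) ≤ M) ∧ ∀ i n, k i ≤ n → -M ≤ pos (c i n) := by
      obtain ⟨M, hM⟩ := (Set.finite_range fun i => |pos (c i (k i))|).bddAbove
      refine ⟨M, fun i n hn => ?_, fun i n hn => ?_⟩
      · exact (h.le_of_subset _ (h.mem _ _) _ (h.mem _ _) ((h.subset_iff i).2 hn.le)).trans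
          ((le_abs_self _).trans (hM ⟨i, rfl⟩))
      · exact (neg_le_neg (hM ⟨i, rfl⟩)).trans ((neg_abs_le _).trans
          (h.le_of_subset _ (h.mem _ _) _ (h.mem _ _) ((h.subset_iff i).2 hn)))
    obtain ⟨M, hM1, hM2⟩ := hbound
    have hss : ∀ a, f (a + 1) ⊂ f a := fun a => hf (Nat.lt_succ_self a)
    rcases hmem 0 with ⟨i₀, n₀, h0, -⟩ | ⟨i₀, n₀, h0, -⟩
    · have hall : ∀ a, f a ∈ T := by
        intro a
        rcases hmem a with ha | ⟨j, m, h1, h2⟩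
        · exact ha
        · exfalso
          have := hf.antitone (Nat.zero_le a)
          rw [h1, h0] at this
          exact h.not_compl_subset _ (h.mem _ _) _ (h.mem _ _) this
      have hpos : ∀ a : ℕ, pos (f 0) + a ≤ pos (f a) := by
        intro a
        induction a with
        | zero => simp
        | succ a ih =>
          obtain ⟨i, n, h1, -⟩ := hall a
          obtain ⟨j, m, h2, -⟩ := hall (a + 1)
          have := h.lt_of_ssubset (h2 ▸ h.mem j m) (h1 ▸ h.mem i n) (hss a)
          push_cast
          omega
      obtain ⟨i, n, h1, h2⟩ := hall (M - pos (f 0) + 1).toNat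
      have h3 := hpos (M - pos (f 0) + 1).toNat
      have h4 := hM1 i n h2
      rw [← h1] at h4
      omega
    · have hall : ∀ a, f a ∈ T' := by
        intro a
        rcases hmem a with ⟨j, m, h1, h2⟩ | ha
        · exfalso
          have := hf.antitone (Nat.zero_le a)
          rw [h1, h0] at this
          exact h.not_subset_compl _ (h.mem _ _) _ (h.mem _ _) this
        · exact ha
      have hpos : ∀ a : ℕ, pos (f a)ᶜ ≤ pos (f 0)ᶜ - a := by
        intro a
        induction a with
        | zero => simp
        | succ a ih =>
          obtain ⟨i, n, h1, -⟩ := hall a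
          obtain ⟨j, m, h2, -⟩ := hall (a + 1)
          have hs := hss a
          have := h.lt_of_ssubset (H := (f a)ᶜ) (K := (f (a + 1))ᶜ)
            (by rw [h1, compl_compl]; exact h.mem i n) (by rw [h2, compl_compl]; exact h.mem j m)
            (Set.ssubset_iff_subset_ne.2 ⟨Set.compl_subset_compl.2 hs.subset,
              fun h => hs.ne (compl_injective h).symm⟩)
          push_cast
          omega
      obtain ⟨i, n, h1, h2⟩ := hall (M + pos (f 0)ᶜ + 1).toNat
      have h3 := hpos (M + pos (f 0)ᶜ + 1).toNat
      have h4 := hM2 i n h2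
      rw [h1, compl_compl] at h3
      omega

theorem adj_iff (h : IsSageevChart P 𝓗 pos c φ) (σ τ : SageevVertex 𝓗) :
    (stdCubing d).graph.Adj (φ σ) (φ τ) ↔ (SageevVertex.graph 𝓗).Adj σ τ := by
  have key : ∀ {σ τ : SageevVertex 𝓗} {i : Fin d} {n : ℤ}, σ.carrier \ τ.carrier = {c i n} →
      τ.carrier \ σ.carrier = {(c i n)ᶜ} →
      φ σ i = φ τ i + 1 ∧ ∀ j, j ≠ i → φ σ j = φ τ j := by
    intro σ τ i n h1 h2
    have h3 : ∀ j m, ¬ (j = i ∧ m = n) → (m < φ σ j ↔ m < φ τ j) := by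
      intro j m hne
      rw [← h.coord, ← h.coord]
      constructor
      · intro h4
        by_contra h5
        have : c j m ∈ σ.carrier \ τ.carrier := ⟨h4, h5⟩
        rw [h1] at this
        exact hne (h.inj _ _ _ _ this)
      · intro h4
        by_contra h5
        have : c j m ∈ τ.carrier \ σ.carrier := ⟨h4, h5⟩
        rw [h2] at this
        exact h.not_subset_compl _ (h.mem j m) _ (h.mem i n) (Set.mem_singleton_iff.1 this).subset
    have h4 : c i n ∈ σ.carrier \ τ.carrier := by rw [h1]; rfl
    have h5 := (h.coord σ i n).1 h4.1
    have h6 : ¬ n < φ τ i := fun h0 => h4.2 ((h.coord τ i n).2 h0)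
    refine ⟨?_, fun j hj => ?_⟩
    · have h7 := h3 i (n + 1) (by omega)
      have h8 := h3 i (n - 1) (by omega)
      have h9 := h3 i (φ σ i - 1)
      omega
    · refine le_antisymm (not_lt.1 fun h0 => ?_) (not_lt.1 fun h0 => ?_)
      · exact lt_irrefl _ ((h3 j _ fun h' => hj h'.1).1 h0)
      · exact lt_irrefl _ ((h3 j _ fun h' => hj h'.1).2 h0)
  have key' : ∀ {σ τ : SageevVertex 𝓗} {i : Fin d}, φ σ i = φ τ i + 1 →
      (∀ j, j ≠ i → φ σ j = φ τ j) →
      σ.carrier \ τ.carrier = {c i (φ τ i)} ∧ τ.carrier \ σ.carrier = {(c i (φ τ i))ᶜ} := by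
    intro σ τ i h1 h2
    have h3 : ∀ j m, (m < φ σ j ∧ ¬ m < φ τ j) ↔ (j = i ∧ m = φ τ i) := by
      intro j m
      by_cases hj : j = i
      · subst hj; rw [h1]; simp only [true_and]; omega
      · rw [h2 j hj]; simp [hj]
    have h4 : ∀ j m, ¬ (m < φ τ j ∧ ¬ m < φ σ j) := by
      intro j m
      by_cases hj : j = i
      · subst hj; rw [h1]; omega
      · rw [h2 j hj]; tauto
    have h5 : c i (φ τ i) ∈ σ := (h.coord _ _ _).2 (by omega)
    have h6 : (c i (φ τ i))ᶜ ∈ τ := (h.compl_coord _ _ _).2 le_rfl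
    constructor
    · refine Set.Subset.antisymm ?_ (Set.singleton_subset_iff.2 ⟨h5, fun h0 =>
        lt_irrefl _ ((h.coord _ _ _).1 h0)⟩)
      rintro H ⟨hσ, hτ⟩
      obtain ⟨j, m, rfl | rfl⟩ := h.cases (σ.subset hσ)
      · obtain ⟨rfl, rfl⟩ := (h3 j m).1 ⟨(h.coord _ _ _).1 hσ, fun h0 =>
          hτ ((h.coord _ _ _).2 h0)⟩
        rfl
      · refine absurd ⟨not_le.1 fun h0 => hτ ((h.compl_coord _ _ _).2 h0), ?_⟩ (h4 j m)
        exact ((h.compl_coord _ _ _).1 hσ).not_gt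
    · refine Set.Subset.antisymm ?_ (Set.singleton_subset_iff.2 ⟨h6, fun h0 => by
        have := (h.compl_coord _ _ _).1 h0
        omega⟩)
      rintro H ⟨hτ, hσ⟩
      obtain ⟨j, m, rfl | rfl⟩ := h.cases (τ.subset hτ)
      · exact absurd ⟨(h.coord _ _ _).1 hτ, fun h0 => hσ ((h.coord _ _ _).2 h0)⟩ (h4 j m)
      · obtain ⟨rfl, rfl⟩ := (h3 j m).1 ⟨not_le.1 fun h0 => hσ ((h.compl_coord _ _ _).2 h0),
          ((h.compl_coord _ _ _).1 hτ).not_gt⟩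
        rfl
  constructor
  · rintro ⟨i, hi | hi, hu⟩
    · obtain ⟨h1, h2⟩ := key' hi fun j hj => (hu j hj).symm
      exact ⟨_, h2, by rw [compl_compl]; exact h1⟩
    · obtain ⟨h1, h2⟩ := key' hi hu
      exact ⟨_, h1, h2⟩
  · rintro ⟨H, h1, h2⟩
    have hH : H ∈ 𝓗 := by
      have : H ∈ σ.carrier \ τ.carrier := by rw [h1]; rfl
      exact σ.subset this.1
    obtain ⟨i, n, rfl | rfl⟩ := h.cases hH
    · obtain ⟨h3, h4⟩ := key h1 h2
      exact ⟨i, Or.inr h3, h4⟩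
    · rw [compl_compl] at h2
      obtain ⟨h3, h4⟩ := key h2 h1
      exact ⟨i, Or.inl h3, fun j hj => (h4 j hj).symm⟩

/-- Among the coordinates to be raised, take the one whose next half-space has least rank. Any
half-space containing it but not `σ` would also contain `τ` and yield a candidate of smaller rank,
so the new point is compatible with inclusions. If none is to be raised, lower dually the coordinate
whose last half-space has largest rank. -/
theorem exists_closer (h : IsSageevChart P 𝓗 pos c φ) {σ τ : SageevVertex 𝓗} (hστ : σ ≠ τ) :
    ∃ σ', (SageevVertex.graph 𝓗).Adj σ σ' ∧
      latticeDist (φ σ') (φ τ) < latticeDist (φ σ) (φ τ) := by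
  classical
  by_cases hlt : ∃ i, φ σ i < φ τ i
  · obtain ⟨i, hi, hmin⟩ := Finset.exists_min_image (Finset.univ.filter fun i => φ σ i < φ τ i)
      (fun i => pos (c i (φ σ i))) (by obtain ⟨i, hi⟩ := hlt; exact ⟨i, by simpa using hi⟩)
    simp only [Finset.mem_filter, Finset.mem_univ, true_and] at hi hmin
    obtain ⟨σ', hσ'⟩ := h.exists_vertex (Function.update (φ σ) i (φ σ i + 1)) (by
      intro a b n m hs hn
      by_contra hcon
      have hle : φ σ b ≤ m := by
        by_cases hb : b = i
        · subst hb; rw [Function.update_self] at hcon; omega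
        · rw [Function.update_of_ne hb] at hcon; omega
      have hnσ : ¬ n < φ σ a := fun h0 => (h.lt_of_subset σ hs h0).not_ge hle
      obtain rfl : a = i := by
        by_contra ha
        rw [Function.update_of_ne ha] at hn
        exact hnσ hn
      rw [Function.update_self] at hn
      obtain rfl : n = φ σ a := by omega
      have h1 := hmin b (hle.trans_lt (h.lt_of_subset τ hs hi))
      have h2 := h.le_of_subset _ (h.mem b m) _ (h.mem b _) ((h.subset_iff b).2 hle)
      have h3 := h.ssubset_pos hs fun h0 => hcon (by
        rw [← h0.1, ← h0.2, Function.update_self]; omega)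
      omega)
    refine ⟨σ', (h.adj_iff _ _).1 ?_, ?_⟩
    · rw [hσ']
      exact ⟨i, by simp, fun j hj => by rw [Function.update_of_ne hj]⟩
    · rw [hσ']
      exact latticeDist_lt (i := i) (fun j hj => by rw [Function.update_of_ne hj])
        (by rw [Function.update_self]; omega)
  · push Not at hlt
    have hex : ∃ i, φ τ i < φ σ i := by
      obtain ⟨i, hi⟩ := Function.ne_iff.1 (h.injective.ne hστ)
      exact ⟨i, lt_of_le_of_ne (hlt i) hi.symm⟩
    obtain ⟨i, hi, hmax⟩ := Finset.exists_max_image (Finset.univ.filter fun i => φ τ i < φ σ i)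
      (fun i => pos (c i (φ σ i - 1))) (by obtain ⟨i, hi⟩ := hex; exact ⟨i, by simpa using hi⟩)
    simp only [Finset.mem_filter, Finset.mem_univ, true_and] at hi hmax
    obtain ⟨σ', hσ'⟩ := h.exists_vertex (Function.update (φ σ) i (φ σ i - 1)) (by
      intro a b n m hs hn
      have hna : n < φ σ a := by
        by_cases ha : a = i
        · subst ha; rw [Function.update_self] at hn; omega
        · rwa [Function.update_of_ne ha] at hn
      have hmb := h.lt_of_subset σ hs hna
      by_contra hcon
      obtain rfl : b = i := by
        by_contra hb
        rw [Function.update_of_ne hb] at hcon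
        exact hcon hmb
      rw [Function.update_self] at hcon
      obtain rfl : m = φ σ b - 1 := by omega
      have hnτ : ¬ n < φ τ a := fun h0 => by
        have := h.lt_of_subset τ hs h0
        omega
      have h1 := hmax a (by omega)
      have h2 := h.le_of_subset _ (h.mem a (φ σ a - 1)) _ (h.mem a n)
        ((h.subset_iff a).2 (by omega))
      have h3 := h.ssubset_pos hs fun h0 => by
        obtain ⟨rfl, rfl⟩ := h0
        rw [Function.update_self] at hn
        omega
      omega)
    refine ⟨σ', (h.adj_iff _ _).1 ?_, ?_⟩
    · rw [hσ']
      exact ⟨i, by simp, fun j hj => by rw [Function.update_of_ne hj]⟩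
    · rw [hσ']
      exact latticeDist_lt (i := i) (fun j hj => by rw [Function.update_of_ne hj])
        (by rw [Function.update_self]; omega)

theorem edist_eq (h : IsSageevChart P 𝓗 pos c φ) (σ τ : SageevVertex 𝓗) :
    (stdCubing d).graph.edist (φ σ) (φ τ) = (SageevVertex.graph 𝓗).edist σ τ := by
  rw [stdCubing_edist]
  refine (SimpleGraph.edist_eq_latticeDist (φ := φ) (fun u v huv =>
    latticeDist_le_one ((h.adj_iff u v).2 huv)) (fun u v huv => h.exists_closer huv) σ τ).symm

end IsSageevChart
end

/-! ### Half-spaces and cubes in the coordinates. -/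

section

variable {V : Type*} {P 𝓗 : Set (Set V)} {pos : Set V → ℤ} {d : ℕ} {c : Fin d → ℤ → Set V}

/-- The half-space of the standard cubing that corresponds to a member of a chain or to its
complement. -/
def chartHalf (c : Fin d → ℤ → Set V) (K : Set V) : Set (Fin d → ℤ) :=
  {x | (∃ i n, K = c i n ∧ n < x i) ∨ ∃ i n, K = (c i n)ᶜ ∧ x i ≤ n}

theorem lattice_half_inj {i j : Fin d} {n m : ℤ}
    (h : {x : Fin d → ℤ | n < x i} = {x | m < x j}) : i = j ∧ n = m := by
  have key : ∀ x : Fin d → ℤ, n < x i ↔ m < x j := fun x => Set.ext_iff.1 h x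
  have hij : i = j := by
    by_contra hij
    have := key (Function.update (fun _ => m) i (n + 1))
    rw [Function.update_self, Function.update_of_ne (Ne.symm hij)] at this
    omega
  subst hij
  have h1 := key fun _ => n + 1
  have h2 := key fun _ => m + 1
  beta_reduce at h1 h2
  exact ⟨rfl, by omega⟩

theorem coordHalfspaces_eq (i : Fin d) :
    coordHalfspaces d i = {K | ∃ n : ℤ, K = {x | n < x i}} := by
  have key : ∀ n m : ℤ, (n : ℝ) + 1 / 2 ≤ (m : ℝ) ↔ n < m := by
    intro n m
    constructor
    · intro h
      have : (n : ℝ) < m := by linarith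
      exact_mod_cast this
    · intro h
      have : (n : ℝ) + 1 ≤ m := by exact_mod_cast h
      linarith
  simp only [coordHalfspaces, key]

namespace IsSageevChart

variable {φ : SageevVertex 𝓗 → Fin d → ℤ}

theorem chain_ne_compl (h : IsSageevChart P 𝓗 pos c φ) (i j : Fin d) (n m : ℤ) :
    c i n ≠ (c j m)ᶜ := fun h0 =>
  h.not_subset_compl _ (h.mem i n) _ (h.mem j m) h0.subset

theorem chartHalf_chain (h : IsSageevChart P 𝓗 pos c φ) (i : Fin d) (n : ℤ) :
    chartHalf c (c i n) = {x | n < x i} := by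
  ext x
  constructor
  · rintro (⟨j, m, h1, h2⟩ | ⟨j, m, h1, -⟩)
    · obtain ⟨rfl, rfl⟩ := h.inj _ _ _ _ h1
      exact h2
    · exact absurd h1 (h.chain_ne_compl _ _ _ _)
  · exact fun hx => Or.inl ⟨i, n, rfl, hx⟩

theorem chartHalf_compl (h : IsSageevChart P 𝓗 pos c φ) (i : Fin d) (n : ℤ) :
    chartHalf c (c i n)ᶜ = {x | x i ≤ n} := by
  ext x
  constructor
  · rintro (⟨j, m, h1, -⟩ | ⟨j, m, h1, h2⟩)
    · exact absurd h1.symm (h.chain_ne_compl _ _ _ _)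
    · obtain ⟨rfl, rfl⟩ := h.inj _ _ _ _ (compl_injective h1)
      exact h2
  · exact fun hx => Or.inr ⟨i, n, rfl, hx⟩

theorem preimage_chartHalf (h : IsSageevChart P 𝓗 pos c φ) {H : Set V} (hH : H ∈ 𝓗) :
    φ ⁻¹' chartHalf c H = SageevVertex.half 𝓗 H := by
  ext σ
  obtain ⟨i, n, rfl | rfl⟩ := h.cases hH
  · rw [h.chartHalf_chain]
    exact (h.coord σ i n).symm
  · rw [h.chartHalf_compl]
    exact (h.compl_coord σ i n).symm

theorem compl_chain_mem (h : IsSageevChart P 𝓗 pos c φ) (i : Fin d) (n : ℤ) : (c i n)ᶜ ∈ 𝓗 :=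
  (h.mem_iff _).2 (Or.inr (by rw [compl_compl]; exact h.mem i n))

theorem bijOn_chartHalf (h : IsSageevChart P 𝓗 pos c φ) :
    Set.BijOn (chartHalf c) 𝓗 (stdCubing d).halfspaces := by
  have hcompl : ∀ (i : Fin d) (n : ℤ), {x : Fin d → ℤ | x i ≤ n} = {x | n < x i}ᶜ := by
    intro i n
    ext x
    simp
  have hne : ∀ (i j : Fin d) (n m : ℤ), {x : Fin d → ℤ | n < x i} ≠ {x | x j ≤ m} := by
    intro i j n m h0
    have := Set.ext_iff.1 h0 fun _ => max n m + 1
    simp only [Set.mem_ofPred_eq] at this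
    omega
  refine ⟨fun H hH => ?_, fun H hH K hK hHK => ?_, fun K hK => ?_⟩
  · obtain ⟨i, n, rfl | rfl⟩ := h.cases hH
    · rw [h.chartHalf_chain]
      exact mem_stdCubing_halfspaces.2 ⟨i, n, Or.inl rfl⟩
    · rw [h.chartHalf_compl]
      exact mem_stdCubing_halfspaces.2 ⟨i, n, Or.inr rfl⟩
  · obtain ⟨i, n, rfl | rfl⟩ := h.cases hH <;> obtain ⟨j, m, rfl | rfl⟩ := h.cases hK <;>
      simp only [h.chartHalf_chain, h.chartHalf_compl] at hHK
    · obtain ⟨rfl, rfl⟩ := lattice_half_inj hHK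
      rfl
    · exact absurd hHK (hne _ _ _ _)
    · exact absurd hHK.symm (hne _ _ _ _)
    · rw [hcompl, hcompl] at hHK
      obtain ⟨rfl, rfl⟩ := lattice_half_inj (compl_injective hHK)
      rfl
  · obtain ⟨i, n, rfl | rfl⟩ := mem_stdCubing_halfspaces.1 hK
    · exact ⟨c i n, h.chain_mem i n, h.chartHalf_chain i n⟩
    · exact ⟨(c i n)ᶜ, h.compl_chain_mem i n, h.chartHalf_compl i n⟩

theorem image_chartHalf (h : IsSageevChart P 𝓗 pos c φ) :
    chartHalf c '' P = stdPosHalfspaces d := by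
  ext K
  simp only [stdPosHalfspaces, coordHalfspaces_eq, Set.mem_iUnion, Set.mem_image,
    Set.mem_ofPred_eq]
  constructor
  · rintro ⟨H, hH, rfl⟩
    obtain ⟨i, n, rfl⟩ := h.surj H hH
    exact ⟨i, n, h.chartHalf_chain i n⟩
  · rintro ⟨i, n, rfl⟩
    exact ⟨c i n, h.mem i n, h.chartHalf_chain i n⟩

theorem chartHalf_mem_coordHalfspaces (h : IsSageevChart P 𝓗 pos c φ) (i j : Fin d) (n : ℤ) :
    chartHalf c (c j n) ∈ coordHalfspaces d i ↔ j = i := by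
  rw [coordHalfspaces_eq, h.chartHalf_chain]
  constructor
  · rintro ⟨m, hm⟩
    exact (lattice_half_inj hm).1
  · rintro rfl
    exact ⟨n, rfl⟩

/-! #### Cubes -/

/-- The coordinates as an embedding of graphs. -/
def embedding (h : IsSageevChart P 𝓗 pos c φ) :
    SageevVertex.graph 𝓗 ↪g (stdCubing d).graph :=
  ⟨⟨φ, h.injective⟩, h.adj_iff _ _⟩

theorem exists_range_eq_image (h : IsSageevChart P 𝓗 pos c φ) {n : ℕ} {C : Set (SageevVertex 𝓗)}
    (e : hypercube n ≃g (SageevVertex.graph 𝓗).induce C) :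
    ∃ f : hypercube n ↪g (stdCubing d).graph, Set.range f = φ '' C := by
  refine ⟨h.embedding.comp ((SimpleGraph.Embedding.induce C).comp e.toEmbedding), ?_⟩
  ext x
  constructor
  · rintro ⟨y, rfl⟩
    exact ⟨_, (e y).2, rfl⟩
  · rintro ⟨σ, hσ, rfl⟩
    obtain ⟨y, hy⟩ := e.surjective ⟨σ, hσ⟩
    refine ⟨y, ?_⟩
    change φ (e y).1 = φ σ
    rw [hy]

theorem image_cube_mem (h : IsSageevChart P 𝓗 pos c φ) {C : Set (SageevVertex 𝓗)}
    (hC : C ∈ (SageevVertex.complex 𝓗).cubes) : φ '' C ∈ (stdCubing d).cubes := by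
  obtain ⟨n, ⟨e⟩⟩ := hC
  obtain ⟨f, hf⟩ := h.exists_range_eq_image e
  rw [← hf]
  exact SimpleGraph.range_mem_cubeCompletion f

theorem dim_cube_le (h : IsSageevChart P 𝓗 pos c φ) {n : ℕ} {C : Set (SageevVertex 𝓗)}
    (hC : (SageevVertex.complex 𝓗).IsCubeOfDim n C) : n ≤ d := by
  obtain ⟨-, ⟨e⟩⟩ := hC
  obtain ⟨f, -⟩ := h.exists_range_eq_image e
  exact le_of_hypercube_embedding f

theorem image_cube_eq (h : IsSageevChart P 𝓗 pos c φ) {C : Set (SageevVertex 𝓗)}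
    (hC : (SageevVertex.complex 𝓗).IsCubeOfDim d C) :
    ∃ v : Fin d → ℤ, φ '' C = {x | ∀ i, x i = v i ∨ x i = v i + 1} := by
  obtain ⟨-, ⟨e⟩⟩ := hC
  obtain ⟨f, hf⟩ := h.exists_range_eq_image e
  obtain ⟨v, hv⟩ := exists_range_eq_of_hypercube_embedding f
  exact ⟨v, by rw [← hf, hv]⟩

/-- The half-spaces dual to a full-dimensional cube. -/
theorem dual_iff (h : IsSageevChart P 𝓗 pos c φ) {C : Set (SageevVertex 𝓗)} {v : Fin d → ℤ}
    (hC : φ '' C = {x | ∀ i, x i = v i ∨ x i = v i + 1}) (H : Set V) :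
    (H ∈ P ∧ ∃ x ∈ C, ∃ y ∈ C, (SageevVertex.graph 𝓗).Adj x y ∧ x ∉ SageevVertex.half 𝓗 H ∧
      y ∈ SageevVertex.half 𝓗 H) ↔ ∃ i, c i (v i) = H := by
  constructor
  · rintro ⟨hH, x, hx, y, hy, -, h1, h2⟩
    obtain ⟨i, n, rfl⟩ := h.surj H hH
    have hx' : φ x ∈ φ '' C := ⟨x, hx, rfl⟩
    have hy' : φ y ∈ φ '' C := ⟨y, hy, rfl⟩
    rw [hC] at hx' hy'
    have h3 : ¬ n < φ x i := fun h0 => h1 ((h.coord x i n).2 h0)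
    have h4 : n < φ y i := (h.coord y i n).1 h2
    have h5 := hx' i
    have h6 := hy' i
    refine ⟨i, ?_⟩
    congr 1
    omega
  · rintro ⟨i, rfl⟩
    have h1 : v ∈ φ '' C := by
      rw [hC]
      exact fun j => Or.inl rfl
    have h2 : Function.update v i (v i + 1) ∈ φ '' C := by
      rw [hC]
      intro j
      by_cases hj : j = i
      · subst hj; simp
      · simp [Function.update_of_ne hj]
    obtain ⟨x, hx, hx'⟩ := h1
    obtain ⟨y, hy, hy'⟩ := h2
    refine ⟨h.mem _ _, x, hx, y, hy, ?_, ?_, ?_⟩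
    · rw [← h.adj_iff, hx', hy']
      exact ⟨i, by simp, fun j hj => by rw [Function.update_of_ne hj]⟩
    · intro h0
      have := (h.coord x i (v i)).1 h0
      rw [hx'] at this
      exact lt_irrefl _ this
    · refine (h.coord y i (v i)).2 ?_
      rw [hy', Function.update_self]
      omega

/-- The vertex of the cube with only coordinate `i` raised belongs to the `i`-th dual half-space and
to no other `c j (v j)`. -/
theorem antichain_of_cube (h : IsSageevChart P 𝓗 pos c φ) {C : Set (SageevVertex 𝓗)}
    {v : Fin d → ℤ} (hC : φ '' C = {x | ∀ i, x i = v i ∨ x i = v i + 1}) {i j : Fin d}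
    (hij : c i (v i) ⊆ c j (v j)) : i = j := by
  by_contra hne
  have h2 : Function.update v i (v i + 1) ∈ φ '' C := by
    rw [hC]
    intro j
    by_cases hj : j = i
    · subst hj; simp
    · simp [Function.update_of_ne hj]
  obtain ⟨y, hy, hy'⟩ := h2
  have := h.lt_of_subset y hij (by rw [hy', Function.update_self]; omega)
  rw [hy', Function.update_of_ne (Ne.symm hne)] at this
  exact lt_irrefl _ this

theorem le_of_chain_subset (h : IsSageevChart P 𝓗 pos c φ)
    (h0 : ∀ i j, c i 0 ⊆ c j 0 → i = j) {i j : Fin d} {n m : ℤ} (hs : c i n ⊆ c j m)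
    (hn : n ≤ 0) : m ≤ 0 := by
  by_contra hm
  have h1 : c i 0 ⊆ c j m := ((h.subset_iff i).2 hn).trans hs
  have h2 := h.anti j 0 m (by omega)
  obtain rfl := h0 i j (h1.trans h2.subset)
  exact h2.not_subset h1

/-- As the members of index zero are incomparable, membership in each can be decided independently:
all points of the unit cube are compatible with the inclusions. -/
theorem exists_cube (h : IsSageevChart P 𝓗 pos c φ) (h0 : ∀ i j, c i 0 ⊆ c j 0 → i = j) :
    ∃ C, (SageevVertex.complex 𝓗).IsCubeOfDim d C := by
  have hex : ∀ x : Fin d → Bool, ∃ σ, φ σ = stdFace 0 (Function.Embedding.refl _) x := by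
    intro x
    have hx : ∀ i, stdFace (0 : Fin d → ℤ) (Function.Embedding.refl _) x i = 0 ∨
        stdFace (0 : Fin d → ℤ) (Function.Embedding.refl _) x i = 1 := by
      intro i
      have := stdFace_apply (0 : Fin d → ℤ) (Function.Embedding.refl _) x i
      simp only [Function.Embedding.refl_apply] at this
      rw [this]
      cases x i <;> simp
    refine h.exists_vertex _ fun i j n m hs hn => ?_
    have h1 := hx i
    have h2 := hx j
    have h3 := h.le_of_chain_subset h0 hs (by omega)
    rcases h3.lt_or_eq with h4 | rfl
    · omega
    · have h5 : c i 0 ⊆ c j 0 := ((h.subset_iff i).2 (by omega)).trans hs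
      obtain rfl := h0 i j h5
      have := (h.subset_iff i).1 hs
      omega
  choose s hs using hex
  let f : hypercube d ↪g SageevVertex.graph 𝓗 := ⟨⟨s, fun x y hxy => by
    have : stdFace (0 : Fin d → ℤ) (Function.Embedding.refl _) x =
      stdFace 0 (Function.Embedding.refl _) y := by rw [← hs, ← hs, hxy]
    exact (stdFace _ _).injective this⟩, by
      intro x y
      change (SageevVertex.graph 𝓗).Adj (s x) (s y) ↔ _
      rw [← h.adj_iff, hs, hs]
      exact (stdFace _ _).map_rel_iff⟩
  exact ⟨Set.range f, SimpleGraph.range_mem_cubeCompletion f, ⟨f.isoInduceRange⟩⟩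

theorem dim_eq (h : IsSageevChart P 𝓗 pos c φ) (h0 : ∀ i j, c i 0 ⊆ c j 0 → i = j) :
    (SageevVertex.complex 𝓗).dim = d := by
  obtain ⟨C, hC⟩ := h.exists_cube h0
  refine le_antisymm (sSup_le ?_) (le_sSup ⟨d, C, hC, rfl⟩)
  rintro _ ⟨n, C', hC', rfl⟩
  exact_mod_cast h.dim_cube_le hC'

end IsSageevChart

end

/-! ### Translations of ranked systems -/

/-- Elements whose ranks agree modulo `ℓ` are in one `g`-orbit, since a rank determines its element,
and orbits are chains. Hence an antichain injects into the residues modulo `ℓ`. This is the source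
of finite dimensionality. -/
theorem card_antichain_le {Q : Type*} [PartialOrder Q] {pos : Q → ℤ} {g : Q ≃o Q} {ℓ : ℤ}
    (hpos : Function.Injective pos) (hℓ : 0 < ℓ) (hg : ∀ x, g x < x)
    (hgpos : ∀ x, pos (g x) = pos x + ℓ) {B : Finset Q} (hB : IsAntichain (· ≤ ·) (B : Set Q)) :
    B.card ≤ ℓ.toNat := by
  have hpow : ∀ (n : ℕ) x, (g ^ n : Q ≃o Q) x ≤ x := by
    intro n x
    induction n with
    | zero => simp
    | succ n ih =>
      rw [pow_succ', RelIso.mul_apply]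
      exact (hg _).le.trans ih
  have key : ∀ (x y : Q) (k : ℤ), pos y = pos x + k * ℓ → 0 ≤ k → y ≤ x := by
    intro x y k h hk
    lift k to ℕ using hk
    have : y = (g ^ (k : ℤ) : Q ≃o Q) x := hpos (by rw [h, pos_zpow hgpos])
    rw [this, zpow_natCast]
    exact hpow k x
  have hmaps : ∀ x ∈ B, pos x % ℓ ∈ Finset.Ico 0 ℓ := fun x _ => by
    rw [Finset.mem_Ico]
    exact ⟨Int.emod_nonneg _ hℓ.ne', Int.emod_lt_of_pos _ hℓ⟩
  have hinj : Set.InjOn (fun x => pos x % ℓ) B := by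
    intro x hx y hy hxy
    obtain ⟨k, hk⟩ := Int.ModEq.dvd (show pos x ≡ pos y [ZMOD ℓ] from hxy)
    rcases le_total 0 k with h | h
    · exact (hB.eq hy hx (key x y k (by linarith) h)).symm
    · exact hB.eq hx hy (key y x (-k) (by linarith) (by omega))
  have := Finset.card_le_card_of_injOn _ hmaps hinj
  simpa using this

section

variable {V G : Type*} [Group G] [MulAction G V] {P 𝓗 : Set (Set V)} {pos : Set V → ℤ} {ℓ : ℤ}
  {g : G} {d : ℕ} {c : Fin d → ℤ → Set V}

/-- The element `g` moves every member of the ranked system `P` into itself, by `ℓ` ranks. -/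
structure IsTranslatedSystem (P : Set (Set V)) (pos : Set V → ℤ) (ℓ : ℤ) (g : G) : Prop
    extends IsRankedSystem P pos where
  length_pos : 0 < ℓ
  smul_mem : ∀ H ∈ P, g • H ∈ P
  inv_smul_mem : ∀ H ∈ P, g⁻¹ • H ∈ P
  smul_ssubset : ∀ H ∈ P, g • H ⊂ H
  pos_smul : ∀ H ∈ P, pos (g • H) = pos H + ℓ

/-- The members of `P` between the chain members `c i 0` and their images under `g`. -/
def chainSpan (P : Set (Set V)) (c : Fin d → ℤ → Set V) (g : G) : Set (Set V) :=
  {K ∈ P | (∃ i, K ⊆ c i 0) ∧ ∃ i, g • c i 0 ⊆ K}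

/-- A decomposition of `P` into chains that are permuted and shifted by `g`, whose members of
index zero are pairwise incomparable. The chain of index zero is saturated between these members
and their images. -/
structure IsEquivariantChainSystem (P : Set (Set V)) (g : G) (c : Fin d → ℤ → Set V)
    (σ : Equiv.Perm (Fin d)) (t : Fin d → ℤ) : Prop extends IsChainSystem P c where
  smul : ∀ i n, g • c i n = c (σ i) (n + t i)
  antichain : ∀ i j, c i 0 ⊆ c j 0 → i = j
  saturated : ∀ (hd : 0 < d) (n : ℤ), c ⟨0, hd⟩ n ∈ chainSpan P c g →
    c ⟨0, hd⟩ (n + 1) ∈ chainSpan P c g → ∀ Z ∈ P, c ⟨0, hd⟩ (n + 1) ⊂ Z → ¬ Z ⊂ c ⟨0, hd⟩ n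

namespace IsTranslatedSystem

/-- The action of `g` on `P`. -/
def smulIso (h : IsTranslatedSystem P pos ℓ g) : P ≃o P where
  toFun H := ⟨g • H.1, h.smul_mem H.1 H.2⟩
  invFun H := ⟨g⁻¹ • H.1, h.inv_smul_mem H.1 H.2⟩
  left_inv H := Subtype.ext (inv_smul_smul g H.1)
  right_inv H := Subtype.ext (smul_inv_smul g H.1)
  map_rel_iff' := Set.smul_set_subset_smul_set_iff

theorem pos_injective (h : IsTranslatedSystem P pos ℓ g) :
    Function.Injective fun H : P => pos H :=
  fun H K hHK => Subtype.ext (h.injOn H.2 K.2 hHK)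

theorem exists_max_antichain (h : IsTranslatedSystem P pos ℓ g) :
    ∃ A : Finset P, IsAntichain (· ≤ ·) (A : Set P) ∧
      ∀ B : Finset P, IsAntichain (· ≤ ·) (B : Set P) → B.card ≤ A.card := by
  let S : Set ℕ := {k | ∃ A : Finset P, IsAntichain (· ≤ ·) (A : Set P) ∧ A.card = k}
  have hbdd : BddAbove S := by
    refine ⟨ℓ.toNat, ?_⟩
    rintro _ ⟨A, hA, rfl⟩
    exact card_antichain_le (g := h.smulIso) h.pos_injective h.length_pos
      (fun x => h.smul_ssubset x.1 x.2) (fun x => h.pos_smul x.1 x.2) hA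
  obtain ⟨A, hA, hcard⟩ := Nat.sSup_mem (s := S) ⟨0, ∅, by simp, rfl⟩ hbdd
  exact ⟨A, hA, fun B hB => hcard ▸ le_csSup hbdd ⟨B, hB, rfl⟩⟩

theorem exists_chains (h : IsTranslatedSystem P pos ℓ g) {A : Finset P}
    (hA : IsAntichain (· ≤ ·) (A : Set P)) (hcard : A.card = d)
    (hmax : ∀ B : Finset P, IsAntichain (· ≤ ·) (B : Set P) → B.card ≤ d) :
    ∃ (c : Fin d → ℤ → Set V) (σ : Equiv.Perm (Fin d)) (t : Fin d → ℤ),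
      IsEquivariantChainSystem P g c σ t ∧ ∀ H, (∃ a ∈ A, a.1 = H) ↔ ∃ i, c i 0 = H := by
  obtain ⟨c, σ, t, hanti, hinj, hsurj, hc0, hsmul, hsat⟩ := exists_equivariant_chains
    (g := h.smulIso) h.pos_injective (fun x y hxy => h.le_of_subset x.1 x.2 y.1 y.2 hxy)
    h.length_pos (fun x => h.smul_ssubset x.1 x.2) (fun x => h.pos_smul x.1 x.2) hA hcard hmax
  have hspan : ∀ x : P, x.1 ∈ chainSpan P (fun i n => (c i n).1) g →
      x ∈ antichainSpan h.smulIso A := by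
    rintro x ⟨-, ⟨i, hi⟩, j, hj⟩
    exact ⟨⟨c i 0, (hc0 _).2 ⟨i, rfl⟩, hi⟩, c j 0, (hc0 _).2 ⟨j, rfl⟩, hj⟩
  refine ⟨fun i n => (c i n).1, σ, t, ⟨⟨fun i n => (c i n).2, ?_, ?_, ?_⟩, ?_, ?_, ?_⟩, ?_⟩
  · intro H hH
    obtain ⟨i, n, hin⟩ := hsurj ⟨H, hH⟩
    exact ⟨i, n, congrArg Subtype.val hin⟩
  · exact fun i j n m h0 => hinj _ _ _ _ (Subtype.ext h0)
  · exact fun i n m hnm => hanti i hnm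
  · exact fun i n => congrArg Subtype.val (hsmul i n)
  · exact fun i j hij =>
      (hinj _ _ _ _ (hA.eq ((hc0 _).2 ⟨i, rfl⟩) ((hc0 _).2 ⟨j, rfl⟩) hij)).1
  · exact fun hd n hn hn' Z hZ h1 h2 => hsat hd n (hspan _ hn) (hspan _ hn') ⟨Z, hZ⟩ h1 h2
  · intro H
    constructor
    · rintro ⟨a, ha, rfl⟩
      obtain ⟨i, hi⟩ := (hc0 a).1 ha
      exact ⟨i, congrArg Subtype.val hi⟩
    · rintro ⟨i, rfl⟩
      exact ⟨c i 0, (hc0 _).2 ⟨i, rfl⟩, rfl⟩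

theorem pos_pow_smul (h : IsTranslatedSystem P pos ℓ g) {H : Set V} (hH : H ∈ P) (n : ℕ) :
    g ^ n • H ∈ P ∧ pos (g ^ n • H) = pos H + n * ℓ := by
  induction n with
  | zero => simpa using hH
  | succ n ih =>
    rw [pow_succ', mul_smul, h.pos_smul _ ih.1, ih.2]
    exact ⟨h.smul_mem _ ih.1, by push_cast; ring⟩

end IsTranslatedSystem

/-! ### Equivariance of the coordinates -/

/-- The automorphism of the standard cubing that permutes the coordinates by `σ` and translates
by `t`. -/
def latticeShift (σ : Equiv.Perm (Fin d)) (t : Fin d → ℤ) :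
    (stdCubing d).graph ≃g (stdCubing d).graph where
  toFun x j := x (σ.symm j) + t (σ.symm j)
  invFun x i := x (σ i) - t i
  left_inv x := by
    funext i
    simp
  right_inv x := by
    funext i
    simp
  map_rel_iff' := by
    intro x y
    constructor
    · rintro ⟨i, h1, h2⟩
      refine ⟨σ.symm i, ?_, fun j hj => ?_⟩
      · change y (σ.symm i) + t (σ.symm i) = x (σ.symm i) + t (σ.symm i) + 1 ∨
          x (σ.symm i) + t (σ.symm i) = y (σ.symm i) + t (σ.symm i) + 1 at h1
        omega
      · have := h2 (σ j) (fun h => hj (by rw [← h, Equiv.symm_apply_apply]))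
        change x (σ.symm (σ j)) + t (σ.symm (σ j)) = y (σ.symm (σ j)) + t (σ.symm (σ j)) at this
        rw [Equiv.symm_apply_apply] at this
        omega
    · rintro ⟨i, h1, h2⟩
      refine ⟨σ i, ?_, fun j hj => ?_⟩
      · change y (σ.symm (σ i)) + t (σ.symm (σ i)) = x (σ.symm (σ i)) + t (σ.symm (σ i)) + 1 ∨
          x (σ.symm (σ i)) + t (σ.symm (σ i)) = y (σ.symm (σ i)) + t (σ.symm (σ i)) + 1
        rw [Equiv.symm_apply_apply]
        omega
      · change x (σ.symm j) + t (σ.symm j) = y (σ.symm j) + t (σ.symm j)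
        rw [h2 (σ.symm j) fun h => hj (by rw [← h, Equiv.apply_symm_apply])]

theorem latticeShift_apply (σ : Equiv.Perm (Fin d)) (t x : Fin d → ℤ) (j : Fin d) :
    latticeShift σ t x j = x (σ.symm j) + t (σ.symm j) := rfl

theorem image_mem_stdCubing (f : (stdCubing d).graph ≃g (stdCubing d).graph)
    {Q : Set (Fin d → ℤ)} (hQ : Q ∈ (stdCubing d).cubes) : f '' Q ∈ (stdCubing d).cubes := by
  obtain ⟨n, ⟨e⟩⟩ := hQ
  have : Set.range (f.toEmbedding.comp ((SimpleGraph.Embedding.induce Q).comp e.toEmbedding)) =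
      f '' Q := by
    ext x
    constructor
    · rintro ⟨y, rfl⟩
      exact ⟨_, (e y).2, rfl⟩
    · rintro ⟨z, hz, rfl⟩
      obtain ⟨y, hy⟩ := e.surjective ⟨z, hz⟩
      refine ⟨y, ?_⟩
      change f (e y).1 = f z
      rw [hy]
  rw [← this]
  exact SimpleGraph.range_mem_cubeCompletion _

/-- The action of the cyclic group generated by `g` on `ℝ^d` by powers of an automorphism `T`
of the standard cubing. -/
theorem exists_zpowers_action (T : (stdCubing d).graph ≃g (stdCubing d).graph)
    (hT : ∀ n : ℕ, g ^ n = 1 → T ^ n = 1) :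
    ∃ α : Subgroup.zpowers g →* Equiv.Perm (Fin d → ℤ),
      (∀ h, ∀ Q ∈ (stdCubing d).cubes, α h '' Q ∈ (stdCubing d).cubes) ∧
      ∀ x, α ⟨g, Subgroup.mem_zpowers g⟩ x = T x := by
  have hgen : ∀ x : Subgroup.zpowers g,
      x ∈ Subgroup.zpowers (⟨g, Subgroup.mem_zpowers g⟩ : Subgroup.zpowers g) := by
    rintro ⟨x, n, rfl⟩
    exact ⟨n, Subtype.ext (by simp)⟩
  let β : Subgroup.zpowers g →* ((stdCubing d).graph ≃g (stdCubing d).graph) :=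
    monoidHomOfForallMemZpowers hgen (g' := T) (by
      rw [Subgroup.orderOf_mk]
      exact orderOf_dvd_of_pow_eq_one (hT _ (pow_orderOf_eq_one g)))
  refine ⟨MonoidHom.mk' (fun h => (β h).toEquiv) fun a b => ?_, fun h Q hQ => ?_, fun x => ?_⟩
  · ext x : 1
    change β (a * b) x = β a (β b x)
    rw [map_mul]
    rfl
  · exact image_mem_stdCubing (β h) hQ
  · change β _ x = T x
    rw [monoidHomOfForallMemZpowers_apply_gen]

theorem forall_zpowers_equivariant {W Y : Type*} [MulAction (Subgroup.zpowers g) W]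
    (α : Subgroup.zpowers g →* Equiv.Perm Y) (φ : W → Y)
    (h : ∀ x, φ ((⟨g, Subgroup.mem_zpowers g⟩ : Subgroup.zpowers g) • x) =
      α ⟨g, Subgroup.mem_zpowers g⟩ (φ x)) (γ : Subgroup.zpowers g) (x : W) :
    φ (γ • x) = α γ (φ x) := by
  have hgen : ∃ n : ℤ, (⟨g, Subgroup.mem_zpowers g⟩ : Subgroup.zpowers g) ^ n = γ := by
    obtain ⟨x, n, rfl⟩ := γ
    exact ⟨n, Subtype.ext (by simp)⟩
  generalize (⟨g, Subgroup.mem_zpowers g⟩ : Subgroup.zpowers g) = δ at h hgen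
  obtain ⟨n, rfl⟩ := hgen
  induction n using Int.induction_on generalizing x with
  | zero => simp
  | succ n ih => rw [zpow_add_one, mul_smul, ih, h, map_mul, Equiv.Perm.mul_apply]
  | pred n ih =>
    have h1 := h (δ⁻¹ • x)
    rw [smul_inv_smul] at h1
    rw [zpow_sub_one, mul_smul, ih, map_mul, Equiv.Perm.mul_apply, map_inv, h1]
    exact congrArg _ ((α δ).symm_apply_apply _).symm

end

/-! ### Coordinates adapted to `g` and to a given cube. -/

section

variable {V G : Type*} [Group G] [MulAction G V] {P 𝓗 : Set (Set V)} {pos : Set V → ℤ} {ℓ : ℤ}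
  {g : G} {d : ℕ} {c : Fin d → ℤ → Set V} {σ : Equiv.Perm (Fin d)} {t : Fin d → ℤ}
  {φ : SageevVertex 𝓗 → Fin d → ℤ}

theorem unitCube_eq : unitCube d = {x | ∀ i, x i = (0 : Fin d → ℤ) i ∨
    x i = (0 : Fin d → ℤ) i + 1} := by
  simp [unitCube]

theorem IsSageevChart.interval_eq (h : IsSageevChart P 𝓗 pos c φ) {x y : SageevVertex 𝓗}
    (hxy : φ x ≤ φ y) :
    SageevVertex.interval x y = {H | ∃ i n, c i n = H ∧ φ x i ≤ n ∧ n < φ y i} := by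
  ext H
  constructor
  · rintro ⟨hH, h1, h2⟩
    change H ∈ y at h1
    change H ∉ x at h2
    obtain ⟨i, n, rfl | rfl⟩ := h.cases hH
    · rw [h.coord] at h1 h2
      exact ⟨i, n, rfl, not_lt.1 h2, h1⟩
    · rw [h.compl_coord] at h1 h2
      exact absurd ((hxy i).trans h1) h2
  · rintro ⟨i, n, rfl, h1, h2⟩
    exact ⟨h.chain_mem i n, (h.coord y i n).2 h2, fun h0 => h1.not_gt ((h.coord x i n).1 h0)⟩

namespace IsEquivariantChainSystem

theorem smul_shift (hs : IsEquivariantChainSystem P g c σ t) (j : Fin d) (n : ℤ) :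
    g • c (σ.symm j) (n - t (σ.symm j)) = c j n := by
  rw [hs.smul, Equiv.apply_symm_apply, sub_add_cancel]

theorem coord_smul (hs : IsEquivariantChainSystem P g c σ t) (h : IsSageevChart P 𝓗 pos c φ)
    {x y : SageevVertex 𝓗} (hxy : y.carrier = g • x.carrier) :
    φ y = latticeShift σ t (φ x) := by
  have key : ∀ j n, n < φ y j ↔ n < φ x (σ.symm j) + t (σ.symm j) := by
    intro j n
    rw [← h.coord, ← hs.smul_shift j n, ← sub_lt_iff_lt_add, ← h.coord]
    change _ ∈ y.carrier ↔ _
    rw [hxy]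
    exact Set.smul_mem_smul_set_iff
  funext j
  rw [latticeShift_apply]
  exact eq_of_forall_lt_iff fun n => key j n

theorem nonneg (hs : IsEquivariantChainSystem P g c σ t) {j : Fin d} {i : Fin d} {n : ℤ}
    (h : c j n ⊆ c i 0) : 0 ≤ n := by
  by_contra hn
  have h1 := hs.anti j n 0 (not_le.1 hn)
  obtain rfl := hs.antichain j i (h1.subset.trans h)
  exact h1.not_subset h

theorem shift_nonneg (hs : IsEquivariantChainSystem P g c σ t)
    (hT : IsTranslatedSystem P pos ℓ g) (i : Fin d) : 0 ≤ t i := by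
  refine hs.nonneg (j := σ i) (i := i) ?_
  have := (hT.smul_ssubset _ (hs.mem i 0)).subset
  rwa [hs.smul, zero_add] at this

/-- Chain `j` enters the span at its member of `A`, of index zero, and leaves it at its member of
`gA`, which is `g • c (σ.symm j) 0`. Incomparability within `A`, and its translate within `gA`,
prevents other chains from extending this range. -/
theorem mem_chainSpan (hs : IsEquivariantChainSystem P g c σ t)
    (h : IsSageevChart P 𝓗 pos c φ) (j : Fin d) (n : ℤ) :
    c j n ∈ chainSpan P c g ↔ 0 ≤ n ∧ n ≤ t (σ.symm j) := by
  constructor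
  · rintro ⟨-, ⟨i, hi⟩, k, hk⟩
    refine ⟨hs.nonneg hi, ?_⟩
    rw [← hs.smul_shift j n, Set.smul_set_subset_smul_set_iff] at hk
    have := h.le_of_chain_subset hs.antichain hk le_rfl
    omega
  · rintro ⟨h1, h2⟩
    refine ⟨hs.mem j n, ⟨j, (h.subset_iff j).2 h1⟩, σ.symm j, ?_⟩
    rw [hs.smul, Equiv.apply_symm_apply, zero_add]
    exact (h.subset_iff j).2 h2

/-- If `d > 0`, then `g ^ n` raises ranks by `n * ℓ`, so only `n = 0` gives the identity; if `d =
0`, there is a single point. This makes the action of the cyclic group well defined. -/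
theorem pow_latticeShift_eq_one (hs : IsEquivariantChainSystem P g c σ t)
    (hT : IsTranslatedSystem P pos ℓ g) (n : ℕ) (hn : g ^ n = 1) : latticeShift σ t ^ n = 1 := by
  rcases d.eq_zero_or_pos with rfl | hd
  · ext x i
    exact i.elim0
  · have h1 := (hT.pos_pow_smul (hs.mem ⟨0, hd⟩ 0) n).2
    rw [hn, one_smul, left_eq_add] at h1
    have h2 := hT.length_pos
    have h3 : n = 0 := by
      rcases mul_eq_zero.1 h1 with h3 | h3
      · exact_mod_cast h3
      · omega
    rw [h3, pow_zero]

/-- The part of the first chain between `A` and `gA` is a segment. -/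
theorem exists_segment (hs : IsEquivariantChainSystem P g c σ t)
    (h : IsSageevChart P 𝓗 pos c φ) (hd : 0 < d) :
    ∃ l : List (Set V), IsSegment 𝓗 l ∧
      {H | H ∈ l} = chainSpan P c g ∩ chartHalf c ⁻¹' coordHalfspaces d ⟨0, hd⟩ := by
  -- Both ends, indices `0` and `t (σ.symm ⟨0, hd⟩)`, belong to the closed span, hence the extra
  -- one.
  set m : ℕ := (t (σ.symm ⟨0, hd⟩) + 1).toNat with hm
  refine ⟨(List.range m).map fun k : ℕ => c ⟨0, hd⟩ k, ⟨?_, ?_⟩, ?_⟩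
  · intro H hH
    obtain ⟨k, -, rfl⟩ := List.mem_map.1 hH
    exact h.chain_mem _ _
  · rw [List.isChain_map, List.isChain_range]
    intro k hk
    rw [Nat.cast_succ]
    have hlt : c ⟨0, hd⟩ ((k : ℤ) + 1) ⊂ c ⟨0, hd⟩ k := hs.anti _ _ _ (by omega)
    refine ⟨hlt, Or.inr hlt, ?_⟩
    rintro ⟨L, hL, ⟨h1, h2⟩ | ⟨h1, h2⟩⟩
    · exact (h1.trans h2).not_subset hlt.subset
    -- Saturation was obtained inside `P` only. A negative half-space cannot intervene either,
    -- because no positive half-space is contained in the complement of another.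
    · rcases (h.mem_iff L).1 hL with hL | hL
      · exact hs.saturated hd k ((hs.mem_chainSpan h _ _).2 (by omega))
          ((hs.mem_chainSpan h _ _).2 (by omega)) L hL h1 h2
      · exact h.not_subset_compl _ (hs.mem _ _) _ hL (by rw [compl_compl]; exact h1.subset)
  · ext H
    simp only [Set.mem_ofPred_eq, List.mem_map, List.mem_range, Set.mem_inter_iff,
      Set.mem_preimage]
    constructor
    · rintro ⟨k, hk, rfl⟩
      exact ⟨(hs.mem_chainSpan h _ _).2 (by omega), (h.chartHalf_mem_coordHalfspaces _ _ _).2 rfl⟩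
    · rintro ⟨h1, h2⟩
      obtain ⟨j, n, rfl⟩ := hs.surj H h1.1
      obtain rfl := (h.chartHalf_mem_coordHalfspaces _ _ _).1 h2
      have h3 := (hs.mem_chainSpan h _ _).1 h1
      exact ⟨n.toNat, by omega, by rw [Int.toNat_of_nonneg h3.1]⟩

end IsEquivariantChainSystem

/-- The coordinates can be adapted to any given full-dimensional cube. -/
theorem IsTranslatedSystem.exists_chart_of_cube (hT : IsTranslatedSystem P pos ℓ g)
    (h𝓗 : ∀ H, H ∈ 𝓗 ↔ H ∈ P ∨ Hᶜ ∈ P)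
    (hmax : ∀ B : Finset P, IsAntichain (· ≤ ·) (B : Set P) → B.card ≤ d)
    {φ₀ : SageevVertex 𝓗 → Fin d → ℤ} (h₀ : IsSageevChart P 𝓗 pos c φ₀)
    {C : Set (SageevVertex 𝓗)} (hC : (SageevVertex.complex 𝓗).IsCubeOfDim d C) :
    ∃ (c : Fin d → ℤ → Set V) (σ : Equiv.Perm (Fin d)) (t : Fin d → ℤ)
      (φ : SageevVertex 𝓗 → Fin d → ℤ), IsSageevChart P 𝓗 pos c φ ∧
      IsEquivariantChainSystem P g c σ t ∧ φ '' C = unitCube d := by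
  classical
  obtain ⟨v, hv⟩ := h₀.image_cube_eq hC
  -- The half-spaces dual to `C`, read in the given coordinates. They form an antichain of size `d`,
  -- hence one of maximum size, on which new chains are built.
  let a : Fin d ↪ P := ⟨fun i => ⟨c i (v i), h₀.mem _ _⟩, fun i j hij =>
    (h₀.inj _ _ _ _ (congrArg Subtype.val hij)).1⟩
  have hA : IsAntichain (· ≤ ·) ((Finset.univ.map a : Finset P) : Set P) := by
    rintro x hx y hy hxy hle
    obtain ⟨i, -, rfl⟩ := Finset.mem_map.1 (Finset.mem_coe.1 hx)
    obtain ⟨j, -, rfl⟩ := Finset.mem_map.1 (Finset.mem_coe.1 hy)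
    exact hxy (congrArg a (h₀.antichain_of_cube hv hle))
  obtain ⟨c', σ, t, hs, hc0⟩ := hT.exists_chains hA (by simp) hmax
  obtain ⟨φ, h⟩ := exists_isSageevChart hT.toIsRankedSystem hs.toIsChainSystem h𝓗
  refine ⟨c', σ, t, φ, h, hs, ?_⟩
  obtain ⟨w, hw⟩ := h.image_cube_eq hC
  -- Duality to `C` does not depend on the coordinates, and the new chains carry the dual
  -- half-spaces at index zero.
  have hw0 : w = 0 := by
    funext i
    obtain ⟨k, hk⟩ := (h₀.dual_iff hv _).1 ((h.dual_iff hw _).2 ⟨i, rfl⟩)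
    obtain ⟨j, hj⟩ := (hc0 _).1 ⟨a k, Finset.mem_map_of_mem a (Finset.mem_univ k), hk⟩
    exact (h.inj _ _ _ _ hj).2.symm
  rw [hw, hw0, unitCube_eq]

end

/-! ### Minimal vertices and spans in the essential characteristic set. -/

namespace CubeComplex

variable {V : Type*} {X : CubeComplex V} {G : Type*} [Group G] [MulAction G V]
  {g : G} {d : ℕ} {c : Fin d → ℤ → Set V} {σ : Equiv.Perm (Fin d)} {t : Fin d → ℤ}
  {pos : Set V → ℤ} {ℓ : ℤ} {φ : X.EssVertex g → Fin d → ℤ} {C : Set (X.EssVertex g)}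

theorem dualPos_eq (h : IsSageevChart (X.axisPos g) (X.axis g) pos c φ)
    (hC : φ '' C = unitCube d) : X.dualPos g C = {H | ∃ i, c i 0 = H} := by
  rw [unitCube_eq] at hC
  ext H
  exact h.dual_iff hC H

/-- A minimal vertex belongs to none of the dual half-spaces `c i 0`, which fixes its coordinates in
the unit cube. Conversely, the vertex with all coordinates one serves as the other end of the
interval. -/
theorem isMinimalVertex_iff (h : IsSageevChart (X.axisPos g) (X.axis g) pos c φ)
    (hC : φ '' C = unitCube d) (o : X.EssVertex g) :
    X.IsMinimalVertex g C o ↔ o ∈ C ∧ φ o = 0 := by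
  constructor
  · rintro ⟨ho, y, hy, hoy⟩
    refine ⟨ho, funext fun i => ?_⟩
    have h1 : c i 0 ∈ SageevVertex.interval o y := by
      rw [← hoy, dualPos_eq h hC]
      exact ⟨i, rfl⟩
    have h2 : ¬ 0 < φ o i := fun h0 => h1.2.2 ((h.coord o i 0).2 h0)
    have h3 : φ o ∈ unitCube d := hC ▸ ⟨o, ho, rfl⟩
    have h4 := h3 i
    change φ o i = 0
    omega
  · rintro ⟨ho, h0⟩
    have h1 : (1 : Fin d → ℤ) ∈ φ '' C := by
      rw [hC]
      exact fun i => Or.inr rfl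
    obtain ⟨y, hy, hy1⟩ := h1
    refine ⟨ho, y, hy, ?_⟩
    rw [dualPos_eq h hC, h.interval_eq (by rw [h0, hy1]; exact zero_le_one), h0, hy1]
    ext H
    constructor
    · rintro ⟨i, rfl⟩
      exact ⟨i, 0, rfl, le_rfl, zero_lt_one⟩
    · rintro ⟨i, n, rfl, h2, h3⟩
      refine ⟨i, ?_⟩
      simp only [Pi.zero_apply, Pi.one_apply] at h2 h3
      congr 1
      omega

theorem exists_isMinimalVertex (h : IsSageevChart (X.axisPos g) (X.axis g) pos c φ)
    (hC : φ '' C = unitCube d) : ∃ o, X.IsMinimalVertex g C o := by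
  have h1 : (0 : Fin d → ℤ) ∈ φ '' C := by
    rw [hC]
    exact fun i => Or.inl rfl
  obtain ⟨o, ho, h0⟩ := h1
  exact ⟨o, (isMinimalVertex_iff h hC o).2 ⟨ho, h0⟩⟩

/-- Since `g` shrinks every half-space, upper bounds may be taken in `A` and lower bounds in `gA`.
-/
theorem closedSpan_eq (hT : IsTranslatedSystem (X.axisPos g) pos ℓ g)
    (hs : IsEquivariantChainSystem (X.axisPos g) g c σ t) :
    X.closedSpan g {H | ∃ i, c i 0 = H} = chainSpan (X.axisPos g) c g := by
  have hle : ∀ i, g • c i 0 ⊆ c i 0 := fun i => (hT.smul_ssubset _ (hs.mem i 0)).subset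
  ext K
  constructor
  · rintro ⟨hK, H, hH, H', hH', h1, h2⟩
    refine ⟨hK, ?_, ?_⟩
    · rcases hH with ⟨i, rfl⟩ | ⟨_, ⟨i, rfl⟩, rfl⟩
      exacts [⟨i, h2⟩, ⟨i, h2.trans (hle i)⟩]
    · rcases hH' with ⟨i, rfl⟩ | ⟨_, ⟨i, rfl⟩, rfl⟩
      exacts [⟨i, (hle i).trans h1⟩, ⟨i, h1⟩]
  · rintro ⟨hK, ⟨i, hi⟩, j, hj⟩
    exact ⟨hK, _, Or.inl ⟨i, rfl⟩, _, Or.inr ⟨_, ⟨j, rfl⟩, rfl⟩, hj, hi⟩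

/-- Removing `gA` deletes from each chain exactly the last index of its part of the span. -/
theorem halfOpenSpan_eq (hT : IsTranslatedSystem (X.axisPos g) pos ℓ g)
    (h : IsSageevChart (X.axisPos g) (X.axis g) pos c φ)
    (hs : IsEquivariantChainSystem (X.axisPos g) g c σ t) :
    X.halfOpenSpan g {H | ∃ i, c i 0 = H} =
      {H | ∃ j n, c j n = H ∧ 0 ≤ n ∧ n < t (σ.symm j)} := by
  have hmem : ∀ j n, c j n ∈ g • {H | ∃ i, c i 0 = H} ↔ n = t (σ.symm j) := by
    intro j n
    constructor
    · rintro ⟨_, ⟨i, rfl⟩, hi⟩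
      change g • c i 0 = c j n at hi
      rw [hs.smul, zero_add] at hi
      obtain ⟨rfl, rfl⟩ := hs.inj _ _ _ _ hi
      rw [Equiv.symm_apply_apply]
    · rintro rfl
      refine ⟨_, ⟨σ.symm j, rfl⟩, ?_⟩
      change g • c (σ.symm j) 0 = _
      rw [hs.smul, zero_add, Equiv.apply_symm_apply]
  rw [halfOpenSpan, closedSpan_eq hT hs]
  ext H
  constructor
  · rintro ⟨h1, h2⟩
    obtain ⟨j, n, rfl⟩ := hs.surj H h1.1
    rw [hmem] at h2
    have h3 := (hs.mem_chainSpan h _ _).1 h1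
    exact ⟨j, n, rfl, h3.1, lt_of_le_of_ne h3.2 h2⟩
  · rintro ⟨j, n, rfl, h1, h2⟩
    exact ⟨(hs.mem_chainSpan h _ _).2 ⟨h1, h2.le⟩, fun h0 => h2.ne ((hmem _ _).1 h0)⟩

theorem IsCAT0.exists_isTranslatedSystem [CubicalAction G X] (hX : X.IsCAT0)
    (hg : X.IsHyperbolic g) (hnt : X.ActsNonTransversely g) :
    ∃ pos, IsTranslatedSystem (X.axisPos g) pos (X.translationDist g) g := by
  obtain ⟨pos, hpos, hsmul⟩ := hX.exists_isRankedSystem hg hnt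
  exact ⟨pos, hpos, by exact_mod_cast hg.2, fun H hH => X.smul_mem_axisPos g hH,
    fun H hH => X.inv_smul_mem_axisPos g hH, fun H hH => (hsmul H hH).1,
    fun H hH => (hsmul H hH).2⟩

end CubeComplex

theorem mainTheorem4 {V : Type*} (X : CubeComplex V) (hX : X.IsCAT0)
    {G : Type*} [Group G] [MulAction G V] [CubicalAction G X]
    (hG : ∀ h : G, X.ActsWithoutInversion h)
    (g : G) (hg : X.IsHyperbolic g) (hnt : X.ActsNonTransversely g) :
    ∃ d : ℕ, (X.ess g).dim = d ∧
      ∀ C : Set (X.EssVertex g), (X.ess g).IsCubeOfDim d C →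
        ∃ (α : Subgroup.zpowers g →* Equiv.Perm (Fin d → ℤ))
          (φ : X.EssVertex g → Fin d → ℤ)
          (Φ : Set V → Set (Fin d → ℤ)),
          -- `⟨g⟩` acts on `ℝ^d` by automorphisms of its standard cubing
          (∀ h, ∀ Q ∈ (stdCubing d).cubes, α h '' Q ∈ (stdCubing d).cubes) ∧
          -- `φ` is an equivariant isometric embedding of cube complexes
          (∀ h x, φ (h • x) = α h (φ x)) ∧
          (∀ x y, (stdCubing d).graph.edist (φ x) (φ y) = (X.ess g).graph.edist x y) ∧
          (∀ Q ∈ (X.ess g).cubes, φ '' Q ∈ (stdCubing d).cubes) ∧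
          -- (1)
          φ '' C = unitCube d ∧
          -- (2): `Φ` is the map on half-spaces induced by `φ`
          (∀ H ∈ X.axis g, φ ⁻¹' Φ H = SageevVertex.half (X.axis g) H) ∧
          Set.BijOn Φ (X.axis g) (stdCubing d).halfspaces ∧
          Φ '' X.axisPos g = stdPosHalfspaces d ∧
          -- (3)
          (∀ hd : 0 < d, ∃ l : List (Set V), IsSegment (X.axis g) l ∧
            {H | H ∈ l} = X.closedSpan g (X.dualPos g C) ∩ Φ ⁻¹' coordHalfspaces d ⟨0, hd⟩) ∧
          -- (4)
          (∃ o, X.IsMinimalVertex g C o) ∧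
          (∀ o, X.IsMinimalVertex g C o → X.halfOpenSpan g (X.dualPos g C) =
            SageevVertex.interval o ((⟨g, Subgroup.mem_zpowers g⟩ : Subgroup.zpowers g) • o)) := by

  have h𝓗 : ∀ H, H ∈ X.axis g ↔ H ∈ X.axisPos g ∨ Hᶜ ∈ X.axisPos g := fun H => Iff.rfl
  obtain ⟨pos, hT⟩ := hX.exists_isTranslatedSystem hg hnt
  -- An arbitrary maximum antichain gives provisional coordinates. They determine the dimension and
  -- identify the half-spaces dual to `C`, from which the final coordinates are built.
  obtain ⟨A, hA, hmax⟩ := hT.exists_max_antichain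
  obtain ⟨c₀, σ₀, t₀, hs₀, -⟩ := hT.exists_chains hA rfl hmax
  obtain ⟨φ₀, h₀⟩ := exists_isSageevChart hT.toIsRankedSystem hs₀.toIsChainSystem h𝓗
  refine ⟨A.card, h₀.dim_eq hs₀.antichain, fun C hC => ?_⟩
  obtain ⟨c, σ, t, φ, h, hs, hφC⟩ := hT.exists_chart_of_cube h𝓗 hmax h₀ hC
  obtain ⟨α, hα, hαg⟩ := exists_zpowers_action (latticeShift σ t) (hs.pow_latticeShift_eq_one hT)
  have hφg : ∀ x : X.EssVertex g,
      φ ((⟨g, Subgroup.mem_zpowers g⟩ : Subgroup.zpowers g) • x) = latticeShift σ t (φ x) :=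
    fun x => hs.coord_smul h rfl
  refine ⟨α, φ, chartHalf c, hα, ?_, h.edist_eq, fun Q hQ => h.image_cube_mem hQ, hφC,
    fun H hH => h.preimage_chartHalf hH, h.bijOn_chartHalf, h.image_chartHalf, fun hd => ?_,
    CubeComplex.exists_isMinimalVertex h hφC, fun o ho => ?_⟩
  · exact forall_zpowers_equivariant α φ fun x => by rw [hαg, hφg]
  · rw [CubeComplex.dualPos_eq h hφC, CubeComplex.closedSpan_eq hT hs]
    exact hs.exists_segment h hd
  · have h0 := ((CubeComplex.isMinimalVertex_iff h hφC o).1 ho).2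
    -- The vertex `o` is the origin and `go` has coordinates `t (σ.symm j)`, so the half-spaces
    -- separating them have the same index ranges as the half-open span.
    have hN : ∀ j, latticeShift σ t (0 : Fin A.card → ℤ) j = t (σ.symm j) := fun j => by
      rw [latticeShift_apply, Pi.zero_apply, zero_add]
    rw [CubeComplex.dualPos_eq h hφC, CubeComplex.halfOpenSpan_eq hT h hs, h.interval_eq]
    · simp only [hφg, h0, hN, Pi.zero_apply]
    · intro j
      rw [hφg, h0, hN]
      exact hs.shift_nonneg hT _
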